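/- **Setting.** Let $\mathcal K$ be the set of open double cones of four-dimensional Minkowski spacetime, and write $a\perp b$ when $a,b\in\mathcal K$ are spacelike separated. Let $\mathcal H$ be an infinite-dimensional separable complex Hilbert space and $a\mapsto\mathfrak A(a)$ a map from $\mathcal K$ to the von Neumann algebras on $\mathcal H$ which is isotonous, local ($a\perp b\Rightarrow\mathfrak A(a)\subseteq\mathfrak A(b)'$), irreducible (the C*-algebra $\mathfrak A$ generated by all $\mathfrak A(a)$ has commutant $\mathbb C1$) and satisfies Haag duality $\mathfrak A(a^\perp)'=\mathfrak A(a)$, where $\mathfrak A(a^\perp)$ is the C*-algebra generated by the $\mathfrak A(b)$ with $b$ contained in the spacelike complement $a^\perp$ of $a$. **The category $\mathcal B(\boldsymbol{\mathfrak A})$.** A morphism of multiplicity $n_\rho$ is a (not necessarily unital) *-homomorphism $\rho:\mathfrak A\to B(\mathcal H)\otimes M_{n_\rho}$. It is localized in $o\in\mathcal K$ if $\rho(A)=(A\otimes 1)\rho(1)$ for all $A\in\mathfrak A(a)$, $a\perp o$. An intertwiner $T\in(\rho,\sigma)$ is a bounded operator $\mathcal H\otimes\mathbb C^{n_\rho}\to\mathcal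 H\otimes\mathbb C^{n_\sigma}$ with $T\rho(1)=T=\sigma(1)T$ and $T\rho(A)=\sigma(A)T$ for all $A\in\mathfrak A$; the identity arrow is $1_\rho=\rho(1)$, and an isometry (unitary) $V\in(\rho,\sigma)$ satisfies $V^+V=1_\rho$ (and $VV^+=1_\sigma$). A localized $\rho$ is transportable if for every $o\in\mathcal K$ there is a unitary in $(\rho,\tau)$ for some $\tau$ localized in $o$. A bimodule is a morphism with values in $\mathfrak A\otimes M_{n_\rho}$; bimodules form a category with the intertwiners with entries in $\mathfrak A$ as arrows. $\mathcal B(\boldsymbol{\mathfrak A})$ is its full subcategory of the bimodules that are localized and transportable as morphisms. The tensor product of bimodules is $\rho\sigma(A)_{i,j}=\rho(\sigma(A)_{i_2,j_2})_{i_1,j_1}$ and $(T\times S)_{i,j}=\sum_kT_{i_1,k}\,\rho_1(S_{i_2,j_2})_{k,j_1}$ for $T\in(\rho_1,\rho_2)$, $S\in(\sigma_1,\sigma_2)$, with $i=i_1+n\,i_2$ and $j=j_1+n'j_2$ for the respective multiplicities $n,n'$ of the first factors; the unit object is $\iota(A)=A$. The symmetry is $\varepsilon(\rho,\sigma)=(V^+\times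 U^+)\,\theta\,(U\times V)\in(\rho\sigma,\sigma\rho)$, where $U\in(\rho,\rho_1)$, $V\in(\sigma,\sigma_1)$ are unitaries with $\rho_1,\sigma_1$ localized in spacelike separated double cones and $\theta$ is the flip of the two index spaces (the result does not depend on the choices). The arrows $1_{\rho^i}\times\varepsilon(\rho,\rho)\times1_{\rho^{d-i-2}}$ represent the adjacent transpositions and so induce a representation $\varepsilon^d_\rho$ of the permutation group of $d$ elements in $(\rho^d,\rho^d)$; let $A_d=\frac1{d!}\sum_p\operatorname{sgn}(p)\,\varepsilon^d_\rho(p)$ and $S_d=\frac1{d!}\sum_p\varepsilon^d_\rho(p)$. **Properties of objects.** An object $\rho$ of $\mathcal B(\boldsymbol{\mathfrak A})$ is * irreducible if $(\rho,\rho)=\mathbb C1_\rho$; * simple if $\varepsilon(\rho,\rho)=\pm1_{\rho^2}$; * faithful if it is injective on $\mathfrak A$; * doubly faithful if for each $a\in\mathcal K$ the map ${}_a\rho(A)=U^+(A\otimes1)U$, $A\in\mathfrak A(a)'$, is injective, where $U\in(\rho,\tau)$ is a unitary with $\tau$ localized in $a$ (the map does not depend on $\tau$ and $U$). An object $\alpha$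 is a direct sum of a finite, possibly empty, family $\rho_i$ if there are isometries $W_i\in(\rho_i,\alpha)$ with $\sum_iW_iW_i^+=1_\alpha$. Let $\mathcal B(\boldsymbol{\mathfrak A})_{\mathrm{fh}}$ be the full subcategory of $\mathcal B(\boldsymbol{\mathfrak A})$ of the finite direct sums of irreducible objects $\rho$ for which there are an integer $d\ge1$, a simple, faithful and doubly faithful object $\gamma$ and an isometry $V\in(\gamma,\rho^d)$ with $VV^+=A_d$ or $VV^+=S_d$. An object $\rho$ has conjugates if there are an object $\overline\rho$ and arrows $R\in(\iota,\overline\rho\rho)$, $\overline R\in(\iota,\rho\overline\rho)$ with $$(\overline R^+\times1_\rho)(1_\rho\times R)=1_\rho,\qquad(R^+\times1_{\overline\rho})(1_{\overline\rho}\times\overline R)=1_{\overline\rho}.$$ **Theorem 4.4.** If every local algebra $\mathfrak A(a)$, $a\in\mathcal K$, is properly infinite (every nonzero central projection is infinite), then $\mathcal B(\boldsymbol{\mathfrak A})_{\mathrm{fh}}$ is exactly the full subcategory of $\mathcal B(\boldsymbol{\mathfrak A})$ whose objects have conjugates. -/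

import Mathlib

open scoped Matrix

noncomputable section

namespace Superselection

/-! ### Minkowski spacetime and double cones -/

/-- Four-dimensional Minkowski spacetime: a time coordinate and three space coordinates. -/
abbrev Minkowski : Type := ℝ × EuclideanSpace ℝ (Fin 3)

/-- `y` lies in the open forward light cone of `x`. -/
def Chronological (x y : Minkowski) : Prop := ‖y.2 - x.2‖ < y.1 - x.1

/-- `x` and `y` are spacelike separated. -/
def SpacelikeSep (x y : Minkowski) : Prop := |y.1 - x.1| < ‖y.2 - x.2‖

/-- Open double cones: nonempty intersections of an open forward cone and an open backward cone. -/
def IsDoubleCone (S : Set Minkowski) : Prop :=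
  ∃ x y, Chronological x y ∧ S = {z | Chronological x z ∧ Chronological z y}

/-- The set of the open double cones. -/
abbrev DoubleCone : Type := {S : Set Minkowski // IsDoubleCone S}

/-- Spacelike complement of a region. -/
def spacelikeCompl (S : Set Minkowski) : Set Minkowski := {z | ∀ x ∈ S, SpacelikeSep x z}

/-- The relation `a ⊥ b`: every point of `a` is spacelike to every point of `b`. -/
def Perp (a b : DoubleCone) : Prop := a.1 ⊆ spacelikeCompl b.1

/-! ### Nets of von Neumann algebras -/

section Net

variable {H : Type*} [NormedAddCommGroup H] [InnerProductSpace ℂ H] [CompleteSpace H]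

/-- The C*-algebra (norm closed star subalgebra) generated by the algebras `R a` with `a ⊆ S`. -/
def regionAlgebra (R : DoubleCone → VonNeumannAlgebra H) (S : Set Minkowski) :
    StarSubalgebra ℂ (H →L[ℂ] H) :=
  (StarAlgebra.adjoin ℂ
    (⋃ (a : DoubleCone) (_ : a.1 ⊆ S), (R a : Set (H →L[ℂ] H)))).topologicalClosure

variable (H) in
/-- A net of local observables in the reference representation: an isotonous, local net of von
Neumann algebras over the double cones that is irreducible and satisfies Haag duality. -/
structure ObservableNet where
  /-- the local algebras -/
  alg : DoubleCone → VonNeumannAlgebra H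
  isotony : ∀ a b : DoubleCone, a.1 ⊆ b.1 → (alg a : Set (H →L[ℂ] H)) ⊆ alg b
  locality : ∀ a b : DoubleCone, Perp a b →
    (alg a : Set (H →L[ℂ] H)) ⊆ (alg b).commutant
  irreducible : ∀ T : H →L[ℂ] H,
    (∀ A ∈ regionAlgebra alg Set.univ, A * T = T * A) → ∃ c : ℂ, T = c • 1
  haag_duality : ∀ a : DoubleCone,
    Set.centralizer (regionAlgebra alg (spacelikeCompl a.1) : Set (H →L[ℂ] H)) = alg a

/-- A von Neumann algebra is properly infinite if each of its nonzero central projections `z` is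
infinite, i.e. Murray-von Neumann equivalent (within the algebra) to a proper subprojection. -/
def IsProperlyInfinite (M : VonNeumannAlgebra H) : Prop :=
  ∀ z : H →L[ℂ] H, IsStarProjection z → z ∈ M → z ∈ M.commutant → z ≠ 0 →
    ∃ v ∈ M, star v * v = z ∧ z * v = v ∧ v * star v ≠ z

end Net

variable {H : Type*} [NormedAddCommGroup H] [InnerProductSpace ℂ H] [CompleteSpace H]

namespace ObservableNet

/-- The C*-algebra of the net. -/
abbrev quasilocal (N : ObservableNet H) : StarSubalgebra ℂ (H →L[ℂ] H) :=
  regionAlgebra N.alg Set.univ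

theorem alg_le_quasilocal (N : ObservableNet H) (a : DoubleCone) {A : H →L[ℂ] H}
    (hA : A ∈ N.alg a) : A ∈ N.quasilocal :=
  StarSubalgebra.le_topologicalClosure _
    (StarAlgebra.subset_adjoin _ _ (Set.mem_iUnion₂.2 ⟨a, Set.subset_univ _, hA⟩))

end ObservableNet

/-! ### Localized transportable morphisms -/

/-- `A ⊗ 1_n`, as a matrix with operator entries. -/
def amp (n : ℕ) (A : H →L[ℂ] H) : Matrix (Fin n) (Fin n) (H →L[ℂ] H) :=
  Matrix.diagonal fun _ => A

/-- A morphism of multiplicity `n` of the C*-algebra of the net: a (not necessarily unital)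
star homomorphism into `B(H) ⊗ M_n`, realised as the `n × n` matrices over `B(H)`. -/
structure Morphism (N : ObservableNet H) where
  n : ℕ
  hom : N.quasilocal →⋆ₙₐ[ℂ] Matrix (Fin n) (Fin n) (H →L[ℂ] H)

namespace Morphism

variable {N : ObservableNet H}

/-- `ρ` is localized in `o`. -/
def LocalizedIn (ρ : Morphism N) (o : DoubleCone) : Prop :=
  ∀ a : DoubleCone, Perp a o → ∀ (A : H →L[ℂ] H) (hA : A ∈ N.alg a),
    ρ.hom ⟨A, N.alg_le_quasilocal a hA⟩ = amp ρ.n A * ρ.hom 1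

/-- The intertwiners `(ρ, σ)`; a bounded operator `H ⊗ ℂ^{n_ρ} → H ⊗ ℂ^{n_σ}` is given by the
matrix of its entries. -/
def IsIntertwiner (ρ σ : Morphism N) (T : Matrix (Fin σ.n) (Fin ρ.n) (H →L[ℂ] H)) : Prop :=
  T * ρ.hom 1 = T ∧ σ.hom 1 * T = T ∧ ∀ A, T * ρ.hom A = σ.hom A * T

/-- Unitary intertwiners: `U` is unitary with respect to the units `ρ(1)` and `σ(1)`. -/
def IsUnitaryIntertwiner (ρ σ : Morphism N)
    (U : Matrix (Fin σ.n) (Fin ρ.n) (H →L[ℂ] H)) : Prop :=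
  IsIntertwiner ρ σ U ∧ Uᴴ * U = ρ.hom 1 ∧ U * Uᴴ = σ.hom 1

/-- `ρ` is transportable: every double cone carries a localized morphism unitarily equivalent
to `ρ`. -/
def IsTransportable (ρ : Morphism N) : Prop :=
  ∀ o : DoubleCone, ∃ τ : Morphism N, τ.LocalizedIn o ∧ ∃ U, IsUnitaryIntertwiner ρ τ U

/-- `ρ` belongs to the set of the localized transportable morphisms. -/
def IsLocalizedTransportable (ρ : Morphism N) : Prop :=
  (∃ o, ρ.LocalizedIn o) ∧ ρ.IsTransportable

/-- The component at the double cone `a` of the extension of `ρ` to a morphism of the presheaf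
`a ↦ 𝔄(a)'` of commutants: `A ↦ Uᴴ (A ⊗ 1) U`, where `U ∈ (ρ, τ)` is unitary and `τ` is localized
in `a`. On `𝔄(a)'` it does not depend on the choice of `τ` and `U`, see `presheafExt_eq`. -/
def presheafExt (ρ : Morphism N) (h : ρ.IsTransportable) (a : DoubleCone) (A : H →L[ℂ] H) :
    Matrix (Fin ρ.n) (Fin ρ.n) (H →L[ℂ] H) :=
  ((h a).choose_spec.2.choose)ᴴ * amp (h a).choose.n A * (h a).choose_spec.2.choose

@[simp]
theorem amp_mul_apply (n : ℕ) {m : ℕ} (A : H →L[ℂ] H) (T : Matrix (Fin n) (Fin m) (H →L[ℂ] H))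
    (i : Fin n) (j : Fin m) : (amp n A * T) i j = A * T i j := by
  simp [amp]

@[simp]
theorem mul_amp_apply (n : ℕ) {m : ℕ} (A : H →L[ℂ] H) (T : Matrix (Fin m) (Fin n) (H →L[ℂ] H))
    (i : Fin m) (j : Fin n) : (T * amp n A) i j = T i j * A := by
  simp [amp]

theorem LocalizedIn.hom_eq_mul_amp {ρ : Morphism N} {o a : DoubleCone} (h : ρ.LocalizedIn o)
    (hao : Perp a o) (A : H →L[ℂ] H) (hA : A ∈ N.alg a) :
    ρ.hom ⟨A, N.alg_le_quasilocal a hA⟩ = ρ.hom 1 * amp ρ.n A := by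
  have h1 := congrArg star (h a hao (star A) (star_mem hA))
  have h2 : star (⟨star A, N.alg_le_quasilocal a (star_mem hA)⟩ : N.quasilocal) =
      ⟨A, N.alg_le_quasilocal a hA⟩ := Subtype.ext (star_star A)
  rw [← map_star, h2, star_mul, ← map_star, star_one] at h1
  rw [h1]
  congr 1
  ext1 i j
  by_cases hij : i = j
  · subst hij; simp [amp, Matrix.star_apply]
  · simp [amp, Matrix.star_apply, hij, Ne.symm hij]

/-- Intertwiners between morphisms localized in `a` have entries in `𝔄(a)`. -/
theorem IsIntertwiner.entry_mem {σ τ : Morphism N} {a : DoubleCone} (hσ : σ.LocalizedIn a)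
    (hτ : τ.LocalizedIn a) {W : Matrix (Fin σ.n) (Fin τ.n) (H →L[ℂ] H)}
    (hW : IsIntertwiner τ σ W) (i : Fin σ.n) (j : Fin τ.n) : W i j ∈ N.alg a := by
  rw [← SetLike.mem_coe, ← N.haag_duality a]
  have key : regionAlgebra N.alg (spacelikeCompl a.1) ≤ StarSubalgebra.centralizer ℂ {W i j} := by
    refine StarSubalgebra.topologicalClosure_minimal (StarAlgebra.adjoin_le ?_) ?_
    · intro B hB
      obtain ⟨c, hc, hB⟩ := Set.mem_iUnion₂.1 hB
      have comm : ∀ B ∈ N.alg c, W i j * B = B * W i j := by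
        intro B hB
        have e := hW.2.2 ⟨B, N.alg_le_quasilocal c hB⟩
        rw [hτ.hom_eq_mul_amp hc B hB, hσ c hc B hB, ← Matrix.mul_assoc, hW.1, Matrix.mul_assoc,
          hW.2.1] at e
        have e' := congrFun (congrFun e i) j
        rwa [mul_amp_apply, amp_mul_apply] at e'
      rw [SetLike.mem_coe, StarSubalgebra.mem_centralizer_iff]
      intro g hg
      rw [Set.mem_singleton_iff] at hg
      subst hg
      refine ⟨comm B hB, ?_⟩
      have := congrArg star (comm (star B) (star_mem hB))
      simpa using this.symm
    · rw [StarSubalgebra.coe_centralizer]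
      exact Set.isClosed_centralizer _
  intro B hB
  exact (((StarSubalgebra.mem_centralizer_iff ℂ).1 (key hB)) (W i j) rfl).1.symm

/-- The extension of `ρ` to the commutants does not depend on the choices. -/
theorem presheafExt_eq (ρ : Morphism N) (h : ρ.IsTransportable) (a : DoubleCone) {A : H →L[ℂ] H}
    (hA : A ∈ (N.alg a).commutant) {σ : Morphism N} (hσ : σ.LocalizedIn a)
    {U : Matrix (Fin σ.n) (Fin ρ.n) (H →L[ℂ] H)} (hU : IsUnitaryIntertwiner ρ σ U) :
    ρ.presheafExt h a A = Uᴴ * amp σ.n A * U := by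
  unfold presheafExt
  have hτ := (h a).choose_spec.1
  have hV := (h a).choose_spec.2.choose_spec
  generalize (h a).choose_spec.2.choose = V at hV
  generalize (h a).choose = τ at hτ V hV
  have sa : ∀ κ : Morphism N, (κ.hom 1)ᴴ = κ.hom 1 := fun κ => by
    rw [← Matrix.star_eq_conjTranspose, ← map_star, star_one]
  have hUa : ∀ B, ρ.hom B * Vᴴ = Vᴴ * τ.hom B := fun B => by
    have e := congrArg Matrix.conjTranspose (hV.1.2.2 (star B))
    simp only [Matrix.conjTranspose_mul] at e
    simpa only [← Matrix.star_eq_conjTranspose, ← map_star, star_star] using e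
  have hW : IsIntertwiner τ σ (U * Vᴴ) := by
    refine ⟨?_, ?_, fun B => ?_⟩
    · rw [Matrix.mul_assoc, ← hUa, ← Matrix.mul_assoc, hU.1.1]
    · rw [← Matrix.mul_assoc, hU.1.2.1]
    · rw [Matrix.mul_assoc, ← hUa, ← Matrix.mul_assoc, hU.1.2.2, Matrix.mul_assoc]
  have comm : U * Vᴴ * amp τ.n A = amp σ.n A * (U * Vᴴ) := by
    ext1 i j
    rw [mul_amp_apply, amp_mul_apply]
    exact VonNeumannAlgebra.mem_commutant_iff.1 hA _ (hW.entry_mem hσ hτ i j)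
  have hUV : U = U * Vᴴ * V := by rw [Matrix.mul_assoc, hV.2.1, hU.1.1]
  calc Vᴴ * amp τ.n A * V = ρ.hom 1 * Vᴴ * amp τ.n A * V := by
        rw [hUa, ← sa τ, ← Matrix.conjTranspose_mul, hV.1.2.1]
    _ = Uᴴ * (U * Vᴴ * amp τ.n A) * V := by rw [← hU.2.1]; simp only [Matrix.mul_assoc]
    _ = Uᴴ * amp σ.n A * (U * Vᴴ * V) := by rw [comm]; simp only [Matrix.mul_assoc]
    _ = Uᴴ * amp σ.n A * U := by rw [← hUV]

end Morphism

/-! ### The tensor category of bimodules of the C*-algebra of the net -/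

/-- A bimodule of multiplicity `n` of the C*-algebra `𝔄` of the net: a (not necessarily unital)
star homomorphism `𝔄 → 𝔄 ⊗ M_n`. -/
structure Bimodule (N : ObservableNet H) where
  n : ℕ
  hom : N.quasilocal →⋆ₙₐ[ℂ] Matrix (Fin n) (Fin n) N.quasilocal

namespace Bimodule

variable {N : ObservableNet H}

/-- The homomorphism of `ρ` with its values regarded as matrices over `B(H)`. -/
def operatorHom (ρ : Bimodule N) :
    N.quasilocal →⋆ₙₐ[ℂ] Matrix (Fin ρ.n) (Fin ρ.n) (H →L[ℂ] H) where
  toFun A := (ρ.hom A).map Subtype.val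
  map_smul' c A := by ext1 i j; simp
  map_zero' := by ext1 i j; simp
  map_add' A B := by ext1 i j; simp
  map_mul' A B := by ext1 i j; simp [Matrix.mul_apply]
  map_star' A := by ext1 i j; simp [map_star, Matrix.star_apply]

@[simp]
theorem operatorHom_apply (ρ : Bimodule N) (A : N.quasilocal) (i j : Fin ρ.n) :
    operatorHom ρ A i j = (ρ.hom A i j : H →L[ℂ] H) := rfl

/-- The underlying morphism into `B(H) ⊗ M_n`. -/
abbrev toMorphism (ρ : Bimodule N) : Morphism N := ⟨ρ.n, operatorHom ρ⟩

/-- The identity arrow `1_ρ = ρ(1)`. -/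
def unit (ρ : Bimodule N) : Matrix (Fin ρ.n) (Fin ρ.n) N.quasilocal := ρ.hom 1

/-- The arrows `(ρ, σ)`: intertwiners with values in `𝔄`. Composition is the matrix product and
the adjoint is the conjugate transpose. -/
def IsArrow (ρ σ : Bimodule N) (T : Matrix (Fin σ.n) (Fin ρ.n) N.quasilocal) : Prop :=
  T * ρ.unit = T ∧ σ.unit * T = T ∧ ∀ A, T * ρ.hom A = σ.hom A * T

/-- Isometries in `(ρ, σ)`. -/
def IsIsometry (ρ σ : Bimodule N) (V : Matrix (Fin σ.n) (Fin ρ.n) N.quasilocal) : Prop :=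
  IsArrow ρ σ V ∧ Vᴴ * V = ρ.unit

/-- Unitaries in `(ρ, σ)`. -/
def IsUnitary (ρ σ : Bimodule N) (V : Matrix (Fin σ.n) (Fin ρ.n) N.quasilocal) : Prop :=
  IsIsometry ρ σ V ∧ V * Vᴴ = σ.unit

/-- `ρ` is irreducible: `(ρ, ρ) = ℂ 1_ρ`. -/
def IsIrreducible (ρ : Bimodule N) : Prop :=
  ∀ T, IsArrow ρ ρ T → ∃ c : ℂ, T = c • ρ.unit

/-- The homomorphism `A ↦ A` of multiplicity one. -/
def iotaHom (N : ObservableNet H) : N.quasilocal →⋆ₙₐ[ℂ] Matrix (Fin 1) (Fin 1) N.quasilocal where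
  toFun A := Matrix.of fun _ _ => A
  map_smul' c A := by ext1 i j; simp
  map_zero' := by ext1 i j; simp
  map_add' A B := by ext1 i j; simp
  map_mul' A B := by ext1 i j; simp [Matrix.mul_apply]
  map_star' A := by ext1 i j; simp [Matrix.star_apply]

@[simp]
theorem iotaHom_apply (A : N.quasilocal) (i j : Fin 1) : iotaHom N A i j = A := rfl

/-- The tensor unit `ι`. -/
abbrev iota (N : ObservableNet H) : Bimodule N := ⟨1, iotaHom N⟩

/-- The homomorphism `ρσ(A)_{i,j} = ρ(σ(A)_{i₂,j₂})_{i₁,j₁}` for `i = i₁ + n_ρ i₂` and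
`j = j₁ + n_ρ j₂`; here `finProdFinEquiv (i₂, i₁) = i₁ + n_ρ i₂`. -/
def tensorHom (ρ σ : Bimodule N) :
    N.quasilocal →⋆ₙₐ[ℂ] Matrix (Fin (σ.n * ρ.n)) (Fin (σ.n * ρ.n)) N.quasilocal where
  toFun A := Matrix.of fun i j =>
    ρ.hom (σ.hom A (finProdFinEquiv.symm i).1 (finProdFinEquiv.symm j).1)
      (finProdFinEquiv.symm i).2 (finProdFinEquiv.symm j).2
  map_smul' c A := by ext1 i j; simp
  map_zero' := by ext1 i j; simp
  map_add' A B := by ext1 i j; simp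
  map_mul' A B := by
    ext1 i j
    simp only [map_mul, Matrix.mul_apply, Matrix.of_apply, map_sum, Matrix.sum_apply]
    rw [← finProdFinEquiv.sum_comp, Fintype.sum_prod_type]
    simp
  map_star' A := by
    ext1 i j
    simp [map_star, Matrix.star_apply]

theorem tensorHom_apply (ρ σ : Bimodule N) (A : N.quasilocal) (i j : Fin (σ.n * ρ.n)) :
    tensorHom ρ σ A i j =
      ρ.hom (σ.hom A (finProdFinEquiv.symm i).1 (finProdFinEquiv.symm j).1)
        (finProdFinEquiv.symm i).2 (finProdFinEquiv.symm j).2 := rfl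

/-- The tensor product `ρσ` of objects. -/
abbrev tensor (ρ σ : Bimodule N) : Bimodule N := ⟨σ.n * ρ.n, tensorHom ρ σ⟩

/-- The tensor product of an arrow `T` with source `ρ₁` and an arrow `S`:
`(T × S)_{i,j} = ∑ₖ T_{i₁,k} ρ₁(S_{i₂,j₂})_{k,j₁}`, with the same ordering of the indices. -/
def times (ρ₁ : Bimodule N) {m p q : ℕ} (T : Matrix (Fin m) (Fin ρ₁.n) N.quasilocal)
    (S : Matrix (Fin p) (Fin q) N.quasilocal) :
    Matrix (Fin (p * m)) (Fin (q * ρ₁.n)) N.quasilocal :=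
  Matrix.of fun i j => ∑ k,
    T (finProdFinEquiv.symm i).2 k *
      ρ₁.hom (S (finProdFinEquiv.symm i).1 (finProdFinEquiv.symm j).1) k
        (finProdFinEquiv.symm j).2

/-- Rewrites the sizes of a matrix along equalities, without changing the entries. It only serves
to identify `(ρσ)τ` with `ρ(στ)`, which agree index by index. -/
def recast {R : Type*} {m m' n n' : ℕ} (hm : m = m') (hn : n = n')
    (T : Matrix (Fin m) (Fin n) R) : Matrix (Fin m') (Fin n') R :=
  T.submatrix (Fin.cast hm.symm) (Fin.cast hn.symm)

/-- The `d`-fold tensor power `ρ^d`. -/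
def power (ρ : Bimodule N) : ℕ → Bimodule N
  | 0 => iota N
  | d + 1 => tensor (power ρ d) ρ

/-! ### Symmetry -/

/-- The flip `θ(n, m)` of the two tensor factors `ℂ^n` and `ℂ^m`. -/
def theta (N : ObservableNet H) (n m : ℕ) :
    Matrix (Fin (n * m)) (Fin (m * n)) N.quasilocal :=
  Matrix.of fun i j => if finProdFinEquiv.symm i = (finProdFinEquiv.symm j).swap then 1 else 0

/-- `E = (V⁺ × U⁺) θ (U × V)` for unitaries `U ∈ (ρ, ρ₁)`, `V ∈ (σ, σ₁)` whose targets are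
localized in mutually spacelike double cones. -/
def IsExchange (ρ σ : Bimodule N)
    (E : Matrix (Fin (tensor σ ρ).n) (Fin (tensor ρ σ).n) N.quasilocal) : Prop :=
  ∃ (o₁ o₂ : DoubleCone) (ρ₁ σ₁ : Bimodule N)
    (U : Matrix (Fin ρ₁.n) (Fin ρ.n) N.quasilocal) (V : Matrix (Fin σ₁.n) (Fin σ.n) N.quasilocal),
    Perp o₁ o₂ ∧ ρ₁.toMorphism.LocalizedIn o₁ ∧ σ₁.toMorphism.LocalizedIn o₂ ∧
    IsUnitary ρ ρ₁ U ∧ IsUnitary σ σ₁ V ∧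
    E = times σ₁ Vᴴ Uᴴ * theta N ρ₁.n σ₁.n * times ρ U V

open Classical in
/-- The symmetry `ε(ρ, σ) ∈ (ρσ, σρ)`; for localized transportable `ρ` and `σ` it does not depend
on the choices of the double cones and of the unitaries (junk value `0` for other bimodules). -/
def symmetry (ρ σ : Bimodule N) :
    Matrix (Fin (tensor σ ρ).n) (Fin (tensor ρ σ).n) N.quasilocal :=
  if h : ∃ E, IsExchange ρ σ E then h.choose else 0

/-- The arrow `1_{ρ^i} × ε(ρ, ρ) × 1_{ρ^{d-i-2}}` of `(ρ^d, ρ^d)`, which exchanges the (zero-based)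
factors `i` and `i + 1` (meaningful for `i + 1 < d`). -/
def exchangeAt (ρ : Bimodule N) :
    (d i : ℕ) → Matrix (Fin (power ρ d).n) (Fin (power ρ d).n) N.quasilocal
  | 0, _ => (power ρ 0).unit
  | 1, _ => (power ρ 1).unit
  | d + 2, i =>
    if i = d then
      recast (Nat.mul_assoc ρ.n ρ.n (power ρ d).n) (Nat.mul_assoc ρ.n ρ.n (power ρ d).n)
        (times (power ρ d) (power ρ d).unit (symmetry ρ ρ))
    else times (power ρ (d + 1)) (exchangeAt ρ (d + 1) i) ρ.unit

/-- `π` is the representation `ε^d_ρ` of the permutation group of `d` elements in `(ρ^d, ρ^d)`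
induced by the symmetry; it is unique, since adjacent transpositions generate. -/
def IsPermutationRep (ρ : Bimodule N) (d : ℕ)
    (π : Equiv.Perm (Fin d) → Matrix (Fin (power ρ d).n) (Fin (power ρ d).n) N.quasilocal) :
    Prop :=
  π 1 = (power ρ d).unit ∧ (∀ p q, π (p * q) = π p * π q) ∧
    ∀ (i : ℕ) (h : i + 1 < d), π (Equiv.swap ⟨i, by omega⟩ ⟨i + 1, h⟩) = exchangeAt ρ d i

/-- The totally antisymmetric projector attached to a representation of the permutation group. -/
def antisymmetrizer {d m : ℕ} (π : Equiv.Perm (Fin d) → Matrix (Fin m) (Fin m) N.quasilocal) :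
    Matrix (Fin m) (Fin m) N.quasilocal :=
  ((d.factorial : ℂ)⁻¹) • ∑ p, (((Equiv.Perm.sign p : ℤˣ) : ℤ) : ℂ) • π p

/-- The totally symmetric projector attached to a representation of the permutation group. -/
def symmetrizer {d m : ℕ} (π : Equiv.Perm (Fin d) → Matrix (Fin m) (Fin m) N.quasilocal) :
    Matrix (Fin m) (Fin m) N.quasilocal :=
  ((d.factorial : ℂ)⁻¹) • ∑ p, π p

/-- `γ` is simple: `ε(γ, γ) = χ 1_{γγ}` with `χ ∈ {1, -1}`. -/
def IsSimple (γ : Bimodule N) : Prop :=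
  ∃ χ : ℂ, (χ = 1 ∨ χ = -1) ∧ symmetry γ γ = χ • (tensor γ γ).unit

/-- `ρ` is faithful. -/
def IsFaithful (ρ : Bimodule N) : Prop := Function.Injective ρ.hom

end Bimodule

/-! ### The category of localized transportable bimodules -/

/-- Objects of the category of the localized transportable bimodules of the net. -/
structure LTBimodule (N : ObservableNet H) extends Bimodule N where
  mem : toBimodule.toMorphism.IsLocalizedTransportable

namespace LTBimodule

open Bimodule CategoryTheory

variable {N : ObservableNet H}

/-- The category of the localized transportable bimodules, a full subcategory of the category of
bimodules. -/
instance : Category (LTBimodule N) where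
  Hom ρ σ := {T : Matrix (Fin σ.n) (Fin ρ.n) N.quasilocal // IsArrow ρ.toBimodule σ.toBimodule T}
  id ρ := ⟨ρ.unit, by
    refine ⟨?_, ?_, fun A => ?_⟩
    · rw [unit, ← map_mul, one_mul]
    · rw [unit, ← map_mul, one_mul]
    · rw [unit, ← map_mul, ← map_mul, one_mul, mul_one]⟩
  comp T S := ⟨S.1 * T.1, by
    obtain ⟨T, hT₁, hT₂, hT₃⟩ := T
    obtain ⟨S, hS₁, hS₂, hS₃⟩ := S
    refine ⟨?_, ?_, fun A => ?_⟩
    · simp only [Matrix.mul_assoc, hT₁]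
    · simp only [← Matrix.mul_assoc, hS₂]
    · simp only [Matrix.mul_assoc, hT₃]
      simp only [← Matrix.mul_assoc, hS₃]⟩
  id_comp T := Subtype.ext T.2.1
  comp_id T := Subtype.ext T.2.2.1
  assoc _ _ _ := Subtype.ext (Matrix.mul_assoc _ _ _).symm

/-- `ρ` is doubly faithful: all components of its extension to the presheaf of commutants are
faithful. -/
def IsDoublyFaithful (ρ : LTBimodule N) : Prop :=
  ∀ a : DoubleCone, Set.InjOn (ρ.toMorphism.presheafExt ρ.mem.2 a)
    ((N.alg a).commutant : Set (H →L[ℂ] H))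

/-- `α` is a direct sum of the finite family `ρ` (the empty family gives the zero objects). -/
def IsDirectSum {k : ℕ} (α : LTBimodule N) (ρ : Fin k → LTBimodule N) : Prop :=
  ∃ W : (i : Fin k) → Matrix (Fin α.n) (Fin (ρ i).n) N.quasilocal,
    (∀ i, IsIsometry (ρ i).toBimodule α.toBimodule (W i)) ∧ ∑ i, W i * (W i)ᴴ = α.unit

/-- `(d, γ, V)` is a 3-tuple associated with `ρ`: `d` is a positive integer, `γ` is a faithful
simple object and `V ∈ (γ, ρ^d)` is an isometry onto the totally antisymmetric or the totally
symmetric projector of `ρ^d`. -/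
def IsStatisticsTriple (ρ : LTBimodule N) (d : ℕ) (γ : LTBimodule N)
    (V : Matrix (Fin (power ρ.toBimodule d).n) (Fin γ.n) N.quasilocal) : Prop :=
  1 ≤ d ∧ IsSimple γ.toBimodule ∧ IsFaithful γ.toBimodule ∧
    IsIsometry γ.toBimodule (power ρ.toBimodule d) V ∧
    ∃ π, IsPermutationRep ρ.toBimodule d π ∧
      (V * Vᴴ = antisymmetrizer π ∨ V * Vᴴ = symmetrizer π)

/-- The objects of the subcategory `fh`: finite direct sums of irreducible objects with finite
statistics whose associated simple object is doubly faithful. -/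
def finiteHomogeneous (N : ObservableNet H) : ObjectProperty (LTBimodule N) := fun α =>
  ∃ (k : ℕ) (ρ : Fin k → LTBimodule N), IsDirectSum α ρ ∧
    ∀ i, IsIrreducible (ρ i).toBimodule ∧
      ∃ d γ V, IsStatisticsTriple (ρ i) d γ V ∧ γ.IsDoublyFaithful

/-- The conjugate equations `(R̄⁺ × 1_ρ)(1_ρ × R) = 1_ρ` and `(R⁺ × 1_σ)(1_σ × R̄) = 1_σ` for
`R ∈ (ι, σρ)` and `R̄ ∈ (ι, ρσ)`. -/
def ConjugateEquations (ρ σ : Bimodule N)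
    (R : Matrix (Fin (tensor σ ρ).n) (Fin (iota N).n) N.quasilocal)
    (R' : Matrix (Fin (tensor ρ σ).n) (Fin (iota N).n) N.quasilocal) : Prop :=
  recast (Nat.mul_one ρ.n) (Nat.one_mul ρ.n)
      (times (tensor ρ σ) R'ᴴ ρ.unit *
        recast (m' := ρ.n * (tensor ρ σ).n) (Nat.mul_assoc ρ.n σ.n ρ.n) rfl
          (times ρ ρ.unit R)) = ρ.unit ∧
  recast (Nat.mul_one σ.n) (Nat.one_mul σ.n)
      (times (tensor σ ρ) Rᴴ σ.unit *
        recast (m' := σ.n * (tensor σ ρ).n) (Nat.mul_assoc σ.n ρ.n σ.n) rfl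
          (times σ σ.unit R')) = σ.unit

/-- The objects which have conjugates. -/
def hasConjugates (N : ObservableNet H) : ObjectProperty (LTBimodule N) := fun ρ =>
  ∃ (σ : LTBimodule N) (R : _) (R' : _),
    IsArrow (iota N) (tensor σ.toBimodule ρ.toBimodule) R ∧
    IsArrow (iota N) (tensor ρ.toBimodule σ.toBimodule) R' ∧
    ConjugateEquations ρ.toBimodule σ.toBimodule R R'

end LTBimodule

end Superselection

end

noncomputable section

namespace Superselection

variable {H : Type*} [NormedAddCommGroup H] [InnerProductSpace ℂ H] [CompleteSpace H]

/-! ### Geometry of double cones -/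

/-! Proper infiniteness puts orthonormal isometries into every local algebra. Contracting the index
space with them realises a bimodule `ρ` by a non-unital endomorphism `f` of the quasilocal algebra
and a frame `W` with `∑ W i W i⁺ = f 1` and `ρ(a)ᵢⱼ = W i⁺ f(a) W j` (`IsFrame`, `exists_frame`).
Frames translate arrows, tensor products, the symmetry and the conjugate equations, so the theorem
becomes one about endomorphisms. There a single conjugate equation suffices (`HalfConj`): it makes
the left side of the other one an idempotent, whose range projection cuts a genuine conjugate out of
the half conjugate (`HalfConj.exists_conjugate`).

Conjugates give finite statistics. An arrow `r ∈ (ι, gf)` defines the left inverse `φ(x) = r⁺ g(x)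
r`, which the conjugate equation makes faithful with an explicit bound (`HalfConj.norm_le`). The
bound limits the number of orthogonal self-adjoint elements of `(f, f)` (`HalfConj.card_le`), so `f`
is a finite sum of irreducibles. For irreducible `f`, `φ(ε)` is a scalar `c` times the unit, and `φ`
maps the (anti)symmetrizer on `d + 1` factors to `(κ ± d c) / (d + 1)` times the one on `d` factors,
where `κ = r⁺ r`. For the right choice of sign, positivity and the bound do not allow all of them to
be nonzero; at the last nonzero one `κ ± d c = 0` (`HalfConj.exists_dim`). Iterating `φ` on this
projection then gives `(κ / d) ^ d`, which is up to a sign the parameter `c ^ d` of `f ^ d`. This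
coincidence forces the symmetry to be a sign on the corresponding subobject
(`HalfConj.times_eq_smul_eps`), while the left inverse and the arrow `r'` make it faithful and
doubly faithful.

Conversely, let `γ` be simple, faithful and doubly faithful with an isometry `v` onto the projection
of `f ^ d`. These properties make the image of `γ` the full corner `γ(1) 𝔄 γ(1)` (`exists_map_eq`),
so `γ` has an inverse `δ` (`exists_inverse`), and `f ^ (d - 1) δ` is the candidate for the
conjugate. The conjugate equation amounts to `v⁺ f(v) ∈ (fγ, γf)` being a nonzero multiple of the
symmetry: a multiple since `f` is irreducible and `γ` full, nonzero since the (anti)symmetrizers on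
the first and on the last `d` of `d + 1` factors do not annihilate each other
(`map_altProj_eq_zero`). Orthonormal isometries take care of direct sums (`exists_halfConj_of_sum`).
-/

/-- The double cone of radius `r` about `p` with vertices on the time axis through `p`. -/
def diamondSet (p : Minkowski) (r : ℝ) : Set Minkowski := {z | ‖z.2 - p.2‖ + |z.1 - p.1| < r}

theorem isDoubleCone_diamondSet (p : Minkowski) {r : ℝ} (hr : 0 < r) :
    IsDoubleCone (diamondSet p r) := by
  refine ⟨(p.1 - r, p.2), (p.1 + r, p.2), ?_, ?_⟩
  · simp only [Chronological, sub_self, norm_zero]; linarith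
  · ext z
    simp only [diamondSet, Chronological, Set.mem_ofPred_eq, norm_sub_rev p.2 z.2]
    constructor
    · intro h
      have h1 := abs_le.1 (le_refl |z.1 - p.1|)
      constructor <;> linarith [h1.1, h1.2]
    · rintro ⟨h1, h2⟩
      rcases abs_cases (z.1 - p.1) with h | h <;> linarith [h.1]

/-- The diamond as a double cone. -/
def diamond (p : Minkowski) (r : ℝ) (hr : 0 < r) : DoubleCone :=
  ⟨diamondSet p r, isDoubleCone_diamondSet p hr⟩

theorem mem_diamondSet_self (p : Minkowski) {r : ℝ} (hr : 0 < r) : p ∈ diamondSet p r := by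
  simpa [diamondSet] using hr

theorem Perp.symm {a b : DoubleCone} (h : Perp a b) : Perp b a := by
  intro x hx y hy
  have := h hy x hx
  simp only [SpacelikeSep] at this ⊢
  rwa [abs_sub_comm, norm_sub_rev]

theorem Perp.mono {a a' b b' : DoubleCone} (h : Perp a b) (ha : a'.1 ⊆ a.1) (hb : b'.1 ⊆ b.1) :
    Perp a' b' := fun _ hx y hy => h (ha hx) y (hb hy)

theorem perp_diamond (p q : Minkowski) {r s : ℝ} (hr : 0 < r) (hs : 0 < s)
    (h : |p.1 - q.1| + r + s ≤ ‖p.2 - q.2‖) : Perp (diamond p r hr) (diamond q s hs) := by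
  intro x hx y hy
  simp only [diamond, diamondSet, Set.mem_ofPred_eq] at hx hy
  simp only [SpacelikeSep]
  have e1 : ‖p.2 - q.2‖ ≤ ‖x.2 - p.2‖ + ‖x.2 - y.2‖ + ‖y.2 - q.2‖ := by
    calc ‖p.2 - q.2‖ = ‖-(x.2 - p.2) + (x.2 - y.2) + (y.2 - q.2)‖ := by congr 1; abel
      _ ≤ _ := (norm_add_le _ _).trans (add_le_add_left ((norm_add_le _ _).trans (by
        rw [norm_neg])) _)
  have e2 : |x.1 - y.1| ≤ |x.1 - p.1| + |p.1 - q.1| + |y.1 - q.1| := by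
    calc |x.1 - y.1| = |(x.1 - p.1) + (p.1 - q.1) + -(y.1 - q.1)| := by congr 1; ring
      _ ≤ _ := (abs_add_le _ _).trans
        (by rw [abs_neg]; exact add_le_add_left (abs_add_le _ _) _)
  linarith

theorem isOpen_of_isDoubleCone {S : Set Minkowski} (h : IsDoubleCone S) : IsOpen S := by
  obtain ⟨x, y, -, rfl⟩ := h
  have h1 : IsOpen {z : Minkowski | ‖z.2 - x.2‖ < z.1 - x.1} :=
    isOpen_lt (by fun_prop) (by fun_prop)
  have h2 : IsOpen {z : Minkowski | ‖y.2 - z.2‖ < y.1 - z.1} :=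
    isOpen_lt (by fun_prop) (by fun_prop)
  exact h1.inter h2

theorem DoubleCone.nonempty (a : DoubleCone) : a.1.Nonempty := by
  obtain ⟨S, x, y, h, rfl⟩ := a
  refine ⟨((x.1 + y.1) / 2, (1 / 2 : ℝ) • (x.2 + y.2)), ?_⟩
  simp only [Chronological, Set.mem_ofPred_eq] at h ⊢
  have e1 : (1 / 2 : ℝ) • (x.2 + y.2) - x.2 = (1 / 2 : ℝ) • (y.2 - x.2) := by module
  have e2 : y.2 - (1 / 2 : ℝ) • (x.2 + y.2) = (1 / 2 : ℝ) • (y.2 - x.2) := by module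
  rw [e1, e2, norm_smul]
  norm_num
  constructor <;> linarith

theorem exists_diamond_subset {U : Set Minkowski} (hU : IsOpen U) {p : Minkowski} (hp : p ∈ U) :
    ∃ (r : ℝ) (hr : 0 < r), (diamond p r hr).1 ⊆ U := by
  obtain ⟨r, hr, h⟩ := Metric.isOpen_iff.1 hU p hp
  refine ⟨r, hr, fun z hz => h ?_⟩
  simp only [diamond, diamondSet, Set.mem_ofPred_eq] at hz
  rw [Metric.mem_ball, dist_eq_norm, Prod.norm_def, max_lt_iff]
  simp only [Prod.fst_sub, Prod.snd_sub, Real.norm_eq_abs]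
  constructor <;> linarith [norm_nonneg (z.2 - p.2), abs_nonneg (z.1 - p.1)]

theorem DoubleCone.exists_subset_diamond (a : DoubleCone) :
    ∃ R : ℝ, ∀ r, R ≤ r → a.1 ⊆ diamondSet 0 r := by
  obtain ⟨S, x, y, h, rfl⟩ := a
  refine ⟨(y.1 - x.1) + ‖x.2‖ + |x.1| + |y.1| + 1, fun r hr z hz => ?_⟩
  simp only [Chronological, diamondSet, Set.mem_ofPred_eq, Prod.fst_zero, Prod.snd_zero,
    sub_zero] at hz ⊢
  have e1 : ‖z.2‖ ≤ ‖z.2 - x.2‖ + ‖x.2‖ := by simpa using norm_add_le (z.2 - x.2) x.2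
  have e2 := norm_nonneg (y.2 - z.2)
  have e3 := norm_nonneg (z.2 - x.2)
  have e4 : |z.1| ≤ |x.1| + |y.1| := by
    rw [abs_le]
    constructor
    · linarith [neg_abs_le x.1, abs_nonneg y.1]
    · linarith [le_abs_self y.1, abs_nonneg x.1]
  linarith

theorem DoubleCone.exists_union_subset (a b : DoubleCone) :
    ∃ c : DoubleCone, a.1 ⊆ c.1 ∧ b.1 ⊆ c.1 := by
  obtain ⟨R, hR⟩ := a.exists_subset_diamond
  obtain ⟨R', hR'⟩ := b.exists_subset_diamond
  have hpos : 0 < max (max R R') 1 := lt_of_lt_of_le one_pos (le_max_right _ _)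
  exact ⟨diamond 0 _ hpos, hR _ ((le_max_left _ _).trans (le_max_left _ _)),
    hR' _ ((le_max_right _ _).trans (le_max_left _ _))⟩

/-- The point with spatial coordinates `(t, 0, 0)` at time zero. -/
def axisPoint (t : ℝ) : Minkowski := (0, EuclideanSpace.single 0 t)

theorem perp_diamond_axisPoint {s t r r' : ℝ} (hr : 0 < r) (hr' : 0 < r') (h : r + r' ≤ |s - t|) :
    Perp (diamond (axisPoint s) r hr) (diamond (axisPoint t) r' hr') := by
  refine perp_diamond _ _ hr hr' ?_
  have : (axisPoint s).2 - (axisPoint t).2 = EuclideanSpace.single 0 (s - t) := by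
    ext i
    by_cases hi : i = 0 <;> simp [axisPoint, hi]
  rw [this, PiLp.norm_single]
  simpa [axisPoint] using h

theorem DoubleCone.exists_perp (a : DoubleCone) : ∃ b : DoubleCone, Perp a b := by
  obtain ⟨R, hR⟩ := a.exists_subset_diamond
  have hpos : 0 < max R 1 := lt_of_lt_of_le one_pos (le_max_right _ _)
  refine ⟨diamond (axisPoint (max R 1 + 1)) 1 one_pos, ?_⟩
  have h0 : axisPoint 0 = 0 := by
    ext i
    · simp [axisPoint]
    · simp [axisPoint]
  have key := perp_diamond_axisPoint (s := 0) (t := max R 1 + 1) hpos one_pos (by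
    rw [zero_sub, abs_neg]; exact le_abs_self _)
  rw [h0] at key
  exact key.mono (hR _ (le_max_left _ _)) subset_rfl

/-- A sequence of mutually spacelike double cones. -/
def remoteCone (k : ℕ) : DoubleCone := diamond (axisPoint k) (1 / 2) (by norm_num)

theorem perp_remoteCone {k l : ℕ} (h : k ≠ l) : Perp (remoteCone k) (remoteCone l) := by
  refine perp_diamond_axisPoint _ _ ?_
  have : (1 : ℝ) ≤ |(k : ℝ) - l| := by
    have h1 : (1 : ℤ) ≤ |(k : ℤ) - l| := Int.one_le_abs (sub_ne_zero.2 (by exact_mod_cast h))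
    exact_mod_cast h1
  linarith

/-! ### Connectedness of the set of spacelike pairs. -/

/-- The pairs of spacelike separated points. -/
def spacelikePairs : Set (Minkowski × Minkowski) := {z | SpacelikeSep z.1 z.2}

/-- The map `(x, t, v) ↦ (x, x + (t‖v‖, v))` sends the product of spacetime, the interval `(-1, 1)`
and punctured space onto the spacelike pairs. The puncture does not disconnect because space has
more than one dimension. -/
theorem isPreconnected_spacelikePairs : IsPreconnected spacelikePairs := by
  have h0 : IsPreconnected ({0}ᶜ : Set (EuclideanSpace ℝ (Fin 3))) :=
    (isConnected_compl_singleton_of_one_lt_rank (by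
      rw [← Module.finrank_eq_rank, finrank_euclideanSpace]; simp) 0).isPreconnected
  have h1 : IsPreconnected (Set.Ioo (-1 : ℝ) 1) := isPreconnected_Ioo
  have h2 := ((isPreconnected_univ (α := Minkowski)).prod (h1.prod h0))
  have h3 := h2.image (fun z : Minkowski × ℝ × EuclideanSpace ℝ (Fin 3) =>
    (z.1, ((z.1.1 + z.2.1 * ‖z.2.2‖, z.1.2 + z.2.2) : Minkowski))) (by fun_prop)
  convert h3 using 1
  ext ⟨x, y⟩
  simp only [spacelikePairs, SpacelikeSep, Set.mem_ofPred_eq, Set.mem_image, Set.mem_prod,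
    Set.mem_univ, true_and, Set.mem_Ioo, Set.mem_compl_iff, Set.mem_singleton_iff]
  constructor
  · intro h
    have hpos : 0 < ‖y.2 - x.2‖ := (abs_nonneg _).trans_lt h
    refine ⟨(x, (y.1 - x.1) / ‖y.2 - x.2‖, y.2 - x.2), ⟨⟨?_, ?_⟩, norm_pos_iff.1 hpos⟩, ?_⟩
    · rw [lt_div_iff₀ hpos]; linarith [neg_abs_le (y.1 - x.1)]
    · rw [div_lt_iff₀ hpos]; linarith [le_abs_self (y.1 - x.1)]
    · refine Prod.ext rfl (Prod.ext ?_ ?_)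
      · simp only; field_simp; ring
      · simp
  · rintro ⟨⟨x', t, v⟩, ⟨⟨h1, h2⟩, hv⟩, he⟩
    obtain ⟨rfl, rfl⟩ := Prod.ext_iff.1 he
    simp only [add_sub_cancel_left, abs_mul, abs_norm]
    have hpos : 0 < ‖v‖ := norm_pos_iff.2 hv
    have : |t| < 1 := abs_lt.2 ⟨h1, h2⟩
    nlinarith

/-- Data attached to the pairs of spacelike separated double cones are unique as soon as they are
unique for every pair and can be kept when the double cones are enlarged. -/
theorem eq_of_spacelike_chain {X : Type*} (P : DoubleCone → DoubleCone → X → Prop)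
    (hex : ∀ a b, Perp a b → ∃ x, P a b x)
    (huniq : ∀ a b x y, Perp a b → P a b x → P a b y → x = y)
    (hmono : ∀ a b a' b' x, a'.1 ⊆ a.1 → b'.1 ⊆ b.1 → Perp a b → P a' b' x → P a b x)
    {a b a' b' : DoubleCone} {x y : X} (h : Perp a b) (h' : Perp a' b') (hx : P a b x)
    (hy : P a' b' y) : x = y := by
  classical
  -- Points replace double cones: each spacelike pair of points gets the datum of some pair of cones
  -- around it. Passing to common smaller diamonds shows that all such cones give the same datum, so
  -- `F` is locally constant on a connected set.
  have val : ∀ z : spacelikePairs, ∃ x, ∃ a b : DoubleCone,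
      z.1.1 ∈ a.1 ∧ z.1.2 ∈ b.1 ∧ Perp a b ∧ P a b x := by
    rintro ⟨⟨p, q⟩, hz⟩
    simp only [spacelikePairs, SpacelikeSep, Set.mem_ofPred_eq] at hz
    have hr : 0 < (‖q.2 - p.2‖ - |q.1 - p.1|) / 2 := by linarith
    have hp := perp_diamond p q hr hr (by rw [abs_sub_comm, norm_sub_rev p.2]; linarith)
    obtain ⟨x, hx⟩ := hex _ _ hp
    exact ⟨x, _, _, mem_diamondSet_self p hr, mem_diamondSet_self q hr, hp, hx⟩
  choose F A B hA hB hAB hF using val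
  have key : ∀ (z : spacelikePairs) (a b : DoubleCone) (x : X), z.1.1 ∈ a.1 → z.1.2 ∈ b.1 →
      Perp a b → P a b x → F z = x := by
    intro z a b x ha hb hab hx
    obtain ⟨r, hr, h1⟩ := exists_diamond_subset ((isOpen_of_isDoubleCone a.2).inter
      (isOpen_of_isDoubleCone (A z).2)) ⟨ha, hA z⟩
    obtain ⟨s, hs, h2⟩ := exists_diamond_subset ((isOpen_of_isDoubleCone b.2).inter
      (isOpen_of_isDoubleCone (B z).2)) ⟨hb, hB z⟩
    have hp := hab.mono (h1.trans Set.inter_subset_left) (h2.trans Set.inter_subset_left)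
    obtain ⟨w, hw⟩ := hex _ _ hp
    rw [huniq _ _ _ _ hab hx (hmono _ _ _ _ _ (h1.trans Set.inter_subset_left)
        (h2.trans Set.inter_subset_left) hab hw),
      huniq _ _ _ _ (hAB z) (hF z) (hmono _ _ _ _ _ (h1.trans Set.inter_subset_right)
        (h2.trans Set.inter_subset_right) (hAB z) hw)]
  have hloc : IsLocallyConstant F := by
    rw [IsLocallyConstant.iff_exists_open]
    intro z
    refine ⟨Subtype.val ⁻¹' ((A z).1 ×ˢ (B z).1), ((isOpen_of_isDoubleCone (A z).2).prod
      (isOpen_of_isDoubleCone (B z).2)).preimage continuous_subtype_val, ⟨hA z, hB z⟩, ?_⟩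
    intro w hw
    exact key w _ _ _ hw.1 hw.2 (hAB z) (hF z)
  obtain ⟨p, hp⟩ := a.nonempty
  obtain ⟨q, hq⟩ := b.nonempty
  obtain ⟨p', hp'⟩ := a'.nonempty
  obtain ⟨q', hq'⟩ := b'.nonempty
  let z : spacelikePairs := ⟨(p, q), h.symm hq p hp⟩
  let z' : spacelikePairs := ⟨(p', q'), h'.symm hq' p' hp'⟩
  have : PreconnectedSpace spacelikePairs :=
    isPreconnected_iff_preconnectedSpace.1 isPreconnected_spacelikePairs
  rw [← key z a b x hp hq h hx, ← key z' a' b' y hp' hq' h' hy]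
  exact hloc.apply_eq_of_preconnectedSpace z z'

/-! ### Isometries in properly infinite von Neumann algebras -/

section VonNeumann

theorem ext_of_denseRange {a b h : H →L[ℂ] H} (hh : DenseRange h) (e : a * h = b * h) : a = b := by
  refine ContinuousLinearMap.coeFn_injective (hh.equalizer a.continuous b.continuous ?_)
  ext ξ
  exact congrArg (fun T : H →L[ℂ] H => T ξ) e

/-- The isometric part of an injective operator in a von Neumann algebra. -/
theorem exists_isometry_of_injective (M : VonNeumannAlgebra H) {x : H →L[ℂ] H} (hx : x ∈ M)
    (hinj : ∀ ξ, x ξ = 0 → ξ = 0) :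
    ∃ u ∈ M, star u * u = 1 ∧ ∃ h : H →L[ℂ] H, DenseRange h ∧ u * h = x := by
  set h := CFC.abs x with hh
  have hsa : star h = h := (IsSelfAdjoint.of_nonneg (CFC.abs_nonneg x)).star_eq
  have hsq : h * h = star x * x := CFC.abs_mul_abs x
  have hnorm : ∀ ξ, ‖x ξ‖ = ‖h ξ‖ := by
    intro ξ
    have e : ∀ T : H →L[ℂ] H, ‖T ξ‖ ^ 2 = RCLike.re (inner ℂ ((star T * T) ξ) ξ) := by
      intro T
      rw [mul_apply_eq_comp, ContinuousLinearMap.star_eq_adjoint,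
        ContinuousLinearMap.adjoint_inner_left, inner_self_eq_norm_sq]
    have e1 : ‖x ξ‖ ^ 2 = ‖h ξ‖ ^ 2 := by rw [e, e, hsa, hsq]
    exact (sq_eq_sq₀ (norm_nonneg _) (norm_nonneg _)).1 e1
  have hdense : DenseRange h := by
    have h1 : (LinearMap.range (h : H →ₗ[ℂ] H))ᗮ = ⊥ := by
      rw [ContinuousLinearMap.orthogonal_range, ← ContinuousLinearMap.star_eq_adjoint, hsa,
        eq_bot_iff]
      intro ξ hξ
      have h2 : h ξ = 0 := hξ
      rw [Submodule.mem_bot]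
      refine hinj ξ (norm_eq_zero.1 ?_)
      rw [hnorm, h2, norm_zero]
    have h2 := Submodule.topologicalClosure_eq_top_iff.2 h1
    exact Submodule.dense_iff_topologicalClosure_eq_top.2 h2
  have hbd : ∀ ξ, ‖(x : H →ₗ[ℂ] H) ξ‖ ≤ 1 * ‖(h : H →ₗ[ℂ] H) ξ‖ := fun ξ => by
    rw [one_mul]; exact (hnorm ξ).le
  -- This is the polar decomposition: `h ξ ↦ x ξ` preserves norms, and the range of `h = |x|` is
  -- dense because `x` is injective.
  let u : H →L[ℂ] H := (x : H →ₗ[ℂ] H).extendOfNorm (h : H →ₗ[ℂ] H)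
  have hu : u * h = x := by
    ext ξ
    exact LinearMap.extendOfNorm_eq hdense ⟨1, hbd⟩ ξ
  have hcomm : ∀ y ∈ M.commutant, y * h = h * y := by
    intro y hy
    have hy' := VonNeumannAlgebra.mem_commutant_iff.1 hy
    exact (Commute.cfcAbs_left (hy' x hx)
      (VonNeumannAlgebra.mem_commutant_iff.1 (star_mem hy) x hx)).eq.symm
  refine ⟨u, ?_, ?_, h, hdense, hu⟩
  -- By the bicommutant property it is enough that `u` commutes with the commutant of `M`. This can
  -- be checked on the range of `h`, as both `h` and `x` commute with it.
  · rw [← VonNeumannAlgebra.commutant_commutant M, VonNeumannAlgebra.mem_commutant_iff]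
    intro y hy
    refine ext_of_denseRange hdense ?_
    rw [mul_assoc, hu, mul_assoc, hcomm y hy, ← mul_assoc, hu]
    exact ((VonNeumannAlgebra.mem_commutant_iff.1 hy) x hx).symm
  · refine ext_of_denseRange hdense ?_
    have h1 : h * (star u * u) = h := by
      refine ext_of_denseRange hdense ?_
      calc h * (star u * u) * h = star (u * h) * (u * h) := by
            rw [star_mul, hsa]; simp only [mul_assoc]
        _ = h * h := by rw [hu, hsq]
    have h2 := congrArg star h1
    rw [star_mul, star_mul, star_star, hsa] at h2
    rw [h2, one_mul]

/-- The projection onto the joint kernel of a family of operators. -/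
theorem exists_projection_joint_kernel {ι : Type*} (g : ι → H →L[ℂ] H) :
    ∃ P : H →L[ℂ] H, IsStarProjection P ∧ (∀ ξ, (∀ t, g t ξ = 0) → P ξ = ξ) ∧
      (∀ t, g t * P = 0) ∧ ∀ M : VonNeumannAlgebra H,
        (∀ y ∈ M.commutant, ∀ ξ, (∀ t, g t ξ = 0) → ∀ t, g t (y ξ) = 0) → P ∈ M := by
  let K : Submodule ℂ H := ⨅ t, LinearMap.ker (g t : H →ₗ[ℂ] H)
  have hmem : ∀ ξ, ξ ∈ K ↔ ∀ t, g t ξ = 0 := fun ξ => by simp [K]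
  have hK : IsClosed (K : Set H) := by
    have : (K : Set H) = ⋂ t, {ξ | g t ξ = 0} := by
      ext ξ
      simpa using hmem ξ
    rw [this]
    exact isClosed_iInter fun t => isClosed_eq (g t).continuous continuous_const
  have : CompleteSpace K := hK.completeSpace_coe
  refine ⟨K.starProjection, isStarProjection_starProjection, ?_, ?_, ?_⟩
  · intro ξ hξ
    exact Submodule.starProjection_eq_self_iff.2 ((hmem ξ).2 hξ)
  · intro t
    ext ξ
    exact (hmem _).1 (K.starProjection_apply_mem ξ) t
  · intro M hM
    rw [VonNeumannAlgebra.IsStarProjection.mem_iff isStarProjection_starProjection]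
    intro y hy
    rw [Submodule.range_starProjection, Module.End.mem_invtSubmodule]
    intro ξ hξ
    exact (hmem _).2 (hM y hy ξ ((hmem _).1 hξ))

/-- The open sets `{ξ | g t ξ ≠ 0}` cover the nonzero vectors, and in a second countable space
countably many of them have the same union. -/
theorem exists_sequence_jointly_injective [TopologicalSpace.SeparableSpace H] {ι : Type*}
    [Nonempty ι] (g : ι → H →L[ℂ] H) (hg : ∀ ξ, (∀ t, g t ξ = 0) → ξ = 0) :
    ∃ τ : ℕ → ι, ∀ ξ, (∀ k, g (τ k) ξ = 0) → ξ = 0 := by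
  have : SecondCountableTopology H := UniformSpace.secondCountable_of_separable H
  obtain ⟨T, hT, hTU⟩ := TopologicalSpace.isOpen_iUnion_countable (fun t => {ξ | g t ξ ≠ 0})
    (fun t => isOpen_ne_fun (g t).continuous continuous_const)
  have key : ∀ ξ, (∀ t ∈ T, g t ξ = 0) → ξ = 0 := by
    intro ξ hξ
    by_contra h0
    obtain ⟨t, ht⟩ := not_forall.1 (mt (hg ξ) h0)
    have : ξ ∈ ⋃ t, {ξ | g t ξ ≠ 0} := Set.mem_iUnion.2 ⟨t, ht⟩
    rw [← hTU] at this
    obtain ⟨t, ht, h⟩ := Set.mem_iUnion₂.1 this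
    exact h (hξ t ht)
  rcases T.eq_empty_or_nonempty with rfl | hne
  · exact ⟨fun _ => Classical.arbitrary ι, fun ξ _ => key ξ (by simp)⟩
  · obtain ⟨τ, rfl⟩ := hT.exists_eq_range hne
    exact ⟨τ, fun ξ hξ => key ξ (by rintro _ ⟨k, rfl⟩; exact hξ k)⟩

theorem isClosed_coe_vonNeumannAlgebra (M : VonNeumannAlgebra H) :
    IsClosed (M : Set (H →L[ℂ] H)) := by
  rw [← VonNeumannAlgebra.centralizer_centralizer M]
  exact Set.isClosed_centralizer _

/-- A sequence of operators with orthogonal ranges whose initial spaces are, up to the algebra,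
jointly everything absorbs an isometry. -/
theorem exists_isometry_of_orthogonal (M : VonNeumannAlgebra H) (a m : ℕ → H →L[ℂ] H)
    (ha : ∀ k, a k ∈ M) (hm : ∀ k, m k ∈ M) (hnorm : ∀ k, ‖a k‖ ≤ 1)
    (horth : ∀ k l, k ≠ l → star (a k) * a l = 0)
    (hinj : ∀ ξ, (∀ k, (star (a k) * a k * m k) ξ = 0) → ξ = 0) :
    ∃ u ∈ M, star u * u = 1 ∧ ∀ b : H →L[ℂ] H, (∀ k, b * a k = 0) → b * u = 0 := by
  -- The weights make `∑ c k • (a k * m k)` converge absolutely. By orthogonality `star (a l)`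
  -- extracts the `l`-th term, so the sum is injective and has an isometric part `u`. An operator
  -- that kills every `a k` kills the sum, hence `u`.
  let c : ℕ → ℝ := fun k => (1 / 2) ^ k * (1 + ‖m k‖)⁻¹
  have hc : ∀ k, 0 < c k := fun k => by positivity
  let y : ℕ → H →L[ℂ] H := fun k => (c k : ℂ) • (a k * m k)
  have hy : Summable y := by
    refine Summable.of_norm_bounded summable_geometric_two fun k => ?_
    rw [norm_smul, Complex.norm_real, Real.norm_of_nonneg (hc k).le]
    have h1 : ‖a k * m k‖ ≤ 1 + ‖m k‖ := by
      refine (norm_mul_le _ _).trans ?_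
      nlinarith [hnorm k, norm_nonneg (m k), norm_nonneg (a k)]
    calc c k * ‖a k * m k‖ ≤ c k * (1 + ‖m k‖) := mul_le_mul_of_nonneg_left h1 (hc k).le
      _ = (1 / 2) ^ k := by
        simp only [c]
        rw [mul_assoc, inv_mul_cancel₀ (by positivity), mul_one]
  have hmul : ∀ b : H →L[ℂ] H, b * ∑' k, y k = ∑' k, b * y k := fun b => (hy.tsum_mul_left b).symm
  have hyM : ∀ k, y k ∈ M := fun k =>
    M.toStarSubalgebra.smul_mem (mul_mem (ha k) (hm k)) _
  have hxM : ∑' k, y k ∈ M :=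
    (isClosed_coe_vonNeumannAlgebra M).mem_of_tendsto hy.hasSum
      (Filter.Eventually.of_forall fun s => sum_mem fun k _ => hyM k)
  have hxinj : ∀ ξ, (∑' k, y k) ξ = 0 → ξ = 0 := by
    intro ξ hξ
    refine hinj ξ fun l => ?_
    have h1 : star (a l) * ∑' k, y k = (c l : ℂ) • (star (a l) * a l * m l) := by
      rw [hmul, tsum_eq_single l]
      · simp only [y, mul_smul_comm, mul_assoc]
      · intro k hk
        simp only [y, mul_smul_comm]
        rw [← mul_assoc, horth l k hk.symm, zero_mul, smul_zero]
    have h2 : (star (a l) * ∑' k, y k) ξ = 0 := by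
      rw [mul_apply_eq_comp, hξ, map_zero]
    rw [h1, smul_apply] at h2
    exact (smul_eq_zero.1 h2).resolve_left (by exact_mod_cast (hc l).ne')
  obtain ⟨u, hu, huu, h, hdense, huh⟩ := exists_isometry_of_injective M hxM hxinj
  refine ⟨u, hu, huu, fun b hb => ext_of_denseRange hdense ?_⟩
  rw [mul_assoc, huh, hmul, zero_mul]
  refine (tsum_congr fun k => ?_).trans tsum_zero
  simp only [y, mul_smul_comm]
  rw [← mul_assoc, hb, zero_mul, smul_zero]

/-! ### Shifts, their defects, and halving in a properly infinite algebra. -/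

/-- The elements which exhibit a central projection as infinite. -/
structure IsShift (M : VonNeumannAlgebra H) (v : H →L[ℂ] H) : Prop where
  mem : v ∈ M
  proj : IsStarProjection (star v * v)
  central : ∀ m ∈ M, star v * v * m = m * (star v * v)
  left : star v * v * v = v

namespace IsShift

variable {M : VonNeumannAlgebra H} {v : H →L[ℂ] H}

/-- The part of the projection which is not attained by the shift. -/
def defect (v : H →L[ℂ] H) : H →L[ℂ] H := star v * v - v * star v

theorem right (h : IsShift M v) : v * (star v * v) = v := by
  rw [← h.central v h.mem, h.left]

theorem star_defect : star (defect v) = defect v := by simp [defect]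

theorem defect_mem (h : IsShift M v) : defect v ∈ M :=
  sub_mem (mul_mem (star_mem h.mem) h.mem) (mul_mem h.mem (star_mem h.mem))

theorem defect_mul (h : IsShift M v) : defect v * v = 0 := by
  rw [defect, sub_mul, h.left, mul_assoc, h.right, sub_self]

theorem proj_mul_defect (h : IsShift M v) : star v * v * defect v = defect v := by
  rw [defect, mul_sub, h.proj.isIdempotentElem.eq, ← mul_assoc, h.left]

theorem defect_sq (h : IsShift M v) : defect v * defect v = defect v := by
  nth_rw 2 [defect]
  rw [mul_sub, ← mul_assoc _ v, h.defect_mul, zero_mul, sub_zero]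
  have := congrArg star h.proj_mul_defect
  simpa [star_defect, mul_assoc] using this

/-- `star (v ^ k) * v ^ k` is `1` for `k = 0` and the projection `star v * v` otherwise. In both
cases it acts trivially on the range of `v`. -/
theorem star_pow_mul_pow_mul_self (h : IsShift M v) (k : ℕ) : star (v ^ k) * v ^ k * v = v := by
  induction k with
  | zero => simp
  | succ k ih =>
    have e : v ^ (k + 1) * v = v * (v * v ^ k) := by rw [← pow_succ, pow_succ', pow_succ']
    rw [mul_assoc, e, pow_succ' v k, star_mul, mul_assoc, ← mul_assoc (star v), ← mul_assoc _ v,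
      h.left, ← pow_succ', pow_succ, ← mul_assoc, ih]

theorem star_pow_mul_pow (h : IsShift M v) (k : ℕ) :
    star (v ^ k) * v ^ k * defect v = defect v := by
  cases k with
  | zero => simp
  | succ k =>
    rw [pow_succ v k, star_mul, mul_assoc (star v), ← mul_assoc (star (v ^ k)),
      h.star_pow_mul_pow_mul_self, h.proj_mul_defect]

/-- The range of the defect is a wandering subspace, as in the Wold decomposition: the smaller power
cancels, and `defect v * v = 0` remains. -/
theorem orthogonal (h : IsShift M v) {k l : ℕ} (hkl : k ≠ l) :
    star (v ^ k * defect v) * (v ^ l * defect v) = 0 := by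
  wlog hlt : k < l generalizing k l
  · have := congrArg star (this hkl.symm (lt_of_le_of_ne (not_lt.1 hlt) hkl.symm))
    rwa [star_mul, star_star, star_zero] at this
  obtain ⟨j, rfl⟩ := Nat.exists_eq_add_of_lt hlt
  have e1 : star (v ^ k * defect v) * v ^ k = defect v := by
    have := congrArg star (h.star_pow_mul_pow k)
    rw [star_mul, star_mul, star_star, star_defect] at this
    rw [star_mul, star_defect, mul_assoc, this]
  rw [show v ^ (k + j + 1) * defect v = v ^ k * (v * (v ^ j * defect v)) by
    rw [add_assoc, pow_add, pow_succ' v j]; simp only [mul_assoc], ← mul_assoc, e1, ← mul_assoc,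
    h.defect_mul, zero_mul]

theorem isometric (h : IsShift M v) (k : ℕ) :
    star (v ^ k * defect v) * (v ^ k * defect v) = defect v := by
  rw [star_mul, star_defect, mul_assoc, ← mul_assoc (star (v ^ k)), h.star_pow_mul_pow, h.defect_sq]

end IsShift

theorem norm_le_one_of_star_mul_self {a p : H →L[ℂ] H} (h : star a * a = p) (hp : p * p = p)
    (hs : star p = p) : ‖a‖ ≤ 1 := by
  have h1 : ‖p‖ ≤ 1 := IsStarProjection.norm_le p ⟨hp, hs⟩
  have h2 : ‖a‖ * ‖a‖ = ‖p‖ := by rw [← CStarRing.norm_star_mul_self, h]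
  nlinarith [norm_nonneg a]

/-- A maximal family of shifts with mutually centrally orthogonal defects. -/
theorem exists_maximal_shifts {M : VonNeumannAlgebra H} (hM : IsProperlyInfinite M) :
    ∃ S : Set (H →L[ℂ] H), (∀ v ∈ S, IsShift M v) ∧
      (∀ v ∈ S, ∀ w ∈ S, v ≠ w → ∀ m ∈ M, IsShift.defect v * m * IsShift.defect w = 0) ∧
      ∀ ξ, (∀ v ∈ S, ∀ m ∈ M, (IsShift.defect v * m) ξ = 0) → ξ = 0 := by
  obtain ⟨S, hS⟩ := zorn_subset {S : Set (H →L[ℂ] H) | (∀ v ∈ S, IsShift M v) ∧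
      (∀ v ∈ S, ∀ w ∈ S, v ≠ w → ∀ m ∈ M, IsShift.defect v * m * IsShift.defect w = 0)} (by
    intro C hC hchain
    refine ⟨⋃₀ C, ⟨?_, ?_⟩, fun s hs => Set.subset_sUnion_of_mem hs⟩
    · rintro v ⟨s, hs, hv⟩
      exact (hC hs).1 v hv
    · rintro v ⟨s, hs, hv⟩ w ⟨t, ht, hw⟩ hvw m hm
      rcases hchain.total hs ht with h | h
      · exact (hC ht).2 v (h hv) w hw hvw m hm
      · exact (hC hs).2 v hv w (h hw) hvw m hm)
  refine ⟨S, hS.prop.1, hS.prop.2, ?_⟩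
  -- The joint kernel of the operators `defect v * m` is invariant under `M` and under its
  -- commutant, so its projection `P` is central. If `P ≠ 0`, proper infiniteness yields a shift
  -- below `P`, whose nonzero defect is centrally orthogonal to the others and could be added to the
  -- family.
  obtain ⟨P, hP, hPfix, hPker, hPmem⟩ := exists_projection_joint_kernel
    (fun t : {t : (H →L[ℂ] H) × (H →L[ℂ] H) // t.1 ∈ S ∧ t.2 ∈ M} =>
      IsShift.defect t.1.1 * t.1.2)
  have hPM : P ∈ M := hPmem M fun y hy ξ hξ t => by
    have h1 := VonNeumannAlgebra.mem_commutant_iff.1 hy _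
      (mul_mem (hS.prop.1 _ t.2.1).defect_mem t.2.2)
    have h2 := congrArg (fun T : H →L[ℂ] H => T ξ) h1
    simp only [mul_apply_eq_comp] at h2 hξ ⊢
    rw [h2, hξ t, map_zero]
  have hPM' : P ∈ M.commutant := hPmem _ fun y hy ξ hξ t => by
    rw [VonNeumannAlgebra.commutant_commutant] at hy
    exact hξ ⟨(t.1.1, t.1.2 * y), t.2.1, mul_mem t.2.2 hy⟩
  have hP0 : P = 0 := by
    by_contra hne
    obtain ⟨v, hvM, hvv, hPv, hvne⟩ := hM P hP hPM hPM' hne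
    have hv : IsShift M v := ⟨hvM, hvv ▸ hP, fun m hm => by
      rw [hvv, VonNeumannAlgebra.mem_commutant_iff.1 hPM' m hm], by rw [hvv, hPv]⟩
    have hdP : P * IsShift.defect v = IsShift.defect v := by rw [← hvv, hv.proj_mul_defect]
    have h1 : ∀ w ∈ S, ∀ m ∈ M, IsShift.defect w * m * IsShift.defect v = 0 := by
      intro w hw m hm
      rw [← hdP, ← mul_assoc, hPker ⟨(w, m), hw, hm⟩, zero_mul]
    have h2 : insert v S ∈ {S : Set (H →L[ℂ] H) | (∀ v ∈ S, IsShift M v) ∧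
        (∀ v ∈ S, ∀ w ∈ S, v ≠ w → ∀ m ∈ M,
          IsShift.defect v * m * IsShift.defect w = 0)} := by
      refine ⟨?_, ?_⟩
      · rintro w (rfl | hw)
        · exact hv
        · exact hS.prop.1 w hw
      · rintro w (rfl | hw) w' (rfl | hw') hne m hm
        · exact absurd rfl hne
        · have := congrArg star (h1 w' hw' (star m) (star_mem hm))
          simpa [IsShift.star_defect, mul_assoc] using this
        · exact h1 w hw m hm
        · exact hS.prop.2 w hw w' hw' hne m hm
    -- Maximality puts `v` among the shifts whose defects are orthogonal to its own. So `defect v =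
    -- 0`, and `v` would attain all of `P`.
    have h3 : v ∈ S := hS.le_of_ge h2 (Set.subset_insert v S) (Set.mem_insert v S)
    have h4 := h1 v h3 1 (one_mem M)
    rw [mul_one, hv.defect_sq, IsShift.defect, hvv, sub_eq_zero] at h4
    exact hvne h4.symm
  intro ξ hξ
  have := hPfix ξ fun t => hξ _ t.2.1 _ t.2.2
  rw [← this, hP0]
  rfl

/-- A properly infinite von Neumann algebra on a separable Hilbert space contains a sequence of
isometries with mutually orthogonal ranges. -/
theorem exists_orthogonal_isometries [TopologicalSpace.SeparableSpace H]
    {M : VonNeumannAlgebra H} (hM : IsProperlyInfinite M) :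
    ∃ u : ℕ → H →L[ℂ] H, (∀ n, u n ∈ M) ∧ ∀ n k, star (u n) * u k = if n = k then 1 else 0 := by
  obtain ⟨S, hS, hSorth, hSinj⟩ := exists_maximal_shifts hM
  rcases S.eq_empty_or_nonempty with rfl | hne
  -- An empty family is jointly injective only on the zero space.
  · have h0 : ∀ T : H →L[ℂ] H, T = 0 := fun T => by
      ext ξ; exact hSinj _ (by simp)
    exact ⟨fun _ => 0, fun _ => zero_mem M, fun n k => by rw [h0 (star _ * _), h0 (ite _ _ _)]⟩
  let ι := {t : (H →L[ℂ] H) × (H →L[ℂ] H) // t.1 ∈ S ∧ t.2 ∈ M}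
  obtain ⟨v₀, hv₀⟩ := hne
  have : Nonempty ι := ⟨⟨(v₀, 1), hv₀, one_mem M⟩⟩
  obtain ⟨τ, hτ⟩ := exists_sequence_jointly_injective
    (fun t : ι => IsShift.defect t.1.1 * t.1.2) (fun ξ hξ => hSinj ξ fun v hv m hm =>
      hξ ⟨(v, m), hv, hm⟩)
  -- Pairing `n` with `k` in the exponent distributes the powers of each shift over infinitely many
  -- sequences. The index `k` must take part because `τ` may meet the same shift repeatedly.
  let a : ℕ → ℕ → H →L[ℂ] H := fun n k =>
    (τ k).1.1 ^ (Nat.pair n k) * IsShift.defect (τ k).1.1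
  have hshift : ∀ k, IsShift M (τ k).1.1 := fun k => hS _ (τ k).2.1
  have haM : ∀ n k, a n k ∈ M := fun n k => mul_mem (pow_mem (hshift k).mem _) (hshift k).defect_mem
  have haa : ∀ n k, star (a n k) * a n k = IsShift.defect (τ k).1.1 := fun n k =>
    (hshift k).isometric _
  have horth : ∀ n k n' k', (n ≠ n' ∨ k ≠ k') → star (a n k) * a n' k' = 0 := by
    intro n k n' k' h
    by_cases hv : (τ k).1.1 = (τ k').1.1
    · simp only [a, ← hv]
      refine (hshift k).orthogonal fun he => ?_
      have := Nat.pair_eq_pair.1 he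
      tauto
    · simp only [a]
      rw [star_mul, IsShift.star_defect, mul_assoc, ← mul_assoc (star _), ← mul_assoc]
      exact hSorth _ (τ k).2.1 _ (τ k').2.1 hv _
        (mul_mem (star_mem (pow_mem (hshift k).mem _)) (pow_mem (hshift k').mem _))
  have hu : ∀ n, ∃ u ∈ M, star u * u = 1 ∧
      ∀ b : H →L[ℂ] H, (∀ k, b * a n k = 0) → b * u = 0 := fun n =>
    exists_isometry_of_orthogonal M (a n) (fun k => (τ k).1.2) (haM n) (fun k => (τ k).2.2)
      (fun k => norm_le_one_of_star_mul_self (haa n k) (hshift k).defect_sq IsShift.star_defect)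
      (fun k l hkl => horth n k n l (Or.inr hkl))
      (fun ξ hξ => hτ ξ fun k => by rw [← haa n k]; exact hξ k)
  choose u huM huu hub using hu
  refine ⟨u, huM, fun n k => ?_⟩
  split_ifs with h
  · rw [h, huu]
  · refine hub k _ fun j => ?_
    have h1 : star (a k j) * u n = 0 := hub n _ fun i => horth k j n i (Or.inl (Ne.symm h))
    simpa using congrArg star h1

end VonNeumann

/-! ### Non-unital endomorphisms and their intertwiners -/

section Endo

variable {A : Type*} [Ring A] [StarRing A] [Algebra ℂ A]

/-- The intertwiners of two (not necessarily unital) endomorphisms. -/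
structure Intertwines (f g : A →⋆ₙₐ[ℂ] A) (t : A) : Prop where
  right : t * f 1 = t
  left : g 1 * t = t
  comm : ∀ a, t * f a = g a * t

/-- Unitary intertwiners, with respect to the units `f 1` and `g 1`. -/
structure UnitaryEquiv (f g : A →⋆ₙₐ[ℂ] A) (u : A) : Prop extends Intertwines f g u where
  star_mul_self : star u * u = f 1
  mul_star_self : u * star u = g 1

variable {f g h f' g' : A →⋆ₙₐ[ℂ] A} {s t u v : A}

theorem star_map_one (f : A →⋆ₙₐ[ℂ] A) : star (f 1) = f 1 := by rw [← map_star, star_one]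

theorem map_one_mul (f : A →⋆ₙₐ[ℂ] A) (a : A) : f 1 * f a = f a := by rw [← map_mul, one_mul]

theorem map_mul_one (f : A →⋆ₙₐ[ℂ] A) (a : A) : f a * f 1 = f a := by rw [← map_mul, mul_one]

theorem map_one_mul_assoc (f : A →⋆ₙₐ[ℂ] A) (a b : A) : f 1 * (f a * b) = f a * b := by
  rw [← mul_assoc, map_one_mul]

namespace Intertwines

theorem one (f : A →⋆ₙₐ[ℂ] A) : Intertwines f f (f 1) :=
  ⟨map_mul_one f 1, map_mul_one f 1, fun a => by rw [map_one_mul, map_mul_one]⟩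

theorem mul (hs : Intertwines g h s) (ht : Intertwines f g t) : Intertwines f h (s * t) :=
  ⟨by rw [mul_assoc, ht.right], by rw [← mul_assoc, hs.left],
    fun a => by rw [mul_assoc, ht.comm, ← mul_assoc, hs.comm, mul_assoc]⟩

theorem star (ht : Intertwines f g t) : Intertwines g f (star t) := by
  refine ⟨?_, ?_, fun a => ?_⟩
  · simpa [star_map_one] using congrArg Star.star ht.left
  · simpa [star_map_one] using congrArg Star.star ht.right
  · simpa [map_star] using (congrArg Star.star (ht.comm (Star.star a))).symm

theorem comm_assoc (ht : Intertwines f g t) (a b : A) : t * (f a * b) = g a * (t * b) := by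
  rw [← mul_assoc, ht.comm, mul_assoc]

/-- The tensor product of intertwiners. -/
theorem times (ht : Intertwines f f' t) (hs : Intertwines g g' s) :
    Intertwines (f.comp g) (f'.comp g') (t * f s) := by
  refine ⟨?_, ?_, fun a => ?_⟩
  · simp only [NonUnitalStarAlgHom.comp_apply]
    rw [mul_assoc, ← map_mul, hs.right]
  · simp only [NonUnitalStarAlgHom.comp_apply]
    rw [ht.comm, ← mul_assoc, ← map_mul, hs.left]
  · simp only [NonUnitalStarAlgHom.comp_apply]
    rw [mul_assoc, ← map_mul, hs.comm, map_mul, ← mul_assoc, ht.comm, mul_assoc]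

/-- Tensoring with a unit from the left. -/
theorem map (hs : Intertwines g g' s) (f : A →⋆ₙₐ[ℂ] A) :
    Intertwines (f.comp g) (f.comp g') (f s) := by
  simpa [map_one_mul] using (one f).times hs

/-- Tensoring with a unit from the right. -/
theorem mul_unit (ht : Intertwines f f' t) (g : A →⋆ₙₐ[ℂ] A) :
    Intertwines (f.comp g) (f'.comp g) (t * f (g 1)) := ht.times (one g)

theorem add (ht : Intertwines f g t) (hs : Intertwines f g s) : Intertwines f g (t + s) :=
  ⟨by rw [add_mul, ht.right, hs.right], by rw [mul_add, ht.left, hs.left],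
    fun a => by rw [add_mul, mul_add, ht.comm, hs.comm]⟩

theorem smul (ht : Intertwines f g t) (c : ℂ) : Intertwines f g (c • t) :=
  ⟨by rw [smul_mul_assoc, ht.right], by rw [mul_smul_comm, ht.left],
    fun a => by rw [smul_mul_assoc, mul_smul_comm, ht.comm]⟩

theorem zero : Intertwines f g (0 : A) := ⟨by simp, by simp, by simp⟩

theorem sub (ht : Intertwines f g t) (hs : Intertwines f g s) : Intertwines f g (t - s) := by
  simpa [sub_eq_add_neg] using ht.add (hs.smul (-1))

theorem sum {ι : Type*} (F : Finset ι) {t : ι → A} (ht : ∀ i ∈ F, Intertwines f g (t i)) :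
    Intertwines f g (∑ i ∈ F, t i) := by
  classical
  induction F using Finset.induction_on with
  | empty => simpa using zero
  | insert i F hi ih =>
    rw [Finset.sum_insert hi]
    exact (ht i (by simp)).add (ih fun j hj => ht j (by simp [hj]))

end Intertwines

namespace UnitaryEquiv

theorem refl (f : A →⋆ₙₐ[ℂ] A) : UnitaryEquiv f f (f 1) :=
  ⟨Intertwines.one f, by rw [star_map_one, map_mul_one], by rw [star_map_one, map_mul_one]⟩

theorem times (hu : UnitaryEquiv f f' u) (hv : UnitaryEquiv g g' v) :
    UnitaryEquiv (f.comp g) (f'.comp g') (u * f v) := by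
  refine ⟨hu.toIntertwines.times hv.toIntertwines, ?_, ?_⟩
  · rw [star_mul, mul_assoc, ← mul_assoc (star u), hu.star_mul_self, map_one_mul, ← map_star,
      ← map_mul, hv.star_mul_self]
    rfl
  · rw [star_mul, mul_assoc, ← mul_assoc (f v), ← map_star f, ← map_mul, hv.mul_star_self,
      ← mul_assoc, hu.comm, mul_assoc, hu.mul_star_self, map_mul_one]
    rfl

theorem conj (hu : UnitaryEquiv f g u) (a : A) : u * f a * star u = g a := by
  rw [hu.comm, mul_assoc, hu.mul_star_self, map_mul_one]

end UnitaryEquiv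

/-- The subobject of `f` given by a projection of `(f, f)`. -/
def subEndo (f : A →⋆ₙₐ[ℂ] A) (e : A) (he : Intertwines f f e) (hs : star e = e)
    (hi : e * e = e) : A →⋆ₙₐ[ℂ] A where
  toFun a := e * f a
  map_smul' c a := by simp
  map_zero' := by simp
  map_add' a b := by rw [map_add, mul_add]
  map_mul' a b := by
    calc e * f (a * b) = e * e * f a * f b := by rw [hi, map_mul, mul_assoc]
      _ = e * (f a * e) * f b := by rw [mul_assoc e e (f a), he.comm]
      _ = e * f a * (e * f b) := by simp only [mul_assoc]
  map_star' a := by rw [star_mul, hs, ← map_star, he.comm]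

section subEndo

variable {e : A} {he : Intertwines f f e} {hs : star e = e} {hi : e * e = e}

theorem subEndo_apply (a : A) : subEndo f e he hs hi a = e * f a := rfl

theorem subEndo_one : subEndo f e he hs hi 1 = e := he.right

theorem intertwines_subEndo : Intertwines (subEndo f e he hs hi) f e :=
  ⟨by rw [subEndo_one, hi], he.left, fun a => by rw [subEndo_apply, ← mul_assoc, hi, he.comm]⟩

end subEndo

end Endo

/-! ### Localized transportable endomorphisms -/

namespace ObservableNet

variable {N : ObservableNet H}

instance (N : ObservableNet H) : IsClosed (N.quasilocal : Set (H →L[ℂ] H)) :=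
  StarSubalgebra.isClosed_topologicalClosure _

/-- This is Haag duality. Commutation with both `B` and `star B` puts the generators of the region
algebra into a closed star subalgebra, the centralizer of `X`. -/
theorem mem_alg_of_commute (N : ObservableNet H) {a : DoubleCone} {X : H →L[ℂ] H}
    (h : ∀ c, Perp c a → ∀ B ∈ N.alg c, X * B = B * X) : X ∈ N.alg a := by
  rw [← SetLike.mem_coe, ← N.haag_duality a]
  have key : regionAlgebra N.alg (spacelikeCompl a.1) ≤ StarSubalgebra.centralizer ℂ {X} := by
    refine StarSubalgebra.topologicalClosure_minimal (StarAlgebra.adjoin_le ?_) ?_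
    · intro B hB
      obtain ⟨c, hc, hB⟩ := Set.mem_iUnion₂.1 hB
      rw [SetLike.mem_coe, StarSubalgebra.mem_centralizer_iff]
      intro g hg
      rw [Set.mem_singleton_iff] at hg
      subst hg
      refine ⟨h c hc B hB, ?_⟩
      have := congrArg star (h c hc (star B) (star_mem hB))
      simpa using this.symm
    · rw [StarSubalgebra.coe_centralizer]
      exact Set.isClosed_centralizer _
  intro B hB
  exact (((StarSubalgebra.mem_centralizer_iff ℂ).1 (key hB)) X rfl).1.symm

theorem commute_of_perp {a b : DoubleCone} (h : Perp a b) {x y : N.quasilocal}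
    (hx : (x : H →L[ℂ] H) ∈ N.alg a) (hy : (y : H →L[ℂ] H) ∈ N.alg b) : x * y = y * x := by
  have := VonNeumannAlgebra.mem_commutant_iff.1 (N.locality a b h hx) y hy
  exact Subtype.ext this.symm

/-- A closed property of the elements of the net holds if it holds for the local ones. -/
theorem quasilocal_induction {P : N.quasilocal → Prop} (hP : IsClosed {x | P x})
    (h : ∀ (a : DoubleCone) (x : N.quasilocal), (x : H →L[ℂ] H) ∈ N.alg a → P x)
    (x : N.quasilocal) : P x := by
  -- Double cones are directed, so the union of the local algebras is itself a star subalgebra, and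
  -- a dense one.
  let S : StarSubalgebra ℂ (H →L[ℂ] H) :=
    { carrier := ⋃ a, (N.alg a : Set (H →L[ℂ] H))
      mul_mem' := by
        intro x y hx hy
        obtain ⟨a, ha⟩ := Set.mem_iUnion.1 hx
        obtain ⟨b, hb⟩ := Set.mem_iUnion.1 hy
        obtain ⟨c, hac, hbc⟩ := a.exists_union_subset b
        exact Set.mem_iUnion.2 ⟨c, mul_mem (N.isotony a c hac ha) (N.isotony b c hbc hb)⟩
      add_mem' := by
        intro x y hx hy
        obtain ⟨a, ha⟩ := Set.mem_iUnion.1 hx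
        obtain ⟨b, hb⟩ := Set.mem_iUnion.1 hy
        obtain ⟨c, hac, hbc⟩ := a.exists_union_subset b
        exact Set.mem_iUnion.2 ⟨c, add_mem (N.isotony a c hac ha) (N.isotony b c hbc hb)⟩
      algebraMap_mem' := fun r => Set.mem_iUnion.2 ⟨remoteCone 0,
        (N.alg (remoteCone 0)).toStarSubalgebra.algebraMap_mem r⟩
      star_mem' := by
        intro x hx
        obtain ⟨a, ha⟩ := Set.mem_iUnion.1 hx
        exact Set.mem_iUnion.2 ⟨a, star_mem ha⟩ }
  have hle : N.quasilocal ≤ S.topologicalClosure := by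
    refine StarSubalgebra.topologicalClosure_mono (StarAlgebra.adjoin_le ?_)
    exact Set.iUnion₂_subset fun a _ => Set.subset_iUnion
      (fun a => (N.alg a : Set (H →L[ℂ] H))) a
  have hx : (x : H →L[ℂ] H) ∈ closure (S : Set (H →L[ℂ] H)) := hle x.2
  obtain ⟨y, hy, hyx⟩ := mem_closure_iff_seq_limit.1 hx
  have hyN : ∀ n, y n ∈ N.quasilocal := fun n => by
    obtain ⟨a, ha⟩ := Set.mem_iUnion.1 (hy n)
    exact N.alg_le_quasilocal a ha
  have hlim : Filter.Tendsto (fun n => (⟨y n, hyN n⟩ : N.quasilocal)) Filter.atTop (nhds x) :=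
    tendsto_subtype_rng.2 hyx
  refine hP.mem_of_tendsto hlim (Filter.Eventually.of_forall fun n => ?_)
  obtain ⟨a, ha⟩ := Set.mem_iUnion.1 (hy n)
  exact h a _ ha

end ObservableNet

section Localized

variable {N : ObservableNet H}

/-- The (not necessarily unital) endomorphisms of the C*-algebra of the net. -/
abbrev NetEndo (N : ObservableNet H) := N.quasilocal →⋆ₙₐ[ℂ] N.quasilocal

namespace NetEndo

theorem continuous (f : NetEndo N) : Continuous f := by
  refine AddMonoidHomClass.continuous_of_bound f 1 fun x => ?_
  rw [one_mul]
  exact NonUnitalStarAlgHom.norm_apply_le f x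

/-- `f` is localized in `o`. -/
def LocalizedIn (f : NetEndo N) (o : DoubleCone) : Prop :=
  ∀ a : DoubleCone, Perp a o → ∀ x : N.quasilocal, (x : H →L[ℂ] H) ∈ N.alg a → f x = x * f 1

/-- `f` is localized and transportable. -/
def IsLT (f : NetEndo N) : Prop :=
  (∃ o, LocalizedIn f o) ∧ ∀ o, ∃ (g : NetEndo N) (u : N.quasilocal),
    LocalizedIn g o ∧ UnitaryEquiv f g u

variable {f g h f₁ g₁ f' g' f₁' g₁' : NetEndo N} {o o₁ o₂ a : DoubleCone}
  {x t s u v u' v' : N.quasilocal}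

namespace LocalizedIn

theorem mono (hf : LocalizedIn f o) (ho : o.1 ⊆ o₁.1) : LocalizedIn f o₁ :=
  fun a ha x hx => hf a (ha.mono subset_rfl ho) x hx

theorem apply_eq (hf : LocalizedIn f o) (ha : Perp a o) (hx : (x : H →L[ℂ] H) ∈ N.alg a) :
    f x = x * f 1 := hf a ha x hx

theorem apply_eq' (hf : LocalizedIn f o) (ha : Perp a o) (hx : (x : H →L[ℂ] H) ∈ N.alg a) :
    f x = f 1 * x := by
  have h1 := congrArg star (hf a ha (star x) (star_mem hx))
  rwa [star_mul, star_star, star_map_one, map_star, star_star] at h1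

theorem intertwiner_mem (hf : LocalizedIn f o) (hg : LocalizedIn g o) (ht : Intertwines f g t) :
    (t : H →L[ℂ] H) ∈ N.alg o := by
  refine N.mem_alg_of_commute fun c hc B hB => ?_
  let b : N.quasilocal := ⟨B, N.alg_le_quasilocal c hB⟩
  have e : t * b = b * t := by
    rw [← ht.right, mul_assoc, ← hf.apply_eq' hc hB, ht.comm, hg.apply_eq hc hB, mul_assoc,
      ht.left, ht.right]
  exact congrArg Subtype.val e

theorem one_mem (hf : LocalizedIn f o) : ((f 1 : N.quasilocal) : H →L[ℂ] H) ∈ N.alg o :=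
  hf.intertwiner_mem hf (Intertwines.one f)

theorem apply_mem (hf : LocalizedIn f o) (hx : (x : H →L[ℂ] H) ∈ N.alg o) :
    ((f x : N.quasilocal) : H →L[ℂ] H) ∈ N.alg o := by
  refine N.mem_alg_of_commute fun c hc B hB => ?_
  let b : N.quasilocal := ⟨B, N.alg_le_quasilocal c hB⟩
  have hxb : b * x = x * b := ObservableNet.commute_of_perp hc hB hx
  have e : f x * b = b * f x := by
    rw [← map_mul_one, mul_assoc, ← hf.apply_eq' hc hB, ← map_mul, ← hxb, map_mul,
      hf.apply_eq hc hB, mul_assoc, map_one_mul, map_mul_one]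
  exact congrArg Subtype.val e

theorem comp (hf : LocalizedIn f o) (hg : LocalizedIn g o) : LocalizedIn (f.comp g) o := by
  intro a ha x hx
  simp only [NonUnitalStarAlgHom.comp_apply]
  rw [hg.apply_eq ha hx, map_mul, hf.apply_eq ha hx, mul_assoc, map_one_mul]

end LocalizedIn

theorem localizedIn_id : LocalizedIn (NonUnitalStarAlgHom.id ℂ N.quasilocal) o :=
  fun _ _ x _ => by simp

theorem localizedIn_subEndo {e : N.quasilocal} {he : Intertwines f f e} {hs : star e = e}
    {hi : e * e = e} (hf : LocalizedIn f o) : LocalizedIn (subEndo f e he hs hi) o :=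
  fun a ha x hx => by
    rw [subEndo_one, subEndo_apply, he.comm, hf.apply_eq ha hx, mul_assoc, he.left]

theorem IsLT.comp (hf : IsLT f) (hg : IsLT g) : IsLT (f.comp g) := by
  refine ⟨?_, fun o => ?_⟩
  · obtain ⟨o₁, h₁⟩ := hf.1
    obtain ⟨o₂, h₂⟩ := hg.1
    obtain ⟨o, ho₁, ho₂⟩ := o₁.exists_union_subset o₂
    exact ⟨o, (h₁.mono ho₁).comp (h₂.mono ho₂)⟩
  · obtain ⟨f₁, u, hf₁, hu⟩ := hf.2 o
    obtain ⟨g₁, v, hg₁, hv⟩ := hg.2 o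
    exact ⟨_, _, hf₁.comp hg₁, hu.times hv⟩

theorem isLT_id : IsLT (NonUnitalStarAlgHom.id ℂ N.quasilocal) :=
  ⟨⟨remoteCone 0, localizedIn_id⟩, fun _ => ⟨_, _, localizedIn_id, UnitaryEquiv.refl _⟩⟩

/-- A transporter `u` from `f` to `g` carries `e` to the projection `u e u⁺` of `(g, g)`, and `u e`
transports the subobject. -/
theorem IsLT.sub {e : N.quasilocal} {he : Intertwines f f e} {hs : star e = e}
    {hi : e * e = e} (hf : IsLT f) : IsLT (subEndo f e he hs hi) := by
  obtain ⟨o, ho⟩ := hf.1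
  refine ⟨⟨o, localizedIn_subEndo ho⟩, fun o => ?_⟩
  obtain ⟨g, u, hg, hu⟩ := hf.2 o
  have hge : Intertwines g g (u * e * star u) :=
    (hu.toIntertwines.mul he).mul hu.toIntertwines.star
  have hgs : star (u * e * star u) = u * e * star u := by
    simp only [star_mul, star_star, hs, mul_assoc]
  have hgi : u * e * star u * (u * e * star u) = u * e * star u := by
    calc _ = u * (e * (star u * u) * e) * star u := by simp only [mul_assoc]
      _ = _ := by rw [hu.star_mul_self, he.right, hi, mul_assoc]
  refine ⟨subEndo g _ hge hgs hgi, u * e, localizedIn_subEndo hg, ⟨⟨?_, ?_, fun a => ?_⟩, ?_, ?_⟩⟩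
  · rw [subEndo_one, mul_assoc, hi]
  · rw [subEndo_one]
    calc _ = u * (e * (star u * u) * e) := by simp only [mul_assoc]
      _ = _ := by rw [hu.star_mul_self, he.right, hi]
  · rw [subEndo_apply, subEndo_apply]
    calc u * e * (e * f a) = u * (e * e * f a) := by simp only [mul_assoc]
      _ = u * (f a * e) := by rw [hi, he.comm]
      _ = u * (f a * (e * (f 1 * e))) := by rw [he.left, hi]
      _ = u * e * f a * (star u * u) * e := by
        rw [hu.star_mul_self, mul_assoc u, he.comm]; simp only [mul_assoc]
      _ = u * e * (f a * star u) * (u * e) := by simp only [mul_assoc]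
      _ = u * e * star u * g a * (u * e) := by
        rw [← hu.toIntertwines.star.comm]; simp only [mul_assoc]
  · rw [subEndo_one]
    calc star (u * e) * (u * e) = e * (star u * u) * e := by
          rw [star_mul, hs]; simp only [mul_assoc]
      _ = e := by rw [hu.star_mul_self, he.right, hi]
  · rw [subEndo_one, star_mul, hs]
    calc u * e * (e * star u) = u * (e * e) * star u := by simp only [mul_assoc]
      _ = _ := by rw [hi]

/-! ### The symmetry -/

/-- The exchange operator defined by a choice of transporters. -/
def exchange (f g₁ : NetEndo N) (u v : N.quasilocal) : N.quasilocal :=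
  star v * g₁ (star u) * u * f v

/-- Transported to the two cones, `t` and `s` become `x = u' t u⁺` and `y = v' s v⁺`. These lie in
the local algebras of `o₁` and `o₂`, so they commute, and `f₁ y` and `g₁ x` are mere products with
the units. -/
theorem exchange_naturality (ho : Perp o₁ o₂) (hf₁ : LocalizedIn f₁ o₁) (hg₁ : LocalizedIn g₁ o₂)
    (hf₁' : LocalizedIn f₁' o₁) (hg₁' : LocalizedIn g₁' o₂) (hu : UnitaryEquiv f f₁ u)
    (hv : UnitaryEquiv g g₁ v) (hu' : UnitaryEquiv f' f₁' u') (hv' : UnitaryEquiv g' g₁' v')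
    (ht : Intertwines f f' t) (hs : Intertwines g g' s) :
    exchange f' g₁' u' v' * (t * f s) = s * g t * exchange f g₁ u v := by
  obtain ⟨x, hx⟩ : ∃ x, x = u' * t * star u := ⟨_, rfl⟩
  obtain ⟨y, hy⟩ : ∃ y, y = v' * s * star v := ⟨_, rfl⟩
  have hxI : Intertwines f₁ f₁' x :=
    hx ▸ (hu'.toIntertwines.mul ht).mul hu.toIntertwines.star
  have hyI : Intertwines g₁ g₁' y :=
    hy ▸ (hv'.toIntertwines.mul hs).mul hv.toIntertwines.star
  have hxm := hf₁.intertwiner_mem hf₁' hxI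
  have hym := hg₁.intertwiner_mem hg₁' hyI
  have hxu : u' * t = x * u := by
    rw [hx, mul_assoc _ (star u), hu.star_mul_self, mul_assoc, ht.right]
  have hyv : v' * s = y * v := by
    rw [hy, mul_assoc _ (star v), hv.star_mul_self, mul_assoc, hs.right]
  have hxy : x * y = y * x := ObservableNet.commute_of_perp ho hxm hym
  have e1 : u' * f' v' * (t * f s) = y * x * (u * f v) := by
    calc u' * f' v' * (t * f s) = u' * (f' v' * t) * f s := by simp only [mul_assoc]
      _ = u' * t * f (v' * s) := by rw [← ht.comm, map_mul]; simp only [mul_assoc]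
      _ = x * (u * f y) * f v := by rw [hxu, hyv, map_mul]; simp only [mul_assoc]
      _ = x * y * (f₁ 1 * u) * f v := by
        rw [hu.comm, hf₁.apply_eq ho.symm hym]; simp only [mul_assoc]
      _ = y * x * (u * f v) := by rw [hu.left, hxy]; simp only [mul_assoc]
  have e2 : star v' * y = s * star v := by
    calc star v' * y = star v' * v' * s * star v := by rw [hy]; simp only [mul_assoc]
      _ = s * star v := by rw [hv'.star_mul_self, hs.left]
  have e3 : star u' * x = t * star u := by
    calc star u' * x = star u' * u' * t * star u := by rw [hx]; simp only [mul_assoc]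
      _ = t * star u := by rw [hu'.star_mul_self, ht.left]
  have e4 : g₁ 1 * x = g₁ x := (hg₁.apply_eq' ho hxm).symm
  calc exchange f' g₁' u' v' * (t * f s)
      = star v' * g₁' (star u') * (u' * f' v' * (t * f s)) := by
        simp only [exchange, mul_assoc]
    _ = star v' * (g₁' (star u') * y) * x * (u * f v) := by rw [e1]; simp only [mul_assoc]
    _ = star v' * y * (g₁ (star u') * g₁ 1) * x * (u * f v) := by
        rw [← hyI.comm, map_mul_one]; simp only [mul_assoc]
    _ = s * star v * (g₁ (star u') * (g₁ 1 * x)) * (u * f v) := by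
        rw [e2]; simp only [mul_assoc]
    _ = s * (star v * g₁ t) * g₁ (star u) * (u * f v) := by
        rw [e4, ← map_mul, e3, map_mul]; simp only [mul_assoc]
    _ = s * g t * exchange f g₁ u v := by
        rw [hv.toIntertwines.star.comm]; simp only [exchange, mul_assoc]

/-- `e` is an exchange operator of `f` and `g` obtained by transport into `o₁` and `o₂`. -/
def IsExchangeAt (f g : NetEndo N) (o₁ o₂ : DoubleCone) (e : N.quasilocal) : Prop :=
  ∃ (f₁ g₁ : NetEndo N) (u v : N.quasilocal), LocalizedIn f₁ o₁ ∧ LocalizedIn g₁ o₂ ∧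
    UnitaryEquiv f f₁ u ∧ UnitaryEquiv g g₁ v ∧ e = exchange f g₁ u v

theorem IsExchangeAt.mul_unit {e : N.quasilocal} (h : IsExchangeAt f g o₁ o₂ e) :
    e * f (g 1) = e := by
  obtain ⟨f₁, g₁, u, v, -, -, hu, hv, rfl⟩ := h
  rw [exchange, mul_assoc, ← map_mul, hv.right]

theorem IsExchangeAt.unit_mul {e : N.quasilocal} (h : IsExchangeAt f g o₁ o₂ e) :
    g (f 1) * e = e := by
  obtain ⟨f₁, g₁, u, v, -, -, hu, hv, rfl⟩ := h
  rw [exchange, ← mul_assoc, ← mul_assoc, ← mul_assoc, ← hv.toIntertwines.star.comm, mul_assoc _ _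
    (g₁ _), ← map_mul, hu.toIntertwines.star.left]

open Classical in
/-- The symmetry of two localized transportable endomorphisms. -/
def eps (f g : NetEndo N) : N.quasilocal :=
  if h : ∃ (e : N.quasilocal) (o₁ o₂ : DoubleCone), Perp o₁ o₂ ∧ IsExchangeAt f g o₁ o₂ e then
    h.choose else 0

theorem exists_isExchangeAt (hf : IsLT f) (hg : IsLT g) (o₁ o₂ : DoubleCone) :
    ∃ e, IsExchangeAt f g o₁ o₂ e := by
  obtain ⟨f₁, u, hf₁, hu⟩ := hf.2 o₁
  obtain ⟨g₁, v, hg₁, hv⟩ := hg.2 o₂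
  exact ⟨_, f₁, g₁, u, v, hf₁, hg₁, hu, hv, rfl⟩

theorem IsExchangeAt.unique {o₁' o₂' : DoubleCone} {e e' : N.quasilocal} (hf : IsLT f)
    (hg : IsLT g) (ho : Perp o₁ o₂) (ho' : Perp o₁' o₂') (he : IsExchangeAt f g o₁ o₂ e)
    (he' : IsExchangeAt f g o₁' o₂' e') : e = e' := by
  refine eq_of_spacelike_chain (fun a b e => IsExchangeAt f g a b e)
    (fun a b _ => exists_isExchangeAt hf hg a b) ?_ ?_ ho ho' he he'
  · intro a b x y hab hx hy
    have h1 := hx.mul_unit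
    have h2 := hy.unit_mul
    obtain ⟨f₁, g₁, u, v, hf₁, hg₁, hu, hv, rfl⟩ := hx
    obtain ⟨f₁', g₁', u', v', hf₁', hg₁', hu', hv', rfl⟩ := hy
    -- For a fixed pair of cones, uniqueness is naturality with respect to the identity arrows.
    -- Different pairs are compared by the connectedness of the spacelike pairs.
    have := exchange_naturality hab hf₁' hg₁' hf₁ hg₁ hu' hv' hu hv (Intertwines.one f)
      (Intertwines.one g)
    rwa [map_one_mul, map_one_mul, h1, h2] at this
  · rintro a b a' b' x ha hb - ⟨f₁, g₁, u, v, hf₁, hg₁, h⟩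
    exact ⟨f₁, g₁, u, v, hf₁.mono ha, hg₁.mono hb, h⟩

theorem eps_eq_of_isExchangeAt {e : N.quasilocal} (hf : IsLT f) (hg : IsLT g) (ho : Perp o₁ o₂)
    (he : IsExchangeAt f g o₁ o₂ e) : eps f g = e := by
  have h : ∃ (e : N.quasilocal) (o₁ o₂ : DoubleCone), Perp o₁ o₂ ∧ IsExchangeAt f g o₁ o₂ e :=
    ⟨e, o₁, o₂, ho, he⟩
  rw [eps, dif_pos h]
  obtain ⟨a, b, hab, hx⟩ := h.choose_spec
  exact IsExchangeAt.unique hf hg hab ho hx he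

theorem eps_eq_exchange (hf : IsLT f) (hg : IsLT g) (ho : Perp o₁ o₂) (hf₁ : LocalizedIn f₁ o₁)
    (hg₁ : LocalizedIn g₁ o₂) (hu : UnitaryEquiv f f₁ u) (hv : UnitaryEquiv g g₁ v) :
    eps f g = exchange f g₁ u v :=
  eps_eq_of_isExchangeAt hf hg ho ⟨f₁, g₁, u, v, hf₁, hg₁, hu, hv, rfl⟩

theorem eps_naturality (hf : IsLT f) (hg : IsLT g) (hf' : IsLT f') (hg' : IsLT g')
    (ht : Intertwines f f' t) (hs : Intertwines g g' s) :
    eps f' g' * (t * f s) = s * g t * eps f g := by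
  have ho : Perp (remoteCone 0) (remoteCone 1) := perp_remoteCone zero_ne_one
  obtain ⟨f₁, u, hf₁, hu⟩ := hf.2 (remoteCone 0)
  obtain ⟨g₁, v, hg₁, hv⟩ := hg.2 (remoteCone 1)
  obtain ⟨f₁', u', hf₁', hu'⟩ := hf'.2 (remoteCone 0)
  obtain ⟨g₁', v', hg₁', hv'⟩ := hg'.2 (remoteCone 1)
  rw [eps_eq_exchange hf hg ho hf₁ hg₁ hu hv, eps_eq_exchange hf' hg' ho hf₁' hg₁' hu' hv']
  exact exchange_naturality ho hf₁ hg₁ hf₁' hg₁' hu hv hu' hv' ht hs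

/-- For a local `x` the transports can be chosen spacelike to its region, where the transported
endomorphisms act on `x` through their units only. As `eps` does not depend on the transports, the
relation holds for every local `x`, and then by continuity. -/
theorem eps_intertwines (hf : IsLT f) (hg : IsLT g) :
    Intertwines (f.comp g) (g.comp f) (eps f g) := by
  have h1 : ∀ a : DoubleCone, ∃ o₁ o₂, Perp o₁ o₂ ∧ Perp a o₁ ∧ Perp a o₂ := by
    intro a
    obtain ⟨o₁, h₁⟩ := a.exists_perp
    obtain ⟨c, hac, ho₁⟩ := a.exists_union_subset o₁
    obtain ⟨o₂, h₂⟩ := c.exists_perp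
    exact ⟨o₁, o₂, h₂.mono ho₁ subset_rfl, h₁, h₂.mono hac subset_rfl⟩
  obtain ⟨o₁, o₂, ho, -, -⟩ := h1 (remoteCone 0)
  obtain ⟨e, he⟩ := exists_isExchangeAt hf hg o₁ o₂
  refine ⟨?_, ?_, ?_⟩
  · rw [eps_eq_of_isExchangeAt hf hg ho he]; exact he.mul_unit
  · rw [eps_eq_of_isExchangeAt hf hg ho he]; exact he.unit_mul
  refine ObservableNet.quasilocal_induction (isClosed_eq ?_ ?_) ?_
  · exact continuous_const.mul (NetEndo.continuous (f.comp g))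
  · exact (NetEndo.continuous (g.comp f)).mul continuous_const
  intro a x hx
  obtain ⟨o₁, o₂, ho, h₁, h₂⟩ := h1 a
  obtain ⟨f₁, u, hf₁, hu⟩ := hf.2 o₁
  obtain ⟨g₁, v, hg₁, hv⟩ := hg.2 o₂
  rw [eps_eq_exchange hf hg ho hf₁ hg₁ hu hv, exchange]
  simp only [NonUnitalStarAlgHom.comp_apply]
  have e1 : u * f v * f (g x) = x * (u * f v) := by
    rw [mul_assoc, ← map_mul, hv.comm, hg₁.apply_eq h₂ hx, mul_assoc, hv.left, map_mul,
      ← mul_assoc, hu.comm, hf₁.apply_eq h₁ hx, mul_assoc, mul_assoc, ← mul_assoc _ u, hu.left]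
  have e2 : star v * g₁ (star u) * x = g (f x) * (star v * g₁ (star u)) := by
    rw [← mul_assoc, ← hv.toIntertwines.star.comm, mul_assoc _ _ (g₁ _), ← map_mul,
      ← hu.toIntertwines.star.comm, hf₁.apply_eq' h₁ hx, ← mul_assoc, hu.toIntertwines.star.right,
      map_mul, hg₁.apply_eq' h₂ hx, ← mul_assoc _ (g₁ 1) x, map_mul_one, mul_assoc]
  calc star v * g₁ (star u) * u * f v * f (g x)
      = star v * g₁ (star u) * (u * f v * f (g x)) := by simp only [mul_assoc]
    _ = (star v * g₁ (star u) * x) * (u * f v) := by rw [e1]; simp only [mul_assoc]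
    _ = _ := by rw [e2]; simp only [mul_assoc]

theorem star_eps (hf : IsLT f) (hg : IsLT g) : star (eps f g) = eps g f := by
  have ho : Perp (remoteCone 0) (remoteCone 1) := perp_remoteCone zero_ne_one
  obtain ⟨f₁, u, hf₁, hu⟩ := hf.2 (remoteCone 0)
  obtain ⟨g₁, v, hg₁, hv⟩ := hg.2 (remoteCone 1)
  rw [eps_eq_exchange hf hg ho hf₁ hg₁ hu hv, eps_eq_exchange hg hf ho.symm hg₁ hf₁ hv hu, exchange,
    exchange]
  simp only [star_mul, star_star, ← map_star, mul_assoc, hv.comm]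
  rw [hu.toIntertwines.star.comm_assoc]

theorem eps_mul_eps (hf : IsLT f) (hg : IsLT g) : eps g f * eps f g = f (g 1) := by
  have ho : Perp (remoteCone 0) (remoteCone 1) := perp_remoteCone zero_ne_one
  obtain ⟨f₁, u, hf₁, hu⟩ := hf.2 (remoteCone 0)
  obtain ⟨g₁, v, hg₁, hv⟩ := hg.2 (remoteCone 1)
  rw [eps_eq_exchange hf hg ho hf₁ hg₁ hu hv, eps_eq_exchange hg hf ho.symm hg₁ hf₁ hv hu, exchange,
    exchange]
  calc star u * f₁ (star v) * v * g u * (star v * g₁ (star u) * u * f v)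
      = star u * f₁ (star v) * v * (g u * star v) * g₁ (star u) * u * f v := by
        simp only [mul_assoc]
    _ = star u * f₁ (star v) * (v * star v) * g₁ (u * star u) * u * f v := by
        rw [← hv.toIntertwines.star.comm, map_mul]; simp only [mul_assoc]
    _ = star u * f₁ (star v) * (g₁ 1 * f₁ 1) * u * f v := by
        rw [hv.mul_star_self, hu.mul_star_self, mul_assoc _ (g₁ 1), map_one_mul,
          hg₁.apply_eq' ho hf₁.one_mem]
    _ = star u * f₁ (star v * g₁ 1) * u * f v := by
        rw [← hf₁.apply_eq ho.symm hg₁.one_mem, map_mul]; simp only [mul_assoc]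
    _ = star u * (f₁ (star v) * u) * f v := by
        rw [hv.toIntertwines.star.right]; simp only [mul_assoc]
    _ = (star u * u) * f (star v * v) := by rw [← hu.comm, map_mul]; simp only [mul_assoc]
    _ = f (g 1) := by rw [hu.star_mul_self, hv.star_mul_self, map_one_mul]

/-- If `f` is already localized spacelike to the target of `g`, its own unit serves as its
transporter. -/
theorem eps_eq_of_localized (hf : IsLT f) (hg : IsLT g) (ho : Perp o₁ o₂)
    (hf₁ : LocalizedIn f o₁) (hg₁ : LocalizedIn g₁ o₂) (hv : UnitaryEquiv g g₁ v) :
    eps f g = star v * f v := by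
  rw [eps_eq_exchange hf hg ho hf₁ hg₁ (UnitaryEquiv.refl f) hv, exchange, star_map_one,
    hg₁.apply_eq' ho hf₁.one_mem, ← mul_assoc, hv.toIntertwines.star.right, mul_assoc, mul_assoc,
    ← mul_assoc (f 1) (f 1), map_mul_one]
  have h1 : star v * f 1 = star v * g₁ 1 * f 1 := by rw [hv.toIntertwines.star.right]
  rw [map_one_mul]

/-- This is a hexagon identity. With `f` and `h` localized in a common cone and only `g` moved away
from it, all three symmetries are built from one transporter `v`. -/
theorem eps_comp_left (hf : IsLT f) (hh : IsLT h) (hg : IsLT g) :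
    eps (f.comp h) g = eps f g * f (eps h g) := by
  obtain ⟨a, ha⟩ := hf.1
  obtain ⟨b, hb⟩ := hh.1
  obtain ⟨o, hao, hbo⟩ := a.exists_union_subset b
  have hfo := ha.mono hao
  have hho := hb.mono hbo
  obtain ⟨o', ho⟩ := o.exists_perp
  obtain ⟨g₁, v, hg₁, hv⟩ := hg.2 o'
  rw [eps_eq_of_localized (hf.comp hh) hg ho (hfo.comp hho) hg₁ hv,
    eps_eq_of_localized hf hg ho hfo hg₁ hv, eps_eq_of_localized hh hg ho hho hg₁ hv]
  simp only [NonUnitalStarAlgHom.comp_apply]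
  calc star v * f (h v) = star v * g₁ 1 * f 1 * f (h v) := by
        rw [hv.toIntertwines.star.right, mul_assoc, map_one_mul]
    _ = star v * f (g₁ 1) * f (h v) := by
        rw [hfo.apply_eq ho.symm hg₁.one_mem]; simp only [mul_assoc]
    _ = star v * f v * f (star v * h v) := by
        rw [← hv.mul_star_self, map_mul, map_mul]; simp only [mul_assoc]

theorem eps_comp_right (hf : IsLT f) (hg : IsLT g) (hh : IsLT h) :
    eps f (g.comp h) = g (eps f h) * eps f g := by
  rw [← star_eps (hg.comp hh) hf, eps_comp_left hg hh hf, star_mul, ← map_star, star_eps hg hf,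
    star_eps hh hf]

theorem eps_id_right (hf : IsLT f) : eps f (NonUnitalStarAlgHom.id ℂ N.quasilocal) = f 1 := by
  obtain ⟨o, ho⟩ := hf.1
  obtain ⟨o', ho'⟩ := o.exists_perp
  rw [eps_eq_of_localized hf isLT_id ho' ho localizedIn_id (UnitaryEquiv.refl _)]
  simp

end NetEndo

end Localized

/-! ### The representation of the permutation group -/

section Permutations

/-- Induction along the words in the adjacent transpositions. -/
theorem perm_induction {d : ℕ} {P : Equiv.Perm (Fin d) → Prop} (one : P 1)
    (mul_swap : ∀ (w : Equiv.Perm (Fin d)) (i : ℕ) (h : i + 1 < d), P w →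
      P (w * Equiv.swap ⟨i, by omega⟩ ⟨i + 1, h⟩)) (w : Equiv.Perm (Fin d)) : P w := by
  cases d with
  | zero => rwa [Subsingleton.elim w 1]
  | succ n =>
    have hw : w ∈ Submonoid.closure
        (Set.range fun i : Fin n => Equiv.swap i.castSucc i.succ) := by
      rw [Equiv.Perm.mclosure_swap_castSucc_succ]; trivial
    induction hw using Submonoid.closure_induction_right with
    | one => exact one
    | mul_right x hx y hy ih =>
      obtain ⟨i, rfl⟩ := hy
      exact mul_swap x i (by omega) ih

/-- The permutation of `d + 1` letters which fixes `0` and acts like `e` on the others. -/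
def shiftPerm {d : ℕ} (e : Equiv.Perm (Fin d)) : Equiv.Perm (Fin (d + 1)) :=
  Equiv.Perm.decomposeFin.symm (0, e)

@[simp] theorem shiftPerm_zero {d : ℕ} (e : Equiv.Perm (Fin d)) : shiftPerm e 0 = 0 := by
  simp [shiftPerm]

@[simp] theorem shiftPerm_succ {d : ℕ} (e : Equiv.Perm (Fin d)) (i : Fin d) :
    shiftPerm e i.succ = (e i).succ := by
  simp [shiftPerm]

theorem shiftPerm_one {d : ℕ} : shiftPerm (1 : Equiv.Perm (Fin d)) = 1 := by
  ext i; refine Fin.cases ?_ (fun i => ?_) i <;> simp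

theorem shiftPerm_mul {d : ℕ} (e e' : Equiv.Perm (Fin d)) :
    shiftPerm (e * e') = shiftPerm e * shiftPerm e' := by
  ext i; refine Fin.cases ?_ (fun i => ?_) i <;> simp

theorem shiftPerm_swap {d : ℕ} (i j : Fin d) :
    shiftPerm (Equiv.swap i j) = Equiv.swap i.succ j.succ := by
  ext k
  refine Fin.cases ?_ (fun k => ?_) k
  · rw [shiftPerm_zero, Equiv.swap_apply_of_ne_of_ne] <;> exact (Fin.succ_ne_zero _).symm
  · rw [shiftPerm_succ]
    simp only [Equiv.swap_apply_def, Fin.succ_inj]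
    split_ifs <;> rfl

/-- The transpositions of `0` with `j` represent the cosets of the stabilizer of `0`. The recursion
for the (anti)symmetrizers rests on this. -/
theorem decomposeFin_symm_eq {d : ℕ} (j : Fin (d + 1)) (e : Equiv.Perm (Fin d)) :
    Equiv.Perm.decomposeFin.symm (j, e) = Equiv.swap 0 j * shiftPerm e := by
  ext i
  refine Fin.cases ?_ (fun i => ?_) i
  · simp
  · simp

/-- One of the two characters of the permutation group: the sign for `b = true`. -/
def permChar (b : Bool) {d : ℕ} : Equiv.Perm (Fin d) →* ℂ where
  toFun w := if b then (((Equiv.Perm.sign w : ℤˣ) : ℤ) : ℂ) else 1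
  map_one' := by simp
  map_mul' w w' := by cases b <;> simp

/-- The value of the character at the transpositions. -/
def permSign (b : Bool) : ℂ := if b then -1 else 1

theorem permChar_swap (b : Bool) {d : ℕ} {i j : Fin d} (h : i ≠ j) :
    permChar b (Equiv.swap i j) = permSign b := by
  cases b <;> simp [permChar, permSign, Equiv.Perm.sign_swap h]

theorem permSign_mul_self (b : Bool) : permSign b * permSign b = 1 := by
  cases b <;> simp [permSign]

theorem permChar_mul_self (b : Bool) {d : ℕ} (w : Equiv.Perm (Fin d)) :
    permChar b w * permChar b w = 1 := by
  cases b
  · simp [permChar]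
  · rcases Int.units_eq_one_or (Equiv.Perm.sign w) with h | h <;> simp [permChar, h]

theorem permChar_inv (b : Bool) {d : ℕ} (w : Equiv.Perm (Fin d)) :
    permChar b w⁻¹ = permChar b w := by
  cases b <;> simp [permChar]

theorem star_permChar (b : Bool) {d : ℕ} (w : Equiv.Perm (Fin d)) :
    star (permChar b w) = permChar b w := by
  cases b <;> simp [permChar]

theorem permChar_shiftPerm (b : Bool) {d : ℕ} (w : Equiv.Perm (Fin d)) :
    permChar b (shiftPerm w) = permChar b w := by
  cases b
  · simp [permChar]
  · simp [permChar, shiftPerm, Equiv.Perm.decomposeFin.symm_sign]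

end Permutations

/-! ### Transport products and the permutations of tensor factors. -/

section PermRep

variable {N : ObservableNet H}

namespace NetEndo

/-- The tensor powers. -/
def npow (f : NetEndo N) : ℕ → NetEndo N
  | 0 => NonUnitalStarAlgHom.id ℂ N.quasilocal
  | d + 1 => (npow f d).comp f

variable {f g : NetEndo N} {o : DoubleCone}

@[simp] theorem npow_zero_apply (a : N.quasilocal) : npow f 0 a = a := rfl

theorem npow_succ_apply (d : ℕ) (a : N.quasilocal) : npow f (d + 1) a = npow f d (f a) := rfl

theorem npow_one : npow f 1 = f := by ext a; rfl

theorem npow_add (m d : ℕ) : npow f (m + d) = (npow f m).comp (npow f d) := by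
  induction d with
  | zero => rfl
  | succ d ih =>
    refine DFunLike.ext _ _ fun a => ?_
    change npow f (m + d) (f a) = _
    rw [ih]
    rfl

theorem npow_add_apply (m d : ℕ) (a : N.quasilocal) :
    npow f (m + d) a = npow f m (npow f d a) := by rw [npow_add]; rfl

theorem npow_succ' (d : ℕ) : npow f (d + 1) = f.comp (npow f d) := by
  rw [add_comm, npow_add, npow_one]

theorem npow_succ_apply' (d : ℕ) (a : N.quasilocal) : npow f (d + 1) a = f (npow f d a) := by
  rw [npow_succ']; rfl

theorem IsLT.npow (hf : IsLT f) (d : ℕ) : IsLT (npow f d) := by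
  induction d with
  | zero => exact isLT_id
  | succ d ih => exact ih.comp hf

theorem npow_mul_unit {m d : ℕ} (h : m ≤ d) : npow f m 1 * npow f d 1 = npow f d 1 := by
  obtain ⟨k, rfl⟩ := Nat.exists_eq_add_of_le h
  rw [npow_add_apply, map_one_mul]

theorem unit_mul_npow {m d : ℕ} (h : m ≤ d) : npow f d 1 * npow f m 1 = npow f d 1 := by
  obtain ⟨k, rfl⟩ := Nat.exists_eq_add_of_le h
  rw [npow_add_apply, map_mul_one]

theorem eps_self_comm (hf : IsLT f) (a : N.quasilocal) : eps f f * f (f a) = f (f a) * eps f f :=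
  (eps_intertwines hf hf).comm a

theorem npow_eps_comm (hf : IsLT f) {i d : ℕ} (h : i + 2 ≤ d) (a : N.quasilocal) :
    npow f i (eps f f) * npow f d a = npow f d a * npow f i (eps f f) := by
  obtain ⟨k, rfl⟩ := Nat.exists_eq_add_of_le h
  rw [show i + 2 + k = i + (1 + 1 + k) by ring, npow_add_apply, npow_add_apply (1 + 1), ← map_mul,
    ← map_mul]
  congr 1
  exact eps_self_comm hf _

theorem eps_self_mul_self (hf : IsLT f) : eps f f * eps f f = f (f 1) := eps_mul_eps hf hf

/-- The transported endomorphisms, localized in mutually spacelike double cones. -/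
def transported (hf : IsLT f) (k : ℕ) : NetEndo N := (hf.2 (remoteCone k)).choose

/-- The transporters. -/
def transporter (hf : IsLT f) (k : ℕ) : N.quasilocal := (hf.2 (remoteCone k)).choose_spec.choose

theorem transported_localizedIn (hf : IsLT f) (k : ℕ) :
    LocalizedIn (transported hf k) (remoteCone k) :=
  (hf.2 (remoteCone k)).choose_spec.choose_spec.1

theorem transporter_unitary (hf : IsLT f) (k : ℕ) :
    UnitaryEquiv f (transported hf k) (transporter hf k) :=
  (hf.2 (remoteCone k)).choose_spec.choose_spec.2

/-- The symmetry reverses the order of two transporters. This relation makes a verification of the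
braid relations superfluous. -/
theorem transporter_exchange (hf : IsLT f) {k l : ℕ} (h : k ≠ l) :
    transporter hf l * f (transporter hf k) * eps f f =
      transporter hf k * f (transporter hf l) := by
  have ho := perp_remoteCone h
  have hk := transporter_unitary hf k
  have hl := transporter_unitary hf l
  have hlk := transported_localizedIn hf k
  have hll := transported_localizedIn hf l
  rw [eps_eq_exchange hf hf ho hlk hll hk hl, exchange]
  generalize transporter hf k = u at *
  generalize transporter hf l = v at *
  generalize transported hf k = f₁ at *
  generalize transported hf l = g₁ at *
  calc v * f u * (star v * g₁ (star u) * u * f v)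
      = v * (f u * star v) * g₁ (star u) * u * f v := by simp only [mul_assoc]
    _ = (v * star v) * g₁ (u * star u) * u * f v := by
        rw [← hl.toIntertwines.star.comm, map_mul]; simp only [mul_assoc]
    _ = f₁ (g₁ 1) * u * f v := by
        rw [hl.mul_star_self, hk.mul_star_self, map_one_mul, hll.apply_eq' ho hlk.one_mem,
          hlk.apply_eq ho.symm hll.one_mem]
    _ = u * f v := by rw [← hk.comm, mul_assoc, ← map_mul, hl.left]

/-- The product of the transporters with the labels `k`. -/
def transportProd (hf : IsLT f) (k : ℕ → ℕ) : ℕ → N.quasilocal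
  | 0 => 1
  | d + 1 => transportProd hf k d * npow f d (transporter hf (k d))

theorem star_transportProd_mul (hf : IsLT f) (k : ℕ → ℕ) (d : ℕ) :
    star (transportProd hf k d) * transportProd hf k d = npow f d 1 := by
  induction d with
  | zero => simp [transportProd]
  | succ d ih =>
    rw [transportProd, star_mul, mul_assoc, ← mul_assoc (star (transportProd hf k d)), ih,
      map_one_mul, ← map_star, ← map_mul, (transporter_unitary hf (k d)).star_mul_self]
    rfl

theorem transportProd_mul_unit (hf : IsLT f) (k : ℕ → ℕ) (d : ℕ) :
    transportProd hf k d * npow f d 1 = transportProd hf k d := by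
  cases d with
  | zero => simp
  | succ d =>
    rw [transportProd, npow_succ_apply, mul_assoc, ← map_mul,
      (transporter_unitary hf (k d)).right]

theorem transportProd_congr (hf : IsLT f) {k k' : ℕ → ℕ} {d : ℕ} (h : ∀ i < d, k i = k' i) :
    transportProd hf k d = transportProd hf k' d := by
  induction d with
  | zero => rfl
  | succ d ih =>
    rw [transportProd, transportProd, ih fun i hi => h i (by omega), h d (by omega)]

/-- The exchange of the factors `i` and `i + 1` of `f ^ d`. -/
def exchangeAt (f : NetEndo N) (d i : ℕ) : N.quasilocal := npow f i (eps f f) * npow f d 1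

/-- Right multiplication by an exchange interchanges two neighbouring labels: this is
`transporter_exchange` under `npow f i`. Further factors are added one at a time, and the exchange
passes through them up to units. -/
theorem transportProd_swap (hf : IsLT f) {k : ℕ → ℕ} {d i : ℕ} (h : i + 2 ≤ d)
    (hk : k i ≠ k (i + 1)) :
    transportProd hf (k ∘ Equiv.swap i (i + 1)) d * exchangeAt f d i = transportProd hf k d := by
  obtain ⟨j, rfl⟩ := Nat.exists_eq_add_of_le h
  clear h
  unfold exchangeAt
  induction j with
  | zero =>
    have e0 : transportProd hf (k ∘ Equiv.swap i (i + 1)) i = transportProd hf k i := by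
      refine transportProd_congr hf fun l hl => ?_
      rw [Function.comp_apply, Equiv.swap_apply_of_ne_of_ne] <;> omega
    rw [← transportProd_mul_unit hf k (i + 2 + 0)]
    simp only [transportProd, add_zero, Function.comp_apply, Equiv.swap_apply_left,
      Equiv.swap_apply_right, e0, npow_succ_apply i]
    have e1 := transporter_exchange hf hk
    have e2 := congrArg (fun a => transportProd hf k i * npow f i a * npow f (i + 2) 1) e1
    simp only [map_mul] at e2
    simp only [mul_assoc] at e2 ⊢
    exact e2
  | succ j ih =>
    have e0 : (k ∘ Equiv.swap i (i + 1)) (i + 2 + j) = k (i + 2 + j) := by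
      rw [Function.comp_apply, Equiv.swap_apply_of_ne_of_ne] <;> omega
    rw [← add_assoc, ← transportProd_mul_unit hf k (i + 2 + j + 1), transportProd, transportProd,
      e0, ← ih]
    generalize transporter hf (k (i + 2 + j)) = u
    have e1 : npow f (i + 2 + j) u = npow f (i + 2 + j) 1 * npow f (i + 2 + j) u := by
      rw [map_one_mul]
    have e2 := npow_eps_comm hf (show i + 2 ≤ i + 2 + j by omega) u
    simp only [mul_assoc] at e2 ⊢
    rw [← mul_assoc (npow f (i + 2 + j) u), ← e2, map_one_mul_assoc]
    simp only [mul_assoc]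

/-- The labels attached to a permutation. -/
def permLabels {d : ℕ} (w : Equiv.Perm (Fin d)) (i : ℕ) : ℕ := if h : i < d then w ⟨i, h⟩ else i

theorem permLabels_mul_swap {d : ℕ} (w : Equiv.Perm (Fin d)) {i : ℕ} (h : i + 1 < d) :
    permLabels (w * Equiv.swap ⟨i, by omega⟩ ⟨i + 1, h⟩) =
      permLabels w ∘ Equiv.swap i (i + 1) := by
  funext j
  by_cases hj : j < d
  · have : (Equiv.swap (⟨i, by omega⟩ : Fin d) ⟨i + 1, h⟩ ⟨j, hj⟩ : ℕ) =
        Equiv.swap i (i + 1) j := by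
      simp only [Equiv.swap_apply_def, Fin.mk.injEq]
      split_ifs <;> rfl
    have hlt : Equiv.swap i (i + 1) j < d := by rw [← this]; exact Fin.is_lt _
    simp only [permLabels, hj, dif_pos, Function.comp_apply, hlt, Equiv.Perm.mul_apply]
    congr 2
    exact Fin.ext this
  · have : Equiv.swap i (i + 1) j = j := by
      rw [Equiv.swap_apply_of_ne_of_ne] <;> omega
    simp [permLabels, hj, this]

theorem exchangeAt_mul_self (hf : IsLT f) {d i : ℕ} (h : i + 1 < d) :
    exchangeAt f d i * exchangeAt f d i = npow f d 1 := by
  unfold exchangeAt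
  rw [mul_assoc, ← mul_assoc (npow f d 1), ← npow_eps_comm hf (show i + 2 ≤ d by omega),
    mul_assoc (npow f i _) (npow f d 1), map_mul_one, ← mul_assoc, ← map_mul, eps_self_mul_self hf]
  exact npow_mul_unit (m := i + 2) (by omega)

/-- The representation of the permutation group on the tensor power `f ^ d`. -/
def permRep (hf : IsLT f) (d : ℕ) (w : Equiv.Perm (Fin d)) : N.quasilocal :=
  star (transportProd hf (permLabels (1 : Equiv.Perm (Fin d))) d) *
    transportProd hf (permLabels w) d

theorem transportProd_mul_swap (hf : IsLT f) {d : ℕ} (w : Equiv.Perm (Fin d)) {i : ℕ}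
    (h : i + 1 < d) :
    transportProd hf (permLabels (w * Equiv.swap ⟨i, by omega⟩ ⟨i + 1, h⟩)) d =
      transportProd hf (permLabels w) d * exchangeAt f d i := by
  rw [permLabels_mul_swap, ← transportProd_swap hf (k := permLabels w) (show i + 2 ≤ d by omega),
    mul_assoc, exchangeAt_mul_self hf h, transportProd_mul_unit]
  have h1 : i < d := by omega
  simp only [permLabels, h, h1, dif_pos]
  intro he
  have := w.injective (Fin.ext he)
  simp [Fin.ext_iff] at this

theorem permRep_one (hf : IsLT f) (d : ℕ) : permRep hf d 1 = npow f d 1 :=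
  star_transportProd_mul hf _ d

/-- With `U_g` for the transport product labelled by `g`, this reads `U_{gw} = U_g ε(w)` for every
`g`, although `ε(w)` is defined at `g = 1`. Multiplicativity of `permRep` follows without any
relations between generators. -/
theorem transportProd_mul_permRep (hf : IsLT f) {d : ℕ} (w : Equiv.Perm (Fin d)) :
    ∀ g : Equiv.Perm (Fin d), transportProd hf (permLabels (g * w)) d =
      transportProd hf (permLabels g) d * permRep hf d w := by
  induction w using perm_induction with
  | one => intro g; rw [mul_one, permRep_one, transportProd_mul_unit]
  | mul_swap w i h ih =>
    intro g
    rw [← mul_assoc, transportProd_mul_swap hf _ h, ih, permRep, permRep,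
      transportProd_mul_swap hf _ h]
    simp only [mul_assoc]

theorem permRep_mul (hf : IsLT f) {d : ℕ} (w w' : Equiv.Perm (Fin d)) :
    permRep hf d (w * w') = permRep hf d w * permRep hf d w' := by
  rw [permRep, transportProd_mul_permRep, ← mul_assoc]
  rfl

theorem permRep_swap (hf : IsLT f) {d i : ℕ} (h : i + 1 < d) :
    permRep hf d (Equiv.swap ⟨i, by omega⟩ ⟨i + 1, h⟩) = exchangeAt f d i := by
  rw [← one_mul (Equiv.swap _ _), permRep, transportProd_mul_swap hf _ h, ← mul_assoc,
    star_transportProd_mul, exchangeAt, ← mul_assoc,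
    ← npow_eps_comm hf (show i + 2 ≤ d by omega), mul_assoc, map_mul_one]

theorem permRep_mul_unit (hf : IsLT f) {d : ℕ} (w : Equiv.Perm (Fin d)) :
    permRep hf d w * npow f d 1 = permRep hf d w := by
  rw [← permRep_one hf, ← permRep_mul, mul_one]

theorem exchangeAt_intertwines (hf : IsLT f) {d i : ℕ} (h : i + 1 < d) :
    Intertwines (npow f d) (npow f d) (exchangeAt f d i) := by
  obtain ⟨k, rfl⟩ := Nat.exists_eq_add_of_le (show i + 2 ≤ d by omega)
  have h1 : Intertwines (npow f (i + 2)) (npow f (i + 2)) (npow f i (eps f f)) := by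
    have := (eps_intertwines hf hf).map (npow f i)
    exact this
  have h2 := h1.mul_unit (npow f k)
  rw [← npow_add] at h2
  rw [exchangeAt, npow_add_apply]
  exact h2

theorem star_exchangeAt (hf : IsLT f) {d i : ℕ} (h : i + 1 < d) :
    star (exchangeAt f d i) = exchangeAt f d i := by
  rw [exchangeAt, star_mul, star_map_one, ← map_star, star_eps hf hf,
    npow_eps_comm hf (show i + 2 ≤ d by omega)]

theorem permRep_intertwines (hf : IsLT f) {d : ℕ} (w : Equiv.Perm (Fin d)) :
    Intertwines (npow f d) (npow f d) (permRep hf d w) := by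
  induction w using perm_induction with
  | one => rw [permRep_one]; exact Intertwines.one _
  | mul_swap w i h ih =>
    rw [permRep_mul, permRep_swap hf h]
    exact ih.mul (exchangeAt_intertwines hf h)

theorem star_permRep (hf : IsLT f) {d : ℕ} (w : Equiv.Perm (Fin d)) :
    star (permRep hf d w) = permRep hf d w⁻¹ := by
  induction w using perm_induction with
  | one => rw [inv_one, permRep_one, star_map_one]
  | mul_swap w i h ih =>
    rw [permRep_mul, star_mul, ih, permRep_swap hf h, star_exchangeAt hf h, mul_inv_rev,
      permRep_mul, Equiv.swap_inv, permRep_swap hf h]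

/-- Applying `f` to an arrow tensors it with `1_f` on the left, which moves its action one place to
the right. -/
theorem permRep_shiftPerm (hf : IsLT f) {d : ℕ} (w : Equiv.Perm (Fin d)) :
    permRep hf (d + 1) (shiftPerm w) = f (permRep hf d w) := by
  induction w using perm_induction with
  | one => rw [shiftPerm_one, permRep_one, permRep_one, npow_succ_apply']
  | mul_swap w i h ih =>
    rw [shiftPerm_mul, permRep_mul, permRep_mul, map_mul, ih, shiftPerm_swap, permRep_swap hf h]
    congr 1
    refine (permRep_swap hf (d := d + 1) (i := i + 1) (by omega)).trans ?_
    rw [exchangeAt, exchangeAt, map_mul, npow_succ_apply', npow_succ_apply']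

/-! ### The (anti)symmetrizers -/

/-- The antisymmetrizer (`b = true`) or symmetrizer (`b = false`). -/
def altProj (hf : IsLT f) (b : Bool) (d : ℕ) : N.quasilocal :=
  ((d.factorial : ℂ)⁻¹) • ∑ w : Equiv.Perm (Fin d), permChar b w • permRep hf d w

theorem altProj_mul_permRep (hf : IsLT f) (b : Bool) {d : ℕ} (w : Equiv.Perm (Fin d)) :
    altProj hf b d * permRep hf d w = permChar b w • altProj hf b d := by
  rw [altProj, smul_mul_assoc, smul_comm]
  congr 1
  rw [Finset.sum_mul, Finset.smul_sum,
    ← Equiv.sum_comp (Equiv.mulRight w) fun v => permChar b w • permChar b v • permRep hf d v]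
  refine Finset.sum_congr rfl fun v _ => ?_
  rw [Equiv.coe_mulRight, map_mul, smul_smul, smul_mul_assoc, ← permRep_mul,
    mul_comm (permChar b v), ← mul_assoc, permChar_mul_self, one_mul]

theorem star_altProj (hf : IsLT f) (b : Bool) (d : ℕ) :
    star (altProj hf b d) = altProj hf b d := by
  rw [altProj, star_smul, star_sum]
  congr 1
  · simp
  · rw [← Equiv.sum_comp (Equiv.inv _)]
    refine Finset.sum_congr rfl fun v _ => ?_
    rw [star_smul, star_permRep, star_permChar, Equiv.inv_apply, permChar_inv, inv_inv]

theorem permRep_mul_altProj (hf : IsLT f) (b : Bool) {d : ℕ} (w : Equiv.Perm (Fin d)) :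
    permRep hf d w * altProj hf b d = permChar b w • altProj hf b d := by
  have := congrArg star (altProj_mul_permRep hf b w⁻¹)
  rwa [star_mul, star_permRep, inv_inv, star_altProj, star_smul, star_permChar, star_altProj,
    permChar_inv] at this

theorem altProj_mul_self (hf : IsLT f) (b : Bool) (d : ℕ) :
    altProj hf b d * altProj hf b d = altProj hf b d := by
  nth_rw 2 [altProj]
  rw [mul_smul_comm, Finset.mul_sum, Finset.sum_congr rfl (fun w _ => by
    rw [mul_smul_comm, altProj_mul_permRep, smul_smul, permChar_mul_self, one_smul]),
    Finset.sum_const, Finset.card_univ, Fintype.card_perm, Fintype.card_fin,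
    ← Nat.cast_smul_eq_nsmul ℂ,
    smul_smul, inv_mul_cancel₀ (by exact_mod_cast d.factorial_ne_zero), one_smul]

theorem altProj_intertwines (hf : IsLT f) (b : Bool) (d : ℕ) :
    Intertwines (npow f d) (npow f d) (altProj hf b d) :=
  (Intertwines.sum _ fun w _ => (permRep_intertwines hf w).smul _).smul _

theorem altProj_zero (hf : IsLT f) (b : Bool) : altProj hf b 0 = 1 := by
  simp [altProj, permRep_one, Subsingleton.elim (default : Equiv.Perm (Fin 0)) 1]

/-- The projection of `f ^ (d + 1)` absorbs the representation of the permutations of the first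
`d` factors. -/
theorem altProj_succ_mul_permRep (hf : IsLT f) (b : Bool) {d : ℕ} (w : Equiv.Perm (Fin d)) :
    altProj hf b (d + 1) * permRep hf d w = permChar b w • altProj hf b (d + 1) := by
  have hA : altProj hf b (d + 1) = altProj hf b (d + 1) * npow f (d + 1) 1 :=
    (altProj_intertwines hf b (d + 1)).right.symm
  induction w using perm_induction with
  | one => rw [permRep_one, map_one (permChar b), one_smul, hA, mul_assoc, unit_mul_npow (by omega)]
  | mul_swap w i h ih =>
    rw [permRep_mul, ← mul_assoc, ih, permRep_swap hf h, map_mul, smul_mul_assoc, ← smul_smul]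
    congr 1
    -- The exchanges on `d` and on `d + 1` factors differ only in `npow f d 1` and `npow f (d + 1)
    -- 1`, and the projection absorbs both.
    have h1 : altProj hf b (d + 1) * exchangeAt f d i =
        altProj hf b (d + 1) * exchangeAt f (d + 1) i := by
      nth_rw 1 [hA]
      rw [exchangeAt, exchangeAt, mul_assoc, ← mul_assoc (npow f (d + 1) 1),
        ← npow_eps_comm hf (show i + 2 ≤ d + 1 by omega), mul_assoc (npow f i _),
        unit_mul_npow (by omega)]
    rw [h1, ← permRep_swap hf (show i + 1 < d + 1 by omega), altProj_mul_permRep,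
      permChar_swap b (by simp [Fin.ext_iff]), permChar_swap b (by simp [Fin.ext_iff])]

theorem altProj_succ_mul_altProj (hf : IsLT f) (b : Bool) (d : ℕ) :
    altProj hf b (d + 1) * altProj hf b d = altProj hf b (d + 1) := by
  nth_rw 2 [altProj]
  rw [mul_smul_comm, Finset.mul_sum, Finset.sum_congr rfl (fun w _ => by
    rw [mul_smul_comm, altProj_succ_mul_permRep, smul_smul, permChar_mul_self, one_smul]),
    Finset.sum_const, Finset.card_univ, Fintype.card_perm, Fintype.card_fin,
    ← Nat.cast_smul_eq_nsmul ℂ,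
    smul_smul, inv_mul_cancel₀ (by exact_mod_cast d.factorial_ne_zero), one_smul]

theorem altProj_mul_altProj_succ (hf : IsLT f) (b : Bool) (d : ℕ) :
    altProj hf b d * altProj hf b (d + 1) = altProj hf b (d + 1) := by
  simpa [star_altProj] using congrArg star (altProj_succ_mul_altProj hf b d)

theorem map_altProj_mul_altProj_succ (hf : IsLT f) (b : Bool) (d : ℕ) :
    f (altProj hf b d) * altProj hf b (d + 1) = altProj hf b (d + 1) := by
  nth_rw 1 [altProj]
  rw [map_smul, smul_mul_assoc, map_sum, Finset.sum_mul, Finset.sum_congr rfl (fun w _ => by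
    rw [map_smul, ← permRep_shiftPerm, smul_mul_assoc, permRep_mul_altProj, permChar_shiftPerm,
      smul_smul, permChar_mul_self, one_smul]),
    Finset.sum_const, Finset.card_univ, Fintype.card_perm, Fintype.card_fin,
    ← Nat.cast_smul_eq_nsmul ℂ,
    smul_smul, inv_mul_cancel₀ (by exact_mod_cast d.factorial_ne_zero), one_smul]

/-- The sum over the permutations is organised by the cosets of the stabilizer of `0`; the
stabilizer itself contributes `f` of the projection on `d` factors. -/
theorem altProj_succ (hf : IsLT f) (b : Bool) (d : ℕ) :
    ((d + 1 : ℕ) : ℂ) • altProj hf b (d + 1) = f (altProj hf b d) +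
      ∑ j : Fin d,
        permSign b • (permRep hf (d + 1) (Equiv.swap 0 j.succ) * f (altProj hf b d)) := by
  have e1 : ∀ j : Fin (d + 1), permChar b (Equiv.swap 0 j) • (permRep hf (d + 1) (Equiv.swap 0 j) *
      f (altProj hf b d)) = ((d.factorial : ℂ)⁻¹) • ∑ w : Equiv.Perm (Fin d),
        permChar b (Equiv.swap 0 j * shiftPerm w) •
          permRep hf (d + 1) (Equiv.swap 0 j * shiftPerm w) := by
    intro j
    rw [altProj, map_smul, mul_smul_comm, smul_comm, map_sum, Finset.mul_sum, Finset.smul_sum]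
    congr 1
    refine Finset.sum_congr rfl fun w _ => ?_
    rw [map_mul, permChar_shiftPerm, permRep_mul, permRep_shiftPerm, map_smul, mul_smul_comm,
      smul_smul]
  have e2 : ((d + 1 : ℕ) : ℂ) • altProj hf b (d + 1) = ∑ j : Fin (d + 1),
      permChar b (Equiv.swap 0 j) • (permRep hf (d + 1) (Equiv.swap 0 j) *
      f (altProj hf b d)) := by
    rw [Finset.sum_congr rfl fun j _ => e1 j, ← Finset.smul_sum, altProj, smul_smul,
      ← Equiv.sum_comp Equiv.Perm.decomposeFin.symm, Fintype.sum_prod_type]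
    congr 1
    · rw [Nat.factorial_succ]
      have h1 : ((d + 1 : ℕ) : ℂ) ≠ 0 := by exact_mod_cast d.succ_ne_zero
      have h2 : (d.factorial : ℂ) ≠ 0 := by exact_mod_cast d.factorial_ne_zero
      push_cast at h1 ⊢
      field_simp
    · refine Finset.sum_congr rfl fun j _ => Finset.sum_congr rfl fun w _ => ?_
      rw [decomposeFin_symm_eq]
  rw [e2, Fin.sum_univ_succ]
  congr 1
  · rw [Equiv.swap_self, ← Equiv.Perm.one_def, map_one, one_smul, permRep_one, npow_succ_apply',
      ← map_mul, (altProj_intertwines hf b d).left]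
  · refine Finset.sum_congr rfl fun j _ => ?_
    rw [permChar_swap b (Fin.succ_ne_zero j).symm]

/-- Transpositions between absorbing projections. -/
theorem sandwich_swap (hf : IsLT f) (b : Bool) {d : ℕ} {q : N.quasilocal}
    (hq : ∀ w : Equiv.Perm (Fin d), q * f (permRep hf d w) = permChar b w • q)
    (hq' : ∀ w : Equiv.Perm (Fin d), f (permRep hf d w) * q = permChar b w • q) (j : Fin d) :
    q * permRep hf (d + 1) (Equiv.swap 0 j.succ) * q = q * eps f f * q := by
  obtain ⟨n, rfl⟩ : ∃ n, d = n + 1 := ⟨d - 1, by have := j.2; omega⟩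
  -- The transposition is conjugate to that of `0` and `1` by a permutation that fixes `0`. The
  -- conjugating factors are absorbed by `q`, and their characters multiply to `1`.
  have e1 : Equiv.swap (0 : Fin (n + 2)) j.succ =
      shiftPerm (Equiv.swap 0 j) * Equiv.swap 0 1 * shiftPerm (Equiv.swap 0 j) := by
    rw [shiftPerm_swap]
    have h : Equiv.swap (0 : Fin (n + 1)).succ j.succ * Equiv.swap 0 1 *
        (Equiv.swap (0 : Fin (n + 1)).succ j.succ)⁻¹ = Equiv.swap 0 j.succ := by
      rw [Equiv.mul_swap_eq_swap_mul, mul_assoc, mul_inv_cancel, mul_one,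
        Equiv.swap_apply_of_ne_of_ne (Fin.succ_ne_zero _).symm (Fin.succ_ne_zero _).symm,
        ← Fin.succ_zero_eq_one, Equiv.swap_apply_left]
    rw [Equiv.swap_inv] at h
    exact h.symm
  have e2 : permRep hf (n + 2) (Equiv.swap 0 1) = eps f f * npow f (n + 2) 1 :=
    permRep_swap hf (d := n + 2) (i := 0) (by omega)
  have e3 : npow f (n + 2) 1 * q = q := by
    have := hq' 1
    rwa [permRep_one, map_one (permChar b), one_smul, ← npow_succ_apply'] at this
  rw [e1, permRep_mul, permRep_mul, permRep_shiftPerm, e2]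
  calc q * (f (permRep hf (n + 1) (Equiv.swap 0 j)) * (eps f f * npow f (n + 2) 1) *
        f (permRep hf (n + 1) (Equiv.swap 0 j))) * q
      = (q * f (permRep hf (n + 1) (Equiv.swap 0 j))) * eps f f *
        (npow f (n + 2) 1 * (f (permRep hf (n + 1) (Equiv.swap 0 j)) * q)) := by
        simp only [mul_assoc]
    _ = _ := by
        rw [hq, hq', mul_smul_comm, e3, smul_mul_assoc, smul_mul_assoc, mul_smul_comm, smul_smul,
          permChar_mul_self, one_smul]

/-- Once `altProj_succ` is multiplied from the left by `f (altProj hf b d)`, all `d` transpositions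
contribute the same sandwich of the symmetry. -/
theorem altProj_succ_eq (hf : IsLT f) (b : Bool) (d : ℕ) :
    ((d + 1 : ℕ) : ℂ) • altProj hf b (d + 1) = f (altProj hf b d) +
      ((d : ℂ) * permSign b) • (f (altProj hf b d) * eps f f * f (altProj hf b d)) := by
  have h1 := congrArg (fun x => f (altProj hf b d) * x) (altProj_succ hf b d)
  simp only [mul_smul_comm, map_altProj_mul_altProj_succ, mul_add, ← map_mul, altProj_mul_self,
    Finset.mul_sum] at h1
  rw [h1]
  congr 1
  rw [Finset.sum_congr rfl fun j _ => by
    rw [← mul_assoc, sandwich_swap hf b (fun w => by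
      rw [← map_mul, altProj_mul_permRep, map_smul]) (fun w => by
      rw [← map_mul, permRep_mul_altProj, map_smul]) j]]
  rw [Finset.sum_const, Finset.card_univ, Fintype.card_fin, ← Nat.cast_smul_eq_nsmul ℂ, smul_smul]

/-- Among `d + 2` factors, the projection on the first `d + 1` is compressed by the one on the last
`d + 1`. Together with `altProj_succ_eq` this gives two linear relations between the same two
elements, as used in `map_altProj_eq_zero`. -/
theorem sandwich_altProj (hf : IsLT f) (b : Bool) (d : ℕ) :
    ((d + 1 : ℕ) : ℂ) • (f (altProj hf b (d + 1)) * altProj hf b (d + 1) *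
      f (altProj hf b (d + 1))) = f (altProj hf b (d + 1)) +
      ((d : ℂ) * permSign b) • (f (altProj hf b (d + 1)) * eps f f *
        f (altProj hf b (d + 1))) := by
  obtain ⟨q, hq⟩ : ∃ q, q = f (altProj hf b (d + 1)) := ⟨_, rfl⟩
  have hqq : q * q = q := by rw [hq, ← map_mul, altProj_mul_self]
  have hq1 : f (altProj hf b d) * q = q := by rw [hq, ← map_mul, altProj_mul_altProj_succ]
  rw [← hq]
  have h1 := congrArg (fun x => q * x * q) (altProj_succ hf b d)
  simp only [mul_smul_comm, smul_mul_assoc, mul_add, add_mul, Finset.mul_sum, Finset.sum_mul] at h1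
  rw [h1, mul_assoc, hq1, hqq]
  congr 1
  rw [Finset.sum_congr rfl fun j _ => by
    rw [mul_assoc, mul_assoc, hq1, ← mul_assoc, sandwich_swap hf b (fun w => by
      rw [hq, ← map_mul, altProj_succ_mul_permRep, map_smul]) (fun w => by
      have := congrArg star (altProj_succ_mul_permRep hf b w⁻¹)
      rw [star_mul, star_permRep, inv_inv, star_altProj, star_smul, star_permChar, star_altProj,
        permChar_inv] at this
      rw [hq, ← map_mul, this, map_smul]) j]]
  rw [Finset.sum_const, Finset.card_univ, Fintype.card_fin, ← Nat.cast_smul_eq_nsmul ℂ, smul_smul]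

end NetEndo

end PermRep

/-! ### Two facts on C*-algebras -/

section CStar

variable {A : Type*} [CStarAlgebra A]

theorem isUnit_one_add_mul_star (w : A) : IsUnit (1 + w * star w) := by
  let _ := CStarAlgebra.spectralOrder A
  let _ := CStarAlgebra.spectralOrderedRing A
  exact CStarAlgebra.isUnit_of_le 1 (le_add_of_nonneg_right (mul_star_self_nonneg w))

/-- The range projection of an idempotent. -/
theorem exists_range_projection {e : A} (he : e * e = e) : ∃ p : A, star p = p ∧ p * p = p ∧
    p * e = e ∧ e * p = p ∧ ∀ b, Commute b e → Commute b (star e) → Commute b p := by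
  -- The range projection is `e e⁺ z⁻¹`. Since `z` is invertible and commutes with `e` and `e⁺`,
  -- this formula is algebraic, and the projection commutes with everything that commutes with both.
  obtain ⟨z, hz⟩ : ∃ z, z = 1 + (e - star e) * star (e - star e) := ⟨_, rfl⟩
  have hse : star e * star e = star e := by rw [← star_mul, he]
  have hzz : z = 1 + e * star e - e - star e + star e * e := by
    rw [hz, star_sub, star_star, sub_mul, mul_sub, mul_sub, he, hse]; abel
  have hze : z * e = e * star e * e := by
    rw [hzz]; simp only [add_mul, sub_mul, one_mul, mul_assoc, he]; abel
  have hez : e * z = e * star e * e := by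
    rw [hzz]; simp only [mul_add, mul_sub, mul_one, ← mul_assoc, he]; abel
  have hzs : star z = z := by rw [hz]; simp
  have hce : Commute e z := hez.trans hze.symm
  have hcs : Commute (star e) z := by
    have := congrArg star hce.eq
    rw [star_mul, star_mul, hzs] at this
    exact this.symm
  obtain ⟨u, hu⟩ : IsUnit z := hz ▸ isUnit_one_add_mul_star _
  have hu1 : (↑u⁻¹ : A) * z = 1 := by rw [← hu, Units.inv_mul]
  have hcomm : ∀ b, Commute b z → Commute b (↑u⁻¹ : A) := fun b hb =>
    Commute.units_inv_right (by rwa [hu])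
  have hsu : star (↑u⁻¹ : A) = ↑u⁻¹ := by
    have h1 := congrArg star hu1
    rw [star_mul, hzs, star_one, ← hu] at h1
    exact (Units.inv_eq_of_mul_eq_one_right h1).symm
  have h1 := hcomm _ hce
  have h2 := hcomm _ hcs
  have hpe : e * star e * ↑u⁻¹ * e = e := by
    rw [mul_assoc, ← h1.eq, ← mul_assoc, ← hez, mul_assoc, ← (hcomm z (Commute.refl z)).eq.symm,
      hu1, mul_one]
  refine ⟨e * star e * ↑u⁻¹, ?_, ?_, hpe, ?_, fun b hb hbs => ?_⟩
  · rw [star_mul, star_mul, star_star, hsu]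
    exact ((h1.mul_left h2).eq).symm
  · rw [← mul_assoc, ← mul_assoc, hpe]
  · rw [← mul_assoc, ← mul_assoc, he]
  · refine (hb.mul_right hbs).mul_right (hcomm _ ?_)
    rw [hzz]
    exact ((((Commute.one_right b).add_right (hb.mul_right hbs)).sub_right hb).sub_right
      hbs).add_right (hbs.mul_right hb)

/-- A self-adjoint element which is not a multiple of a projection has two nonzero orthogonal
multiples in the commutative algebra which it generates. -/
theorem exists_orthogonal_of_isSelfAdjoint {y : A} (hy : IsSelfAdjoint y)
    (hne : ∀ c : ℝ, y * y ≠ c • y) : ∃ p q : A, star p = p ∧ star q = q ∧ y * p ≠ 0 ∧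
      y * q ≠ 0 ∧ p * q = 0 ∧ ∀ b, Commute b y → Commute b p ∧ Commute b q := by
  -- If the spectrum had at most one nonzero point `c`, then `x² = c x` would hold on it, against
  -- `hne`. Around two distinct nonzero points, bumps with half their distance as radius have
  -- product zero.
  have key : ∃ s t : ℝ, s ∈ spectrum ℝ y ∧ t ∈ spectrum ℝ y ∧ s ≠ 0 ∧ t ≠ 0 ∧ s ≠ t := by
    by_contra! h
    have h' : ∃ c : ℝ, ∀ x ∈ spectrum ℝ y, x ≠ 0 → x = c := by
      by_cases h0 : ∃ c ∈ spectrum ℝ y, c ≠ 0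
      · obtain ⟨c, hc, hc0⟩ := h0
        exact ⟨c, fun x hx hx0 => h x c hx hc hx0 hc0⟩
      · push Not at h0
        exact ⟨0, fun x hx hx0 => (hx0 (h0 x hx)).elim⟩
    obtain ⟨c, hc⟩ := h'
    apply hne c
    have e1 : y * y = cfc (fun x : ℝ => x * x) y := by
      rw [cfc_mul (fun x : ℝ => x) (fun x : ℝ => x) y, cfc_id' ℝ y]
    have e2 : c • y = cfc (fun x : ℝ => c * x) y := by
      rw [cfc_const_mul c (fun x : ℝ => x) y, cfc_id' ℝ y]
    rw [e1, e2]
    refine cfc_congr fun x hx => ?_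
    by_cases hx0 : x = 0
    · simp [hx0]
    · simp [hc x hx hx0]
  obtain ⟨s, t, hs, ht, hs0, ht0, hst⟩ := key
  have hδ : 0 < |s - t| / 2 := by have := abs_pos.2 (sub_ne_zero.2 hst); positivity
  let p : ℝ → ℝ := fun x => max 0 (|s - t| / 2 - |x - s|)
  let q : ℝ → ℝ := fun x => max 0 (|s - t| / 2 - |x - t|)
  have hp : Continuous p := by fun_prop
  have hq : Continuous q := by fun_prop
  have hpq : ∀ x, p x * q x = 0 := by
    intro x
    have : |s - t| ≤ |x - s| + |x - t| := by
      have := abs_sub_le s x t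
      rwa [abs_sub_comm s x] at this
    simp only [p, q]
    rcases le_total (|s - t| / 2) |x - s| with h | h
    · rw [max_eq_left (by linarith), zero_mul]
    · rw [max_eq_left (b := |s - t| / 2 - |x - t|) (by linarith), mul_zero]
  have hnz : ∀ (f : ℝ → ℝ), Continuous f → ∀ x ∈ spectrum ℝ y, x * f x ≠ 0 → y * cfc f y ≠ 0 := by
    intro f hf x hx hx0 h0
    have e1 : y * cfc f y = cfc (fun x : ℝ => x * f x) y := by
      rw [cfc_mul (fun x : ℝ => x) f y, cfc_id' ℝ y]
    have e2 : cfc (fun x : ℝ => x * f x) y = cfc (fun _ : ℝ => (0 : ℝ)) y := by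
      rw [← e1, h0, cfc_const_zero]
    exact hx0 ((cfc_eq_cfc_iff_eqOn (R := ℝ)).1 e2 hx)
  refine ⟨cfc p y, cfc q y, cfc_predicate p y, cfc_predicate q y, hnz p hp s hs ?_,
    hnz q hq t ht ?_, ?_, fun b hb => ⟨(hb.symm.cfc_real p).symm, (hb.symm.cfc_real q).symm⟩⟩
  · simp only [p, sub_self, abs_zero, sub_zero, max_eq_right hδ.le]
    exact mul_ne_zero hs0 hδ.ne'
  · simp only [q, sub_self, abs_zero, sub_zero, max_eq_right hδ.le]
    exact mul_ne_zero ht0 hδ.ne'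
  · rw [← cfc_mul p q y, cfc_congr (g := fun _ => (0 : ℝ)) fun x _ => hpq x, cfc_const_zero]

end CStar

/-! ### Half conjugates -/

section HalfConjugates

variable {N : ObservableNet H}

theorem norm_sq_of_adjoint_mul_self {x p : H →L[ℂ] H} {c : ℝ} 
    (h : star x * x = (c : ℂ) • p) {η : H} (h2 : p η = η) : c * ‖η‖ ^ 2 = ‖x η‖ ^ 2 := by
  have h3 : inner ℂ η ((star x * x) η) = inner ℂ (x η) (x η) :=
    ContinuousLinearMap.adjoint_inner_right x η (x η)
  rw [h, smul_apply, h2, inner_smul_right, inner_self_eq_norm_sq_to_K,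
    inner_self_eq_norm_sq_to_K] at h3
  apply Complex.ofReal_injective
  push_cast
  exact h3

theorem nonneg_of_adjoint_mul_self {x p : H →L[ℂ] H} {c : ℝ} (hp : p * p = p) (hp0 : p ≠ 0)
    (h : star x * x = (c : ℂ) • p) : 0 ≤ c := by
  obtain ⟨ξ, hξ⟩ : ∃ ξ : H, p ξ ≠ 0 := by
    by_contra! h0
    exact hp0 (ContinuousLinearMap.ext h0)
  have h4 := norm_sq_of_adjoint_mul_self h
    (show p (p ξ) = p ξ from congrArg (fun a : H →L[ℂ] H => a ξ) hp)
  have h5 : 0 < ‖p ξ‖ ^ 2 := pow_pos (norm_pos_iff.2 hξ) 2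
  refine nonneg_of_mul_nonneg_left ?_ h5
  rw [h4]
  positivity

namespace ObservableNet

theorem exists_scalar_of_commute {x : N.quasilocal} (h : ∀ a, x * a = a * x) :
    ∃ c : ℂ, x = c • 1 := by
  obtain ⟨c, hc⟩ := N.irreducible x fun A hA => (congrArg Subtype.val (h ⟨A, hA⟩)).symm
  exact ⟨c, Subtype.ext hc⟩

theorem norm_smul_one [Nontrivial H] (c : ℂ) : ‖(c • 1 : N.quasilocal)‖ = ‖c‖ := by
  rw [norm_smul]
  have : ‖(1 : N.quasilocal)‖ = ‖(1 : H →L[ℂ] H)‖ := rfl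
  rw [this, norm_one, mul_one]

theorem smul_one_injective [Nontrivial H] {c d : ℂ} (h : (c • 1 : N.quasilocal) = d • 1) :
    c = d := by
  rw [← sub_eq_zero, ← norm_eq_zero, ← norm_smul_one (N := N), sub_smul, h, sub_self, norm_zero]

theorem nonneg_of_star_mul_self {x p : N.quasilocal} {c : ℝ} (hp : p * p = p) (hp0 : p ≠ 0)
    (h : star x * x = (c : ℂ) • p) : 0 ≤ c :=
  nonneg_of_adjoint_mul_self (congrArg Subtype.val hp) (fun h0 => hp0 (Subtype.ext h0))
    (congrArg Subtype.val h)

end ObservableNet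

namespace NetEndo

/-- `g` is a conjugate of `f` up to one of the two conjugate equations. -/
structure HalfConj (f g : NetEndo N) (r r' : N.quasilocal) : Prop where
  lt : IsLT g
  arrow : Intertwines (NonUnitalStarAlgHom.id ℂ N.quasilocal) (g.comp f) r
  arrow' : Intertwines (NonUnitalStarAlgHom.id ℂ N.quasilocal) (f.comp g) r'
  zigzag : star r' * f r = f 1

variable {f g f₂ g₂ : NetEndo N} {r r' r₂ r₂' : N.quasilocal}

theorem halfConj_id : HalfConj (NonUnitalStarAlgHom.id ℂ N.quasilocal)
    (NonUnitalStarAlgHom.id ℂ N.quasilocal) 1 1 :=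
  ⟨isLT_id, Intertwines.one _, Intertwines.one _, by simp⟩

namespace HalfConj

/-- One arrow is inserted between the legs of the other, so the conjugates compose in the opposite
order. -/
theorem comp (h : HalfConj f g r r') (h₂ : HalfConj f₂ g₂ r₂ r₂') :
    HalfConj (f.comp f₂) (g₂.comp g) (g₂ r * r₂) (f r₂' * r') := by
  refine ⟨h₂.lt.comp h.lt, ?_, ?_, ?_⟩
  · refine ⟨mul_one _, ?_, fun a => ?_⟩
    · change g₂ (g (f (f₂ 1))) * (g₂ r * r₂) = g₂ r * r₂
      rw [← mul_assoc, ← map_mul, show g (f (f₂ 1)) * r = r * f₂ 1 from (h.arrow.comm _).symm,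
        map_mul, mul_assoc, show g₂ (f₂ 1) * r₂ = r₂ from h₂.arrow.left]
    · change g₂ r * r₂ * a = g₂ (g (f (f₂ a))) * (g₂ r * r₂)
      rw [mul_assoc, ← mul_assoc (g₂ (g (f (f₂ a)))), ← map_mul,
        show g (f (f₂ a)) * r = r * f₂ a from (h.arrow.comm _).symm, map_mul, mul_assoc,
        show r₂ * a = g₂ (f₂ a) * r₂ from h₂.arrow.comm a]
  · refine ⟨mul_one _, ?_, fun a => ?_⟩
    · change f (f₂ (g₂ (g 1))) * (f r₂' * r') = f r₂' * r'
      rw [← mul_assoc, ← map_mul, show f₂ (g₂ (g 1)) * r₂' = r₂' * g 1 from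
        (h₂.arrow'.comm _).symm, map_mul, mul_assoc,
        show f (g 1) * r' = r' from h.arrow'.left]
    · change f r₂' * r' * a = f (f₂ (g₂ (g a))) * (f r₂' * r')
      rw [mul_assoc, ← mul_assoc (f (f₂ (g₂ (g a)))), ← map_mul,
        show f₂ (g₂ (g a)) * r₂' = r₂' * g a from (h₂.arrow'.comm _).symm, map_mul, mul_assoc,
        show r' * a = f (g a) * r' from h.arrow'.comm a]
  · change star (f r₂' * r') * f (f₂ (g₂ r * r₂)) = f (f₂ 1)
    rw [star_mul, ← map_star, mul_assoc, ← map_mul, map_mul f₂, ← mul_assoc (star r₂'),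
      show star r₂' * f₂ (g₂ r) = r * star r₂' from h₂.arrow'.star.comm r, mul_assoc,
      h₂.zigzag, map_mul, ← mul_assoc, h.zigzag, map_one_mul]

theorem star_arrow_comm (h : HalfConj f g r r') (a : N.quasilocal) :
    star r * g (f a) = a * star r := h.arrow.star.comm a

theorem arrow_comm (h : HalfConj f g r r') (a : N.quasilocal) : g (f a) * r = r * a :=
  (h.arrow.comm a).symm

theorem star_arrow'_comm (h : HalfConj f g r r') (a : N.quasilocal) :
    star r' * f (g a) = a * star r' := h.arrow'.star.comm a

theorem arrow'_comm (h : HalfConj f g r r') (a : N.quasilocal) : f (g a) * r' = r' * a :=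
  (h.arrow'.comm a).symm

theorem zigzag_star (h : HalfConj f g r r') : f (star r) * r' = f 1 := by
  have := congrArg star h.zigzag
  rwa [star_mul, star_star, ← map_star, star_map_one] at this

/-- A half conjugate has a subobject which is a conjugate. -/
theorem exists_conjugate (h : HalfConj f g r r') :
    ∃ g₁ r₁ r₁', HalfConj f g₁ r₁ r₁' ∧ star r₁ * g₁ r₁' = g₁ 1 := by
  -- This is the left side of the missing conjugate equation. The given one makes it an idempotent
  -- of `(g, g)`; it need not be self-adjoint, hence the range projection.
  obtain ⟨e, he⟩ : ∃ e, e = star r * g r' := ⟨_, rfl⟩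
  have hei : e * e = e := by
    rw [he]
    calc star r * g r' * (star r * g r') = star r * (g r' * star r) * g r' := by
          simp only [mul_assoc]
      _ = star r * g (f (star r)) * (g (f (g r')) * g r') := by
          rw [← h.star_arrow_comm, h.star_arrow_comm (star r)]; simp only [mul_assoc]
      _ = star r * g (f (star r) * r') * g r' := by
          rw [← map_mul g, h.arrow'_comm, map_mul, map_mul]; simp only [mul_assoc]
      _ = star r * g r' := by
          rw [h.zigzag_star, show star r * g (f 1) = star r by rw [h.star_arrow_comm, one_mul]]
  have hea : Intertwines g g e := by
    refine ⟨?_, ?_, fun a => ?_⟩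
    · rw [he, mul_assoc, ← map_mul, mul_one]
    · rw [he, ← mul_assoc, ← h.star_arrow_comm, mul_assoc, ← map_mul, h.arrow'_comm, mul_one]
    · rw [he, mul_assoc, ← map_mul, ← h.arrow'_comm, map_mul, ← mul_assoc, h.star_arrow_comm,
        mul_assoc]
  obtain ⟨p, hps, hpp, hpe, hep, hpc⟩ := exists_range_projection hei
  have hpa : Intertwines g g p := by
    have hc : ∀ a, p * g a = g a * p := fun a =>
      (hpc (g a) (hea.comm a).symm (hea.star.comm a).symm).symm
    have h1 : g 1 * p = p := by rw [← hep, ← mul_assoc, hea.left]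
    exact ⟨by rw [hc, h1], h1, hc⟩
  -- `r'` does not see the idempotent, nor therefore its range projection `p`. Cutting `g` down to
  -- `p` thus keeps the given equation and turns the other one into `e * p = p`.
  have hfe : f e * r' = r' := by
    rw [he, map_mul, mul_assoc, h.arrow'_comm, ← mul_assoc, h.zigzag_star, ← h.arrow'.left,
      NonUnitalStarAlgHom.comp_apply, map_one_mul_assoc]
  have hfp : f p * r' = r' := by rw [← hfe, ← mul_assoc, ← map_mul, hpe]
  refine ⟨subEndo g p hpa hps hpp, p * r, r', ⟨h.lt.sub, ⟨mul_one _, ?_, fun a => ?_⟩,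
    ⟨mul_one _, ?_, fun a => ?_⟩, ?_⟩, ?_⟩
  · change p * g (f 1) * (p * r) = p * r
    rw [mul_assoc, ← mul_assoc (g (f 1)), ← hpa.comm, mul_assoc, h.arrow_comm, mul_one,
      ← mul_assoc, hpp]
  · change p * r * a = p * g (f a) * (p * r)
    rw [mul_assoc p (g (f a)), ← mul_assoc (g (f a)), ← hpa.comm, mul_assoc p (g (f a)),
      h.arrow_comm, ← mul_assoc p p, hpp, mul_assoc]
  · change f (p * g 1) * r' = r'
    rw [hpa.right, hfp]
  · change r' * a = f (p * g a) * r'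
    rw [map_mul, mul_assoc, h.arrow'_comm, ← mul_assoc, hfp]
  · rw [map_mul, ← mul_assoc, ← star_star (f p), ← star_mul, ← map_star, hps, hfp, h.zigzag]
  · rw [star_mul, hps, subEndo_apply, subEndo_apply, hpa.right, mul_assoc, ← mul_assoc p, hpp,
      hpa.comm, ← mul_assoc, ← he, hep]

end HalfConj

/-- The left inverse attached to a half conjugate. -/
def leftInv (g : NetEndo N) (r : N.quasilocal) : N.quasilocal →ₗ[ℂ] N.quasilocal where
  toFun x := star r * g x * r
  map_add' x y := by simp only [map_add, mul_add, add_mul]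
  map_smul' c x := by simp

theorem leftInv_apply (g : NetEndo N) (r x : N.quasilocal) : leftInv g r x = star r * g x * r := rfl

theorem leftInv_comp (x : N.quasilocal) :
    leftInv (g₂.comp g) (g₂ r * r₂) x = leftInv g₂ r₂ (leftInv g r x) := by
  simp only [leftInv_apply, star_mul, NonUnitalStarAlgHom.comp_apply, map_mul, map_star, mul_assoc]

theorem star_leftInv (x : N.quasilocal) : star (leftInv g r x) = leftInv g r (star x) := by
  simp only [leftInv_apply, star_mul, star_star, map_star, mul_assoc]

namespace HalfConj

theorem leftInv_mul_mul (h : HalfConj f g r r') (a x b : N.quasilocal) :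
    leftInv g r (f a * x * f b) = a * leftInv g r x * b := by
  simp only [leftInv_apply, map_mul]
  rw [mul_assoc, mul_assoc, h.arrow_comm, ← mul_assoc, ← mul_assoc, ← mul_assoc,
    h.star_arrow_comm]
  simp only [mul_assoc]

theorem leftInv_mul (h : HalfConj f g r r') (a x : N.quasilocal) :
    leftInv g r (f a * x) = a * leftInv g r x := by
  simp only [leftInv_apply, map_mul]
  rw [← mul_assoc, h.star_arrow_comm]
  simp only [mul_assoc]

theorem leftInv_mul_right (h : HalfConj f g r r') (x b : N.quasilocal) :
    leftInv g r (x * f b) = leftInv g r x * b := by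
  simp only [leftInv_apply, map_mul]
  rw [mul_assoc, mul_assoc, h.arrow_comm]
  simp only [mul_assoc]

theorem leftInv_map (h : HalfConj f g r r') (a : N.quasilocal) :
    leftInv g r (f a) = a * (star r * r) := by
  rw [leftInv_apply, h.star_arrow_comm, mul_assoc]

/-- The conjugate equation recovers `x * f 1` from `g x * r`. Both the norm bound and the
faithfulness of the left inverse come from this. -/
theorem mul_map_one (h : HalfConj f g r r') (x : N.quasilocal) :
    x * f 1 = star r' * f (g x * r) := by
  rw [← h.zigzag, ← mul_assoc, ← h.star_arrow'_comm, map_mul, mul_assoc]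

theorem norm_le (h : HalfConj f g r r') {x : N.quasilocal} (hx : x * f 1 = x) :
    ‖x‖ ≤ ‖r'‖ * ‖g x * r‖ := by
  nth_rw 1 [← hx]
  rw [h.mul_map_one]
  calc _ ≤ ‖star r'‖ * ‖f (g x * r)‖ := norm_mul_le _ _
    _ ≤ _ := by
      rw [norm_star]
      gcongr
      exact NonUnitalStarAlgHom.norm_apply_le f _

theorem leftInv_star_mul_self (x : N.quasilocal) :
    leftInv g r (star x * x) = star (g x * r) * (g x * r) := by
  simp only [leftInv_apply, star_mul, map_mul, map_star, mul_assoc]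

theorem eq_zero_of_leftInv (h : HalfConj f g r r') {x : N.quasilocal} (hx : x * f 1 = x)
    (h0 : leftInv g r (star x * x) = 0) : x = 0 := by
  rw [leftInv_star_mul_self, CStarRing.star_mul_self_eq_zero_iff] at h0
  have := h.norm_le hx
  rw [h0, norm_zero, mul_zero] at this
  exact norm_le_zero_iff.1 this

theorem exists_leftInv_eq_smul (h : HalfConj f g r r') {x : N.quasilocal}
    (hx : ∀ a, x * f a = f a * x) : ∃ c : ℂ, leftInv g r x = c • 1 :=
  ObservableNet.exists_scalar_of_commute fun a => by
    rw [← h.leftInv_mul_right, hx, h.leftInv_mul]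

/-- `r⁺ r` is an arrow of `ι`, hence a scalar since the net is irreducible. It cannot vanish, as `r
= 0` would give `f 1 = 0` in the conjugate equation. -/
theorem exists_dimension [Nontrivial H] (h : HalfConj f g r r') (h1 : f 1 ≠ 0) :
    ∃ κ : ℝ, 0 < κ ∧ star r * r = (κ : ℂ) • 1 := by
  obtain ⟨c, hc⟩ := ObservableNet.exists_scalar_of_commute (x := star r * r) fun a => by
    rw [← h.leftInv_map, leftInv_apply, mul_assoc (star r) (g _), h.arrow_comm, mul_assoc]
  have hreal : (c.re : ℂ) = c := by
    rw [← Complex.conj_eq_iff_re]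
    refine ObservableNet.smul_one_injective (N := N) ?_
    rw [← hc]
    have := congrArg star hc
    rw [star_mul, star_star, star_smul, star_one] at this
    exact this.symm
  have h2 : (1 : N.quasilocal) ≠ 0 := fun h0 => h1 (by rw [h0, map_zero])
  refine ⟨c.re, lt_of_le_of_ne (ObservableNet.nonneg_of_star_mul_self (mul_one _) h2
    (by rw [hreal]; exact hc)) fun h0 => h1 ?_, by rw [hreal]; exact hc⟩
  rw [← h0] at hreal
  rw [← hreal, Complex.ofReal_zero, zero_smul, CStarRing.star_mul_self_eq_zero_iff] at hc
  rw [← h.zigzag, hc, map_zero, mul_zero]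

/-- The half conjugate of a subobject. -/
theorem sub (h : HalfConj f g r r') {e : N.quasilocal} (he : Intertwines f f e) (hs : star e = e)
    (hi : e * e = e) : HalfConj (subEndo f e he hs hi) g (g e * r) (e * r') := by
  refine ⟨h.lt, ⟨mul_one _, ?_, fun a => ?_⟩, ⟨mul_one _, ?_, fun a => ?_⟩, ?_⟩
  · change g (e * f 1) * (g e * r) = g e * r
    rw [he.right, ← mul_assoc, ← map_mul, hi]
  · change g e * r * a = g (e * f a) * (g e * r)
    rw [← mul_assoc (g (e * f a)), ← map_mul, mul_assoc e, ← he.comm, ← mul_assoc e e, hi, map_mul,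
      mul_assoc, mul_assoc, h.arrow_comm]
  · change e * f (g 1) * (e * r') = e * r'
    rw [mul_assoc, ← mul_assoc (f (g 1)), ← he.comm, mul_assoc, h.arrow'_comm, mul_one,
      ← mul_assoc, hi]
  · change e * r' * a = e * f (g a) * (e * r')
    rw [mul_assoc e, mul_assoc e, ← mul_assoc (f (g a)), ← he.comm, mul_assoc, ← h.arrow'_comm,
      ← mul_assoc e e, hi]
  · rw [subEndo_one, subEndo_apply, star_mul, hs, mul_assoc, ← mul_assoc e e, hi, he.comm, map_mul,
      ← mul_assoc, ← mul_assoc, h.star_arrow'_comm, mul_assoc e, h.zigzag, mul_assoc, he.left, hi]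

/-! ### Complete reducibility -/

/-- The elements `w i`, normalised by `star r * w i = 1`, have orthogonal ranges and norms at most
`‖r'‖`. Hence `k = ‖star r * ∑ w i‖ ≤ ‖r‖ * √k * ‖r'‖`. -/
theorem card_le [Nontrivial H] (h : HalfConj f g r r') {k : ℕ} {y : Fin k → N.quasilocal}
    (hy : ∀ i, Intertwines f f (y i)) (hs : ∀ i, star (y i) = y i) (h0 : ∀ i, y i ≠ 0)
    (hort : ∀ i j, i ≠ j → y i * y j = 0) : (k : ℝ) ≤ ‖r‖ ^ 2 * ‖r'‖ ^ 2 := by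
  have h1 : ∀ i, ∃ c : ℂ, leftInv g r (star (y i) * y i) = c • 1 := fun i =>
    h.exists_leftInv_eq_smul fun a => ((hy i).star.mul (hy i)).comm a
  choose c hc using h1
  have hcn : ∀ i, ‖c i‖ = ‖g (y i) * r‖ ^ 2 := fun i => by
    rw [← ObservableNet.norm_smul_one (N := N), ← hc, leftInv_star_mul_self,
      CStarRing.norm_star_mul_self, sq]
  have hyn : ∀ i, ‖y i‖ ^ 2 ≤ ‖r'‖ ^ 2 * ‖c i‖ := fun i => by
    rw [hcn, ← mul_pow]
    exact pow_le_pow_left₀ (norm_nonneg _) (h.norm_le (hy i).right) 2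
  have hcpos : ∀ i, 0 < ‖c i‖ := fun i => by
    rcases (norm_nonneg (c i)).eq_or_lt with h' | h'
    · have := hyn i
      rw [← h', mul_zero] at this
      have h2 := norm_pos_iff.2 (h0 i)
      nlinarith [pow_pos h2 2]
    · exact h'
  have hcne : ∀ i, c i ≠ 0 := fun i => norm_pos_iff.1 (hcpos i)
  let w : Fin k → N.quasilocal := fun i => (c i)⁻¹ • (g (star (y i) * y i) * r)
  have hw1 : star r * ∑ i, w i = (k : ℂ) • 1 := by
    rw [Finset.mul_sum]
    have : ∀ i, star r * w i = 1 := fun i => by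
      have := hc i
      rw [leftInv_apply, mul_assoc] at this
      simp only [w]
      rw [mul_smul_comm, this, smul_smul, inv_mul_cancel₀ (hcne i), one_smul]
    simp only [this, Finset.sum_const, Finset.card_univ, Fintype.card_fin]
    rw [Nat.cast_smul_eq_nsmul]
  have hwn : ∀ i, ‖w i‖ ^ 2 ≤ ‖r'‖ ^ 2 := fun i => by
    have h2 : ‖w i‖ ≤ ‖c i‖⁻¹ * (‖y i‖ * ‖g (y i) * r‖) := by
      simp only [w]
      rw [norm_smul, norm_inv, map_mul, mul_assoc]
      gcongr
      refine (norm_mul_le _ _).trans ?_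
      gcongr
      exact (NonUnitalStarAlgHom.norm_apply_le g _).trans (norm_star _).le
    have h3 : ‖w i‖ ^ 2 ≤ (‖c i‖⁻¹ * (‖y i‖ * ‖g (y i) * r‖)) ^ 2 :=
      pow_le_pow_left₀ (norm_nonneg _) h2 2
    refine h3.trans ?_
    rw [mul_pow, mul_pow, ← hcn]
    have h4 : ‖c i‖⁻¹ ^ 2 * (‖y i‖ ^ 2 * ‖c i‖) = ‖y i‖ ^ 2 * ‖c i‖⁻¹ := by
      have := (hcpos i).ne'
      field_simp
    rw [h4]
    calc _ ≤ ‖r'‖ ^ 2 * ‖c i‖ * ‖c i‖⁻¹ := by gcongr; exact hyn i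
      _ = _ := by rw [mul_assoc, mul_inv_cancel₀ (hcpos i).ne', mul_one]
  have hwo : ∀ i j, i ≠ j → star (w i) * w j = 0 := fun i j hij => by
    simp only [w, star_smul, smul_mul_assoc, mul_smul_comm, star_mul, hs, ← map_star]
    rw [mul_assoc (star r), ← mul_assoc (g _) (g _) r, ← map_mul, mul_assoc (y i),
      ← mul_assoc (y i) (y j), hort i j hij, zero_mul, mul_zero, map_zero, zero_mul, mul_zero,
      smul_zero, smul_zero]
  have hwsum : ‖∑ i, w i‖ ^ 2 ≤ k * ‖r'‖ ^ 2 := by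
    rw [sq, ← CStarRing.norm_star_mul_self, star_sum, Finset.sum_mul]
    have : ∀ i, star (w i) * ∑ j, w j = star (w i) * w i := fun i => by
      rw [Finset.mul_sum, Finset.sum_eq_single i (fun j _ hj => hwo i j hj.symm) (by simp)]
    simp only [this]
    refine (norm_sum_le _ _).trans ?_
    calc _ ≤ ∑ _i : Fin k, ‖r'‖ ^ 2 := by
          refine Finset.sum_le_sum fun i _ => ?_
          rw [CStarRing.norm_star_mul_self, ← sq]
          exact hwn i
      _ = _ := by simp
  have hk : (k : ℝ) ≤ ‖r‖ * ‖∑ i, w i‖ := by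
    have := norm_mul_le (star r) (∑ i, w i)
    rwa [hw1, ObservableNet.norm_smul_one, norm_star, Complex.norm_natCast] at this
  rcases (Nat.cast_nonneg (α := ℝ) k).eq_or_lt with h' | h'
  · rw [← h']; positivity
  · have h5 : (k : ℝ) ^ 2 ≤ ‖r‖ ^ 2 * (k * ‖r'‖ ^ 2) := by
      calc (k : ℝ) ^ 2 ≤ (‖r‖ * ‖∑ i, w i‖) ^ 2 := pow_le_pow_left₀ h'.le hk 2
        _ = ‖r‖ ^ 2 * ‖∑ i, w i‖ ^ 2 := mul_pow _ _ _
        _ ≤ _ := by gcongr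
    have h6 : (k : ℝ) * k ≤ k * (‖r‖ ^ 2 * ‖r'‖ ^ 2) := by nlinarith
    exact le_of_mul_le_mul_left h6 h'

end HalfConj
end NetEndo
end HalfConjugates

/-! ### Maximal orthogonal families and minimal projections. -/

section Decomposition

variable {N : ObservableNet H}

namespace NetEndo

/-- Finite families of mutually orthogonal nonzero self-adjoint intertwiners. -/
structure IsOrthogonalFamily (f : NetEndo N) {k : ℕ} (y : Fin k → N.quasilocal) : Prop where
  intertwines : ∀ i, Intertwines f f (y i)
  star_eq : ∀ i, star (y i) = y i
  ne_zero : ∀ i, y i ≠ 0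
  mul_eq_zero : ∀ i j, i ≠ j → y i * y j = 0

namespace IsOrthogonalFamily

variable {f : NetEndo N} {k : ℕ} {y : Fin k → N.quasilocal} {a b : N.quasilocal}

theorem mul_eq_zero_symm (ha : star a = a) (hb : star b = b) (h : a * b = 0) : b * a = 0 := by
  have := congrArg star h
  rwa [star_mul, ha, hb, star_zero] at this

theorem cons (hy : IsOrthogonalFamily f y) (ha : Intertwines f f a) (hs : star a = a) (h0 : a ≠ 0)
    (hay : ∀ j, a * y j = 0) :
    IsOrthogonalFamily f (Fin.cons a y : Fin (k + 1) → N.quasilocal) := by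
  refine ⟨fun i => ?_, fun i => ?_, fun i => ?_, fun i j => ?_⟩
  · refine Fin.cases ?_ (fun i => ?_) i
    · exact ha
    · exact hy.intertwines i
  · refine Fin.cases ?_ (fun i => ?_) i
    · exact hs
    · exact hy.star_eq i
  · refine Fin.cases ?_ (fun i => ?_) i
    · exact h0
    · exact hy.ne_zero i
  · refine Fin.cases ?_ (fun i => ?_) i <;> refine Fin.cases ?_ (fun j => ?_) j
    · intro h; exact (h rfl).elim
    · intro _; exact hay j
    · intro _; exact mul_eq_zero_symm hs (hy.star_eq i) (hay i)
    · intro h; exact hy.mul_eq_zero i j fun h' => h (by rw [h'])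

theorem update (hy : IsOrthogonalFamily f y) (i : Fin k) (ha : Intertwines f f a)
    (hs : star a = a) (h0 : a ≠ 0) (hay : ∀ j, j ≠ i → a * y j = 0) :
    IsOrthogonalFamily f (Function.update y i a) := by
  refine ⟨fun j => ?_, fun j => ?_, fun j => ?_, fun j l hjl => ?_⟩
  · rcases eq_or_ne j i with rfl | h
    · rwa [Function.update_self]
    · rw [Function.update_of_ne h]; exact hy.intertwines j
  · rcases eq_or_ne j i with rfl | h
    · rwa [Function.update_self]
    · rw [Function.update_of_ne h]; exact hy.star_eq j
  · rcases eq_or_ne j i with rfl | h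
    · rwa [Function.update_self]
    · rw [Function.update_of_ne h]; exact hy.ne_zero j
  · rcases eq_or_ne j i with rfl | h
    · rw [Function.update_self, Function.update_of_ne hjl.symm]; exact hay l hjl.symm
    · rw [Function.update_of_ne h]
      rcases eq_or_ne l i with rfl | h'
      · rw [Function.update_self]; exact mul_eq_zero_symm hs (hy.star_eq j) (hay j h)
      · rw [Function.update_of_ne h']; exact hy.mul_eq_zero j l hjl

theorem split (hy : IsOrthogonalFamily f y) (i : Fin k) (ha : Intertwines f f a)
    (hb : Intertwines f f b) (has : star a = a) (hbs : star b = b) (ha0 : a ≠ 0) (hb0 : b ≠ 0)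
    (hab : a * b = 0) (hay : ∀ j, j ≠ i → a * y j = 0) (hby : ∀ j, j ≠ i → b * y j = 0) :
    IsOrthogonalFamily f (Fin.cons a (Function.update y i b) : Fin (k + 1) → N.quasilocal) := by
  refine (hy.update i hb hbs hb0 hby).cons ha has ha0 fun j => ?_
  rcases eq_or_ne j i with rfl | h
  · rwa [Function.update_self]
  · rw [Function.update_of_ne h]; exact hay j h

/-- The elements of a maximal family are multiples of projections. -/
theorem exists_mul_self_eq (hy : IsOrthogonalFamily f y)
    (hmax : ∀ z : Fin (k + 1) → N.quasilocal, ¬ IsOrthogonalFamily f z) (i : Fin k) :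
    ∃ c : ℂ, c ≠ 0 ∧ star c = c ∧ y i * y i = c • y i := by
  by_cases h : ∃ c : ℝ, y i * y i = c • y i
  · obtain ⟨c, hc⟩ := h
    refine ⟨c, fun h0 => hy.ne_zero i ?_, Complex.conj_ofReal c, by rw [hc]; rfl⟩
    rw [Complex.ofReal_eq_zero] at h0
    rw [h0, zero_smul] at hc
    rw [← CStarRing.star_mul_self_eq_zero_iff, hy.star_eq, hc]
  · push Not at h
    -- The functional calculus would split `y i` into two orthogonal nonzero intertwiners, giving a
    -- family with `k + 1` members.
    obtain ⟨p, q, hp, hq, hp0, hq0, hpq, hc⟩ := exists_orthogonal_of_isSelfAdjoint (hy.star_eq i) h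
    have hcy := hc (y i) (Commute.refl _)
    have hint : ∀ p, (∀ b, Commute b (y i) → Commute b p) → Intertwines f f (y i * p) := by
      intro p hcp
      have h1 : ∀ a, p * f a = f a * p := fun a =>
        (hcp (f a) ((hy.intertwines i).comm a).symm).eq.symm
      refine ⟨?_, by rw [← mul_assoc, (hy.intertwines i).left], fun a => ?_⟩
      · rw [mul_assoc, h1, ← mul_assoc, (hy.intertwines i).right]
      · rw [mul_assoc, h1, ← mul_assoc, (hy.intertwines i).comm, mul_assoc]
    have hz : ∀ p, Commute (y i) p → ∀ j, j ≠ i → y i * p * y j = 0 := by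
      intro p hcp j hj
      rw [hcp.eq, mul_assoc, hy.mul_eq_zero i j hj.symm, mul_zero]
    refine (hmax _ (hy.split i (hint p fun b hb => (hc b hb).1) (hint q fun b hb => (hc b hb).2)
      ?_ ?_ hp0 hq0 ?_ (hz p hcy.1) (hz q hcy.2))).elim
    · rw [star_mul, hp, hy.star_eq, hcy.1.eq]
    · rw [star_mul, hq, hy.star_eq, hcy.2.eq]
    · rw [hcy.2.eq, mul_assoc, ← mul_assoc p, hpq, zero_mul, mul_zero]

/-- The elements of a maximal family of projections are minimal. -/
theorem exists_sandwich_eq (hy : IsOrthogonalFamily f y)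
    (hmax : ∀ z : Fin (k + 1) → N.quasilocal, ¬ IsOrthogonalFamily f z)
    (hi : ∀ i, y i * y i = y i) (i : Fin k) {t : N.quasilocal} (ht : Intertwines f f t) :
    ∃ c : ℂ, y i * t * y i = c • y i := by
  have key : ∀ t, Intertwines f f t → star t = t → ∃ c : ℂ, y i * t * y i = c • y i := by
    intro t ht hts
    obtain ⟨w, hw⟩ : ∃ w, w = y i * t * y i := ⟨_, rfl⟩
    rw [← hw]
    by_cases hw0 : w = 0
    · exact ⟨0, by rw [hw0, zero_smul]⟩
    have hyw : y i * w = w := by rw [hw]; simp only [← mul_assoc, hi]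
    have hwy : w * y i = w := by rw [hw]; simp only [mul_assoc, hi]
    have hwi : Intertwines f f w := hw ▸ ((hy.intertwines i).mul ht).mul (hy.intertwines i)
    have hws : star w = w := by rw [hw]; simp only [star_mul, hts, hy.star_eq, mul_assoc]
    have hwj : ∀ j, j ≠ i → w * y j = 0 := fun j hj => by
      rw [← hwy, mul_assoc, hy.mul_eq_zero i j hj.symm, mul_zero]
    obtain ⟨c, hc0, hcs, hc⟩ := (hy.update i hwi hws hw0 hwj).exists_mul_self_eq hmax i
    rw [Function.update_self] at hc
    refine ⟨c, ?_⟩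
    -- Up to the factor `c`, `w` is a projection below `y i`. If it were a proper one, `w` and `c •
    -- y i - w` could replace `y i` and enlarge the family.
    by_contra hne
    refine hmax _ (hy.split i hwi ((hy.intertwines i).smul c |>.sub hwi) hws ?_ hw0
      (sub_ne_zero.2 fun h => hne h.symm) ?_ hwj fun j hj => ?_)
    · rw [star_sub, star_smul, hcs, hws, hy.star_eq]
    · rw [mul_sub, mul_smul_comm, hwy, hc, sub_self]
    · rw [sub_mul, smul_mul_assoc, hwj j hj, hy.mul_eq_zero i j hj.symm, smul_zero, sub_zero]
  obtain ⟨c, hc⟩ := key (t + star t) (ht.add ht.star) (by rw [star_add, star_star, add_comm])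
  obtain ⟨d, hd⟩ := key (Complex.I • (t - star t)) ((ht.sub ht.star).smul _) (by
    rw [star_smul, star_sub, star_star, ← neg_sub t, smul_neg, ← neg_smul]
    simp)
  refine ⟨(1 / 2) * (c - Complex.I * d), ?_⟩
  have e : t = (1 / 2 : ℂ) • ((t + star t) - Complex.I • (Complex.I • (t - star t))) := by
    rw [smul_smul, Complex.I_mul_I, neg_one_smul, sub_neg_eq_add,
      show t + star t + (t - star t) = (2 : ℂ) • t by rw [two_smul]; abel, smul_smul]
    norm_num
  rw [e, mul_smul_comm, smul_mul_assoc, mul_sub, sub_mul, hc, mul_smul_comm, smul_mul_assoc, hd,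
    smul_smul, ← sub_smul, smul_smul]

end IsOrthogonalFamily

/-- Endomorphisms with half conjugates are finite direct sums of irreducible ones. -/
theorem HalfConj.exists_decomposition [Nontrivial H] {f g : NetEndo N} {r r' : N.quasilocal}
    (h : HalfConj f g r r') : ∃ (k : ℕ) (e : Fin k → N.quasilocal), (∀ i, Intertwines f f (e i)) ∧
      (∀ i, star (e i) = e i) ∧ (∀ i, e i * e i = e i) ∧ (∀ i, e i ≠ 0) ∧ ∑ i, e i = f 1 ∧
      ∀ i t, Intertwines f f t → ∃ c : ℂ, e i * t * e i = c • e i := by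
  -- The bound of `card_le` guarantees an orthogonal family of maximal size.
  obtain ⟨k, ⟨y, hy⟩, hmax⟩ : ∃ k, (∃ y : Fin k → N.quasilocal, IsOrthogonalFamily f y) ∧
      ∀ z : Fin (k + 1) → N.quasilocal, ¬ IsOrthogonalFamily f z := by
    by_contra! hcon
    have hall : ∀ k, ∃ y : Fin k → N.quasilocal, IsOrthogonalFamily f y := by
      intro k
      induction k with
      | zero => exact ⟨Fin.elim0, fun i => i.elim0, fun i => i.elim0,
          fun i => i.elim0, fun i => i.elim0⟩
      | succ k ih => exact hcon k ih
    obtain ⟨k, hk⟩ := exists_nat_gt (‖r‖ ^ 2 * ‖r'‖ ^ 2)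
    obtain ⟨y, hy⟩ := hall k
    exact (h.card_le hy.intertwines hy.star_eq hy.ne_zero hy.mul_eq_zero).not_gt hk
  choose c hc0 hcs hc using hy.exists_mul_self_eq hmax
  obtain ⟨e, he, hei⟩ : ∃ e : Fin k → N.quasilocal, IsOrthogonalFamily f e ∧
      ∀ i, e i * e i = e i := by
    refine ⟨fun i => (c i)⁻¹ • y i, ⟨fun i => (hy.intertwines i).smul _,
      fun i => by rw [star_smul, star_inv₀, hcs, hy.star_eq],
      fun i => smul_ne_zero (inv_ne_zero (hc0 i)) (hy.ne_zero i),
      fun i j hij => by rw [smul_mul_smul_comm, hy.mul_eq_zero i j hij, smul_zero]⟩, fun i => ?_⟩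
    rw [smul_mul_smul_comm, hc, smul_smul, mul_assoc, inv_mul_cancel₀ (hc0 i), mul_one]
  refine ⟨k, e, he.intertwines, he.star_eq, hei, he.ne_zero, ?_,
    fun i t ht => he.exists_sandwich_eq hmax hei i ht⟩
  by_contra hne
  -- Otherwise the complement of the sum would be a further member.
  refine hmax _ (he.cons (a := f 1 - ∑ i, e i)
    ((Intertwines.one f).sub (Intertwines.sum _ fun i _ => he.intertwines i)) ?_
    (sub_ne_zero.2 fun h => hne h.symm) fun j => ?_)
  · rw [star_sub, star_map_one, star_sum, Finset.sum_congr rfl fun i _ => he.star_eq i]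
  · rw [sub_mul, (he.intertwines j).left, Finset.sum_mul, Finset.sum_eq_single j
      (fun i _ hij => he.mul_eq_zero i j hij) (by simp), hei, sub_self]

theorem subEndo_irreducible {f : NetEndo N} {e : N.quasilocal} (he : Intertwines f f e)
    (hs : star e = e) (hi : e * e = e)
    (hirr : ∀ t, Intertwines f f t → ∃ c : ℂ, e * t * e = c • e) {t : N.quasilocal}
    (ht : Intertwines (subEndo f e he hs hi) (subEndo f e he hs hi) t) :
    ∃ c : ℂ, t = c • subEndo f e he hs hi 1 := by
  have h1 : Intertwines (subEndo f e he hs hi) f e := intertwines_subEndo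
  obtain ⟨c, hc⟩ := hirr _ ((h1.mul ht).mul h1.star)
  refine ⟨c, ?_⟩
  have h2 := ht.left
  have h3 := ht.right
  rw [subEndo_one] at h2 h3 ⊢
  rw [← hc, hs, h2, h3, h2, h3]

end NetEndo
end Decomposition

/-! ### Statistics of irreducible endomorphisms with half conjugates -/

section Statistics

variable {N : ObservableNet H}

namespace NetEndo

variable {f g f₂ g₂ : NetEndo N} {r r' r₂ r₂' : N.quasilocal}

theorem eps_id_id : eps (NonUnitalStarAlgHom.id ℂ N.quasilocal)
    (NonUnitalStarAlgHom.id ℂ N.quasilocal) = 1 := eps_id_right isLT_id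

/-- The Yang-Baxter equation. -/
theorem eps_yang_baxter (hf : IsLT f) (hf₂ : IsLT f₂) :
    eps f f₂ * f (eps f₂ f₂) * eps f₂ f =
      f₂ (eps f₂ f) * eps f₂ f₂ * f₂ (eps f f₂) := by
  -- Naturality in the second argument with respect to the arrow `eps f f₂`; the hexagon identity
  -- expands both sides.
  have h1 := eps_naturality hf₂ (hf.comp hf₂) hf₂ (hf₂.comp hf) (Intertwines.one f₂)
    (eps_intertwines hf hf₂)
  rw [eps_comp_right hf₂ hf₂ hf, eps_comp_right hf₂ hf hf₂, map_one_mul] at h1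
  rw [h1, NonUnitalStarAlgHom.comp_apply]
  have h2 : f (f₂ (f₂ 1)) * (f (eps f₂ f₂) * eps f₂ f) = f (eps f₂ f₂) * eps f₂ f := by
    rw [← mul_assoc, ← map_mul, show f₂ (f₂ 1) * eps f₂ f₂ = eps f₂ f₂ from
      (eps_intertwines hf₂ hf₂).left]
  rw [mul_assoc (eps f f₂) (f (f₂ (f₂ 1))), h2, mul_assoc]

/-- The statistics parameters are multiplicative. -/
theorem HalfConj.leftInv_eps_comp (hf : IsLT f) (hf₂ : IsLT f₂) (h : HalfConj f g r r')
    (h₂ : HalfConj f₂ g₂ r₂ r₂') {c d : ℂ} (hc : leftInv g r (eps f f) = c • f 1)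
    (hd : leftInv g₂ r₂ (eps f₂ f₂) = d • f₂ 1) :
    leftInv (g₂.comp g) (g₂ r * r₂) (eps (f.comp f₂) (f.comp f₂)) = (c * d) • f (f₂ 1) := by
  have e1 : leftInv g r (eps (f.comp f₂) (f.comp f₂)) =
      c • (eps f f₂ * f (eps f₂ f₂) * eps f₂ f) := by
    have h1 := (eps_intertwines hf hf₂).right
    have h2 : eps f f₂ * f 1 = eps f f₂ := by
      rw [← h1, mul_assoc, NonUnitalStarAlgHom.comp_apply, map_mul_one]
    rw [eps_comp_left hf hf₂ (hf.comp hf₂), h.leftInv_mul_right, eps_comp_right hf hf hf₂,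
      h.leftInv_mul, hc, mul_smul_comm, h2, smul_mul_assoc, eps_comp_right hf₂ hf hf₂, mul_assoc]
  have h3 : f₂ 1 * eps f f₂ = eps f f₂ := by
    rw [← (eps_intertwines hf hf₂).left, NonUnitalStarAlgHom.comp_apply, map_one_mul_assoc]
  -- The Yang-Baxter equation brings the argument into the form `f₂ _ * eps f₂ f₂ * f₂ _`, where the
  -- second left inverse can be evaluated.
  rw [leftInv_comp, e1, map_smul, eps_yang_baxter hf hf₂, h₂.leftInv_mul_mul, hd, mul_smul_comm,
    smul_mul_assoc, mul_assoc, h3, eps_mul_eps hf hf₂, smul_smul]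

/-- The half conjugates of the tensor powers. -/
theorem HalfConj.exists_npow (hf : IsLT f) (h : HalfConj f g r r') {c : ℂ}
    (hc : leftInv g r (eps f f) = c • f 1) (d : ℕ) : ∃ g' s s', HalfConj (npow f d) g' s s' ∧
      (∀ x, leftInv g' s x = (leftInv g r)^[d] x) ∧
      leftInv g' s (eps (npow f d) (npow f d)) = c ^ d • npow f d 1 := by
  induction d with
  | zero =>
    refine ⟨_, _, _, halfConj_id, fun x => ?_, ?_⟩
    · simp [leftInv_apply]
    · change leftInv (NonUnitalStarAlgHom.id ℂ N.quasilocal) 1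
        (eps (NonUnitalStarAlgHom.id ℂ N.quasilocal) (NonUnitalStarAlgHom.id ℂ N.quasilocal)) = _
      rw [eps_id_id]
      simp [leftInv_apply]
  | succ d ih =>
    obtain ⟨g', s, s', h', hφ, hε⟩ := ih
    refine ⟨_, _, _, h'.comp h, fun x => ?_, ?_⟩
    · rw [leftInv_comp, hφ, ← Function.iterate_succ_apply' (leftInv g r)]
    · rw [pow_succ]
      exact HalfConj.leftInv_eps_comp (hf.npow d) hf h' h hε hc

theorem altProj_mul_map_one (hf : IsLT f) (b : Bool) {d : ℕ} (hd : 1 ≤ d) :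
    altProj hf b d * f 1 = altProj hf b d := by
  have := unit_mul_npow (f := f) hd
  rw [npow_one] at this
  rw [← (altProj_intertwines hf b d).right, mul_assoc, this]

/-- The left inverse of the (anti)symmetrizers. -/
theorem HalfConj.leftInv_altProj (hf : IsLT f) (h : HalfConj f g r r') (b : Bool) {κ c : ℂ}
    (hκ : star r * r = κ • 1) (hc : leftInv g r (eps f f) = c • f 1) (d : ℕ) :
    leftInv g r (altProj hf b (d + 1)) =
      ((κ + d * permSign b * c) / (d + 1)) • altProj hf b d := by
  have hd : ((d : ℂ) + 1) ≠ 0 := by exact_mod_cast d.succ_ne_zero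
  have h1 := congrArg (leftInv g r) (altProj_succ_eq hf b d)
  rw [map_smul, map_add, map_smul, h.leftInv_map, hκ, mul_smul_comm, mul_one, h.leftInv_mul_mul,
    hc] at h1
  have h2 : ((d : ℂ) * permSign b) • (altProj hf b d * (c • f 1) * altProj hf b d) =
      (d * permSign b * c) • altProj hf b d := by
    rcases Nat.eq_zero_or_pos d with rfl | hd'
    · simp
    · rw [mul_smul_comm, smul_mul_assoc, altProj_mul_map_one hf b hd', altProj_mul_self, smul_smul]
  rw [h2, ← add_smul] at h1
  rw [div_eq_inv_mul, mul_smul, ← h1, smul_smul]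
  push_cast
  rw [inv_mul_cancel₀ hd, one_smul]

theorem exists_real_of_selfAdjoint {x y : N.quasilocal} {c : ℂ} (hx : star x = x) (hy : star y = y)
    (hy0 : y ≠ 0) (h : x = c • y) : ((c.re : ℝ) : ℂ) = c := by
  rw [← Complex.conj_eq_iff_re]
  have h1 := congrArg star h
  rw [hx, star_smul, hy, h, ← sub_eq_zero, ← sub_smul, smul_eq_zero] at h1
  exact (sub_eq_zero.1 (h1.resolve_right hy0)).symm

/-- An irreducible endomorphism with a half conjugate has finite statistics. -/
theorem HalfConj.exists_dim [Nontrivial H] (hf : IsLT f) (h : HalfConj f g r r')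
    (h1 : f 1 ≠ 0) {κ c : ℂ} (hκ : star r * r = κ • 1) (hκ0 : κ ≠ 0)
    (hc : leftInv g r (eps f f) = c • f 1) :
    ∃ (b : Bool) (d : ℕ), 1 ≤ d ∧ altProj hf b d ≠ 0 ∧ d * permSign b * c = -κ := by
  have hone : (1 : N.quasilocal) ≠ 0 := fun h0 => h1 (by rw [h0, map_zero])
  have hκr := exists_real_of_selfAdjoint (by rw [star_mul, star_star]) (star_one _) hone hκ
  have hcr := exists_real_of_selfAdjoint (by rw [star_leftInv, star_eps hf hf]) (star_map_one f)
    h1 hc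
  obtain ⟨b, hb⟩ : ∃ b, ∃ s : ℝ, s ≤ 0 ∧ (s : ℂ) = permSign b * c := by
    rcases le_total c.re 0 with h' | h'
    · exact ⟨false, c.re, h', by rw [hcr]; simp [permSign]⟩
    · exact ⟨true, -c.re, by linarith, by push_cast; rw [hcr]; simp [permSign]⟩
  obtain ⟨s, hs0, hs⟩ := hb
  have hφ : ∀ d, leftInv g r (altProj hf b (d + 1)) =
      (((κ.re + d * s) / (d + 1) : ℝ) : ℂ) • altProj hf b d := fun d => by
    rw [h.leftInv_altProj hf b hκ hc]
    congr 1
    push_cast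
    rw [hκr, hs, mul_assoc]
  have hφ' : ∀ d, star (g (altProj hf b d) * r) * (g (altProj hf b d) * r) =
      leftInv g r (altProj hf b d) := fun d => by
    rw [← leftInv_star_mul_self, star_altProj, altProj_mul_self]
  have hex : ∃ d, altProj hf b d = 0 := by
    by_contra! hne
    -- A nonzero projection has norm one. So the left inverse of the projection on `d + 1` factors
    -- has norm at least `1 / ‖r'‖²`, whereas the recursion and `s ≤ 0` bound this norm by `κ / (d +
    -- 1)`.
    have hbound : ∀ d : ℕ, ((d : ℝ) + 1) ≤ ‖r'‖ ^ 2 * κ.re := by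
      intro d
      have hd1 : (0 : ℝ) < d + 1 := by positivity
      have h2 := hφ' (d + 1)
      rw [hφ] at h2
      have hnn : 0 ≤ (κ.re + d * s) / (d + 1) :=
        ObservableNet.nonneg_of_star_mul_self (altProj_mul_self hf b d) (hne d) h2
      have hn1 : ∀ d, ‖altProj hf b d‖ = 1 := fun d => by
        have h3 := CStarRing.norm_star_mul_self (x := altProj hf b d)
        rw [star_altProj, altProj_mul_self] at h3
        have h4 := norm_ne_zero_iff.2 (hne d)
        field_simp at h3
        exact h3.symm
      have h5 := h.norm_le (altProj_mul_map_one hf b (show 1 ≤ d + 1 by omega))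
      have h6 := CStarRing.norm_star_mul_self (x := g (altProj hf b (d + 1)) * r)
      rw [h2, norm_smul, hn1, mul_one, Complex.norm_real, Real.norm_of_nonneg hnn] at h6
      rw [hn1] at h5
      have h7 : 1 ≤ ‖r'‖ ^ 2 * ((κ.re + d * s) / (d + 1)) := by
        rw [h6]; nlinarith [norm_nonneg r', norm_nonneg (g (altProj hf b (d + 1)) * r)]
      have h8 : (κ.re + d * s) / (d + 1) ≤ κ.re / (d + 1) := by
        gcongr
        nlinarith [Nat.cast_nonneg (α := ℝ) d]
      have h9 : 1 ≤ ‖r'‖ ^ 2 * (κ.re / (d + 1)) :=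
        h7.trans (by gcongr)
      rw [← mul_div_assoc, le_div_iff₀ hd1] at h9
      linarith
    obtain ⟨d, hd⟩ := exists_nat_gt (‖r'‖ ^ 2 * κ.re)
    linarith [hbound d]
  classical
  -- The first vanishing projection is that on `d + 1` factors. The recursion sends it to a multiple
  -- of the nonzero one on `d` factors, so the coefficient vanishes: `κ + d s = 0`.
  obtain ⟨d, hd⟩ : ∃ d, Nat.find hex = d + 1 := by
    refine Nat.exists_eq_succ_of_ne_zero fun h0 => hone ?_
    have := Nat.find_spec hex
    rwa [h0, altProj_zero] at this
  have hd0 : altProj hf b d ≠ 0 := Nat.find_min hex (by omega)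
  have hd1 : altProj hf b (d + 1) = 0 := hd ▸ Nat.find_spec hex
  have h2 := h.leftInv_altProj hf b hκ hc d
  rw [hd1, map_zero] at h2
  have h3 := (smul_eq_zero.1 h2.symm).resolve_right hd0
  rw [div_eq_zero_iff] at h3
  have h4 := h3.resolve_right (by exact_mod_cast d.succ_ne_zero)
  refine ⟨b, d, ?_, hd0, by linear_combination h4⟩
  rcases Nat.eq_zero_or_pos d with rfl | h'
  · simp at h4
    exact (hκ0 h4).elim
  · exact h'

/-- With `x = -κ / d` the factors are `(κ / d) * (d - k) / (k + 1)`, and the numerators `d - k` are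
the denominators in reverse order. -/
theorem prod_dim {κ x : ℂ} {d : ℕ} (h : d * x = -κ) (hd : 1 ≤ d) :
    ∏ k ∈ Finset.range d, ((κ + k * x) / (k + 1)) = (κ / d) ^ d := by
  have hd0 : (d : ℂ) ≠ 0 := by exact_mod_cast (by omega : d ≠ 0)
  have h1 : ∀ k ∈ Finset.range d, (κ + k * x) / (k + 1) =
      (κ / d) * (((d - 1 - k + 1 : ℕ) : ℂ) / ((k + 1 : ℕ) : ℂ)) := by
    intro k hk
    have hk' := Finset.mem_range.1 hk
    rw [show d - 1 - k + 1 = d - k by omega, Nat.cast_sub hk'.le]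
    have hk0 : (k : ℂ) + 1 ≠ 0 := by exact_mod_cast k.succ_ne_zero
    push_cast
    field_simp
    linear_combination (k : ℂ) * h
  rw [Finset.prod_congr rfl h1, Finset.prod_mul_distrib, Finset.prod_const, Finset.card_range,
    Finset.prod_div_distrib, Finset.prod_range_reflect (fun k => ((k + 1 : ℕ) : ℂ)) d, div_self,
    mul_one]
  exact Finset.prod_ne_zero_iff.2 fun k _ => by exact_mod_cast k.succ_ne_zero

theorem HalfConj.iterate_leftInv_altProj (hf : IsLT f) (h : HalfConj f g r r') (b : Bool) {κ c : ℂ}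
    (hκ : star r * r = κ • 1) (hc : leftInv g r (eps f f) = c • f 1) (d : ℕ) :
    (leftInv g r)^[d] (altProj hf b d) =
      (∏ k ∈ Finset.range d, ((κ + k * (permSign b * c)) / (k + 1))) • 1 := by
  induction d with
  | zero => simp [altProj_zero]
  | succ d ih =>
    rw [Function.iterate_succ_apply, h.leftInv_altProj hf b hκ hc, Finset.prod_range_succ,
      mul_comm (Finset.prod _ _), mul_smul, ← ih, mul_assoc]
    generalize altProj hf b d = x
    generalize (κ + d * (permSign b * c)) / (d + 1) = y
    clear ih
    induction d generalizing x with
    | zero => rfl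
    | succ d ih => rw [Function.iterate_succ_apply, map_smul, ih, Function.iterate_succ_apply]

/-- `f` is doubly faithful. -/
def IsDoublyFaithful (f : NetEndo N) : Prop :=
  ∀ (o : DoubleCone) (f₁ : NetEndo N) (u : N.quasilocal), LocalizedIn f₁ o → UnitaryEquiv f f₁ u →
    ∀ x ∈ (N.alg o).commutant, x * ((f₁ 1 : N.quasilocal) : H →L[ℂ] H) = 0 → x = 0

/-- Transported to `o`, the arrow becomes an element `S` of the local algebra with `f₁ 1 * S = S`
and `S⁺ S` a nonzero scalar. If `x` lies in the commutant and `x * f₁ 1 = 0`, then `S x = x S = 0`,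
so `x = 0`. -/
theorem isDoublyFaithful_of_arrow (hg : IsLT g) {s : N.quasilocal} (hs0 : s ≠ 0)
    (hs : Intertwines (NonUnitalStarAlgHom.id ℂ N.quasilocal) (f.comp g) s) :
    IsDoublyFaithful f := by
  intro o f₁ u hf₁ hu x hx h0
  obtain ⟨g₁, v, hg₁, hv⟩ := hg.2 o
  have huv := hu.times hv
  have hs₁ := huv.toIntertwines.mul hs
  have hmem := localizedIn_id.intertwiner_mem (hf₁.comp hg₁) hs₁
  have hss : star (u * f v * s) * (u * f v * s) = star s * s := by
    rw [star_mul, mul_assoc, ← mul_assoc (star (u * f v)), huv.star_mul_self, hs.left]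
  obtain ⟨c, hc⟩ := ObservableNet.exists_scalar_of_commute (x := star s * s)
    fun a => (hs.star.mul hs).comm a
  have hleft : f₁ 1 * (u * f v * s) = u * f v * s := by
    rw [← mul_assoc, ← mul_assoc, hu.left]
  have hc0 : c ≠ 0 := by
    rintro rfl
    rw [zero_smul, CStarRing.star_mul_self_eq_zero_iff] at hc
    exact hs0 hc
  have e1 : x * ((u * f v * s : N.quasilocal) : H →L[ℂ] H) = 0 := by
    rw [← hleft, MulMemClass.coe_mul, ← mul_assoc, h0, zero_mul]
  rw [← VonNeumannAlgebra.mem_commutant_iff.1 hx _ hmem] at e1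
  have e2 : ((star (u * f v * s) * (u * f v * s) : N.quasilocal) : H →L[ℂ] H) * x = 0 := by
    rw [MulMemClass.coe_mul, mul_assoc, e1, mul_zero]
  rw [hss, hc] at e2
  have e3 : c • x = 0 := by
    rw [← e2]
    change c • x = (c • (1 : H →L[ℂ] H)) * x
    rw [smul_mul_assoc, one_mul]
  exact (smul_eq_zero.1 e3).resolve_left hc0

/-- Two projections which are not distinguished by a left inverse. -/
theorem HalfConj.eq_smul_of_leftInv (h : HalfConj f g r r') {p q : N.quasilocal} {c : ℂ}
    (hc : c * c = 1) (hcs : star c = c) (hp1 : p * f 1 = p) (hq1 : q * f 1 = q)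
    (hps : star p = p) (hqs : star q = q) (hpp : p * p = p) (hqq : q * q = p) (hpq : p * q = q)
    (hφ : leftInv g r p = c • leftInv g r q) : p = c • q := by
  have hqp : q * p = q := by
    have := congrArg star hpq
    rwa [star_mul, hps, hqs] at this
  refine sub_eq_zero.1 (h.eq_zero_of_leftInv ?_ ?_)
  · rw [sub_mul, smul_mul_assoc, hp1, hq1]
  -- The difference is twice a projection, so faithfulness of the left inverse can be tested on the
  -- difference itself.
  · have h1 : star (p - c • q) * (p - c • q) = (p - c • q) + (p - c • q) := by
      rw [star_sub, star_smul, hcs, hps, hqs, sub_mul, mul_sub, mul_sub, hpp, mul_smul_comm, hpq,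
        smul_mul_assoc, smul_mul_smul_comm, hc, hqq, hqp, one_smul]
      generalize c • q = x
      abel
    rw [h1, map_add, map_sub, map_smul, hφ, sub_self, add_zero]

theorem eps_self_mul (hf : IsLT f) {e : N.quasilocal} (he : Intertwines f f e) :
    eps f f * e = f e * eps f f := by
  have h1 := eps_naturality hf hf hf hf he (Intertwines.one f)
  have h2 : eps f f * f (f 1) = eps f f := (eps_intertwines hf hf).right
  rw [he.comm, ← mul_assoc, h2, map_one_mul] at h1
  exact h1

/-- The subobject `e × e` of `f × f`. -/
theorem HalfConj.times_eq_smul_eps (hf : IsLT f) (h : HalfConj f g r r') {e : N.quasilocal}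
    (he : Intertwines f f e) (hs : star e = e) (hi : e * e = e) {m c : ℂ}
    (hc : c * c = 1) (hcs : star c = c) (hφ : leftInv g r e = m • 1)
    (hε : leftInv g r (eps f f) = (c * m) • f 1) :
    e * f e = c • (eps f f * (e * f e)) := by
  have hp' : e * f e = f e * e := he.comm e
  have hpp : e * f e * (e * f e) = e * f e := by
    rw [mul_assoc, ← mul_assoc (f e), ← he.comm, mul_assoc, ← map_mul, hi, ← mul_assoc, hi]
  have hps : star (e * f e) = e * f e := by rw [star_mul, ← map_star, hs, ← he.comm]
  have hBp : eps f f * (e * f e) = e * f e * eps f f := eps_naturality hf hf hf hf he he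
  have hBB : eps f f * (eps f f * (e * f e)) = e * f e := by
    rw [← mul_assoc, eps_self_mul_self hf, hp', ← mul_assoc, ← map_mul, he.left]
  have hp1 : e * f e * f 1 = e * f e := by rw [mul_assoc, map_mul_one]
  refine h.eq_smul_of_leftInv hc hcs hp1 ?_ hps ?_ hpp ?_ ?_ ?_
  · rw [mul_assoc, hp1]
  · rw [star_mul, hps, star_eps hf hf, hBp]
  · rw [mul_assoc, ← mul_assoc (e * f e), ← hBp, mul_assoc (eps f f), hpp, hBB]
  · rw [← mul_assoc, ← hBp, mul_assoc, hpp]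
  -- Both sides are `m • e`: the left one by `hφ`, the right one since the left inverse replaces the
  -- symmetry by `c m` and `c² = 1`.
  · rw [h.leftInv_mul_right, hφ, ← mul_assoc, eps_self_mul hf he, h.leftInv_mul_mul, hε,
      mul_smul_comm, he.right, smul_mul_assoc, smul_mul_assoc, one_mul, hi, smul_smul, ← mul_assoc,
      hc, one_mul]

/-- A subobject with the statistics parameter of a simple object is simple. -/
theorem HalfConj.eps_sub (hf : IsLT f) (h : HalfConj f g r r') {e : N.quasilocal}
    (he : Intertwines f f e) (hs : star e = e) (hi : e * e = e) {m c : ℂ}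
    (hc : c * c = 1) (hcs : star c = c) (hφ : leftInv g r e = m • 1)
    (hε : leftInv g r (eps f f) = (c * m) • f 1) {γ : NetEndo N}
    (hγ : γ = subEndo f e he hs hi) : eps γ γ = c • γ (γ 1) := by
  have hin : Intertwines γ f e := hγ ▸ intertwines_subEndo
  have hlt : IsLT γ := hγ ▸ hf.sub
  have h0 : ∀ a, γ a = e * f a := fun a => by rw [hγ, subEndo_apply]
  clear hγ
  have hγe : e * γ e = e * f e := by rw [h0, ← mul_assoc, hi]
  have hγ1 : γ (γ 1) = e * f e := by rw [h0, h0, he.right]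
  have h2 := eps_naturality hlt hlt hf hf hin hin
  have h5 : γ (γ 1) * eps γ γ = eps γ γ := (eps_intertwines hlt hlt).left
  have h6 := h.times_eq_smul_eps hf he hs hi hc hcs hφ hε
  rw [hγ1] at h5
  rw [hγe, h5] at h2
  rw [hγ1, ← h2]
  nth_rw 2 [h6]
  rw [smul_smul, hc, one_smul]

/-- A subobject with the statistics parameter of a simple object is simple, faithful and doubly
faithful. -/
theorem HalfConj.simple_sub (hf : IsLT f) (h : HalfConj f g r r') {e : N.quasilocal}
    (he : Intertwines f f e) (hs : star e = e) (hi : e * e = e) (he0 : e ≠ 0) {m c : ℂ}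
    (hc : c * c = 1) (hcs : star c = c) (hm : m ≠ 0) (hφ : leftInv g r e = m • 1)
    (hε : leftInv g r (eps f f) = (c * m) • f 1) :
    eps (subEndo f e he hs hi) (subEndo f e he hs hi) =
        c • subEndo f e he hs hi (subEndo f e he hs hi 1) ∧
      Function.Injective (subEndo f e he hs hi) ∧ IsDoublyFaithful (subEndo f e he hs hi) := by
  have hin : Intertwines (subEndo f e he hs hi) f e := intertwines_subEndo
  refine ⟨h.eps_sub hf he hs hi hc hcs hφ hε rfl, ?_,
    isDoublyFaithful_of_arrow h.lt (s := e * r') ?_ ?_⟩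
  · rw [injective_iff_map_eq_zero]
    intro a ha
    -- With `φ` for the left inverse, `φ(e f(a)) = φ(e) a = m a`, and `a` can be read off because `m
    -- ≠ 0`.
    have := h.leftInv_mul_right e a
    rw [← subEndo_apply (he := he) (hs := hs) (hi := hi), ha, map_zero, hφ,
      smul_mul_assoc, one_mul] at this
    exact (smul_eq_zero.1 this.symm).resolve_left hm
  · intro h0
    have h3 := congrArg star h0
    rw [star_mul, hs, star_zero] at h3
    have h2 : f 1 * e = 0 := by
      rw [← h.zigzag, mul_assoc, ← he.comm, ← mul_assoc, h3, zero_mul]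
    rw [he.left] at h2
    exact he0 h2
  · have h2 := (hin.star.mul_unit g).mul h.arrow'
    rw [mul_assoc, h.arrow'_comm, mul_one, hs] at h2
    exact h2

/-- An irreducible endomorphism with a half conjugate has an associated simple, faithful and doubly
faithful endomorphism. -/
theorem HalfConj.exists_simple [Nontrivial H] (hf : IsLT f) (h : HalfConj f g r r')
    (hirr : ∀ t, Intertwines f f t → ∃ c : ℂ, t = c • f 1) (h1 : f 1 ≠ 0) :
    ∃ (b : Bool) (d : ℕ), 1 ≤ d ∧ ∃ γ : NetEndo N,
      γ = subEndo (npow f d) (altProj hf b d) (altProj_intertwines hf b d) (star_altProj hf b d)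
        (altProj_mul_self hf b d) ∧
      (∃ s : ℂ, (s = 1 ∨ s = -1) ∧ eps γ γ = s • γ (γ 1)) ∧ Function.Injective γ ∧
        IsDoublyFaithful γ := by
  obtain ⟨κ, hκ0, hκ⟩ := h.exists_dimension h1
  have hκ0' : (κ : ℂ) ≠ 0 := by exact_mod_cast hκ0.ne'
  obtain ⟨c, hc⟩ := hirr (leftInv g r (eps f f)) (by
    refine ⟨?_, ?_, fun a => ?_⟩
    · rw [← h.leftInv_mul_right,
        show eps f f * f (f 1) = eps f f from (eps_intertwines hf hf).right]
    · rw [← h.leftInv_mul, show f (f 1) * eps f f = eps f f from (eps_intertwines hf hf).left]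
    · rw [← h.leftInv_mul_right, eps_self_comm hf, h.leftInv_mul])
  obtain ⟨b, d, hd, hA0, hdim⟩ := h.exists_dim hf h1 hκ hκ0' hc
  have hd0 : (d : ℂ) ≠ 0 := by exact_mod_cast (by omega : d ≠ 0)
  refine ⟨b, d, hd, _, rfl, ?_⟩
  obtain ⟨g', r₁, r₁', h', hφ, hε⟩ := h.exists_npow hf hc d
  have hm := h.iterate_leftInv_altProj hf b hκ hc d
  rw [prod_dim (by rw [← mul_assoc]; exact hdim) hd, ← hφ] at hm
  have hm0 : ((κ : ℂ) / d) ^ d ≠ 0 := pow_ne_zero _ (div_ne_zero hκ0' hd0)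
  -- Hence `c ^ d` agrees up to a sign with `(κ / d) ^ d`, the value of the iterated left inverse at
  -- the projection. This is what `simple_sub` requires, and the sign becomes that of the symmetry
  -- of `γ`.
  have hcs : c = -permSign b * (κ / d) := by
    have := permSign_mul_self b
    field_simp
    linear_combination permSign b * hdim - c * d * this
  obtain ⟨s, hs, hsd⟩ : ∃ s : ℂ, (s = 1 ∨ s = -1) ∧ (-permSign b) ^ d = s := by
    refine ⟨_, ?_, rfl⟩
    cases b
    · simpa [permSign] using neg_one_pow_eq_or ℂ d
    · simp [permSign]
  rw [hcs, mul_pow, hsd] at hε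
  have := h'.simple_sub (hf.npow d) (altProj_intertwines hf b d) (star_altProj hf b d)
    (altProj_mul_self hf b d) hA0 (c := s) (by rcases hs with rfl | rfl <;> norm_num)
    (by rcases hs with rfl | rfl <;> simp) hm0 hm hε
  exact ⟨⟨s, hs, this.1⟩, this.2⟩

end NetEndo
end Statistics

/-! ### Inverses of simple, faithful and doubly faithful endomorphisms -/

section Inverses

variable {N : ObservableNet H}

namespace NetEndo

variable {f g γ δ : NetEndo N}

/-- An isometry of the local algebra into the range of the unit. -/
theorem IsDoublyFaithful.exists_isometry [TopologicalSpace.SeparableSpace H]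
    (hN : ∀ a, IsProperlyInfinite (N.alg a)) (hd : IsDoublyFaithful γ) {o : DoubleCone}
    {γ₁ : NetEndo N} {v : N.quasilocal} (hγ₁ : LocalizedIn γ₁ o) (hv : UnitaryEquiv γ γ₁ v) :
    ∃ u : N.quasilocal, (u : H →L[ℂ] H) ∈ N.alg o ∧ star u * u = 1 ∧ γ₁ 1 * u = u := by
  obtain ⟨t, htmem, ht⟩ := exists_orthogonal_isometries (hN o)
  let t' : ℕ → N.quasilocal := fun k => ⟨t k, N.alg_le_quasilocal o (htmem k)⟩
  have ht' : ∀ k l, star (t' k) * t' l = if k = l then 1 else 0 := fun k l => by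
    have := ht k l
    split_ifs at this ⊢ <;> exact Subtype.ext this
  let E : H →L[ℂ] H := ((γ₁ 1 : N.quasilocal) : H →L[ℂ] H)
  have hE : E ∈ N.alg o := hγ₁.one_mem
  -- The projection onto the joint kernel lies in the commutant and is annihilated by `E`, so double
  -- faithfulness makes it zero.
  have hinj : ∀ ξ, (∀ m : N.alg o, (E * (m : H →L[ℂ] H)) ξ = 0) → ξ = 0 := by
    obtain ⟨P, _, hP1, hP2, hP3⟩ := exists_projection_joint_kernel
      fun m : N.alg o => E * (m : H →L[ℂ] H)
    have hPmem : P ∈ (N.alg o).commutant := by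
      refine hP3 _ fun y hy ξ hξ m => ?_
      rw [VonNeumannAlgebra.commutant_commutant] at hy
      exact hξ ⟨m * y, mul_mem m.2 hy⟩
    have hP0 : P = 0 := by
      refine hd o γ₁ v hγ₁ hv P hPmem ?_
      have := hP2 1
      rw [OneMemClass.coe_one, mul_one] at this
      change P * E = 0
      rw [← VonNeumannAlgebra.mem_commutant_iff.1 hPmem E hE, this]
    intro ξ hξ
    rw [← hP1 ξ hξ, hP0, zero_apply]
  obtain ⟨τ, hτ⟩ := exists_sequence_jointly_injective _ hinj
  have hEE : star E = E := congrArg Subtype.val (star_map_one γ₁)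
  have hE2 : E * E = E := congrArg Subtype.val (map_one_mul γ₁ 1)
  have hval : ∀ k l, star ((γ₁ (t' k) : N.quasilocal) : H →L[ℂ] H) *
      ((γ₁ (t' l) : N.quasilocal) : H →L[ℂ] H) = if k = l then E else 0 := fun k l => by
    have h1 : star (γ₁ (t' k)) * γ₁ (t' l) = if k = l then γ₁ 1 else 0 := by
      rw [← map_star, ← map_mul, ht']
      split_ifs
      · rfl
      · exact map_zero _
    have h2 := congrArg Subtype.val h1
    split_ifs at h2 ⊢ <;> exact h2
  -- The elements `γ₁ (t' k)` have initial projection `E` and orthogonal ranges below `E`.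
  -- Infinitely many copies of `E` thus fit into `E`, and by joint injectivity they accommodate the
  -- whole space.
  obtain ⟨u, hu, huu, hub⟩ := exists_isometry_of_orthogonal (N.alg o)
    (fun k => ((γ₁ (t' k) : N.quasilocal) : H →L[ℂ] H)) (fun k => (τ k : H →L[ℂ] H))
    (fun k => hγ₁.apply_mem (htmem k)) (fun k => (τ k).2)
    (fun k => norm_le_one_of_star_mul_self ((hval k k).trans (if_pos rfl)) hE2 hEE)
    (fun k l hkl => (hval k l).trans (if_neg hkl)) (fun ξ hξ => hτ ξ fun k => by
      have := hξ k
      rwa [hval, if_pos rfl] at this)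
  refine ⟨⟨u, N.alg_le_quasilocal o hu⟩, hu, Subtype.ext huu, Subtype.ext ?_⟩
  have h3 := hub (1 - E) fun k => by
    have : E * ((γ₁ (t' k) : N.quasilocal) : H →L[ℂ] H) = _ :=
      congrArg Subtype.val (map_one_mul γ₁ (t' k))
    rw [sub_mul, this, one_mul, sub_self]
  rw [sub_mul, one_mul, sub_eq_zero] at h3
  exact h3.symm

/-- The range of a simple, faithful and doubly faithful endomorphism is a corner. -/
theorem exists_map_eq [TopologicalSpace.SeparableSpace H]
    (hN : ∀ a, IsProperlyInfinite (N.alg a)) (hγ : IsLT γ) {c : ℂ} (hc : c * c = 1)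
    (hcs : star c = c) (hs : eps γ γ = c • γ (γ 1)) (hi : Function.Injective γ)
    (hd : IsDoublyFaithful γ) (x : N.quasilocal) : ∃ y, γ y = γ 1 * x * γ 1 := by
  have hclosed : IsClosed {x : N.quasilocal | ∃ y, γ y = γ 1 * x * γ 1} := by
    have h1 : IsClosed (Set.range γ) :=
      (NonUnitalStarAlgHom.isometry γ hi).isClosedEmbedding.isClosed_range
    exact h1.preimage ((continuous_const.mul continuous_id).mul continuous_const)
  refine ObservableNet.quasilocal_induction hclosed (fun b B hB => ?_) x
  obtain ⟨o, ho⟩ := hγ.1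
  obtain ⟨a, hoa, hba⟩ := o.exists_union_subset b
  obtain ⟨o₂, hao₂⟩ := a.exists_perp
  obtain ⟨γ₁, v, hγ₁, hv⟩ := hγ.2 o₂
  obtain ⟨u, hu, huu, hγu⟩ := hd.exists_isometry hN hγ₁ hv
  have hoo₂ : Perp o₂ o := hao₂.symm.mono subset_rfl hoa
  -- Simplicity evaluates `γ` on its own transporter: `γ v = c • (v * γ (γ 1))`.
  have h1 := eps_eq_of_localized hγ hγ hoo₂.symm ho hγ₁ hv
  rw [hs] at h1
  have hγv : γ v = c • (v * γ (γ 1)) := by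
    have h2 := congrArg (fun x => v * x) h1
    simp only [← mul_assoc, hv.mul_star_self, mul_smul_comm] at h2
    rw [h2]
    calc γ v = γ (γ₁ 1 * v) := by rw [hv.left]
      _ = γ₁ 1 * (γ 1 * γ v) := by
        rw [map_mul, ho.apply_eq hoo₂ hγ₁.one_mem, mul_assoc]
      _ = γ₁ 1 * γ v := by rw [map_one_mul]
  have hEBE : ((γ 1 * B * γ 1 : N.quasilocal) : H →L[ℂ] H) ∈ N.alg a :=
    mul_mem (mul_mem (N.isotony o a hoa ho.one_mem) (N.isotony b a hba hB))
      (N.isotony o a hoa ho.one_mem)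
  -- `γ` maps `v B v⁺` to `γ 1 * B * γ 1 * γ₁ 1`. The isometry `u`, which commutes with `γ 1 * B * γ
  -- 1` and has its range below `γ₁ 1`, removes the last factor.
  refine ⟨star u * (v * B * star v) * u, ?_⟩
  have h3 : γ (v * B * star v) = γ 1 * B * γ 1 * γ₁ 1 := by
    rw [← hγ₁.apply_eq hao₂ hEBE, ← hv.conj, map_mul, map_mul, map_star, hγv]
    simp only [star_smul, hcs, star_mul, ← map_star, star_one, smul_mul_assoc, mul_smul_comm,
      smul_smul, hc, one_smul, map_mul, mul_assoc]
  rw [map_mul, map_mul, map_star, h3, ho.apply_eq hoo₂ hu, star_mul, star_map_one]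
  calc γ 1 * star u * (γ 1 * B * γ 1 * γ₁ 1) * (u * γ 1)
      = γ 1 * (star u * (γ 1 * B * γ 1)) * (γ₁ 1 * u) * γ 1 := by simp only [mul_assoc]
    _ = γ 1 * (γ 1 * B * γ 1) * (star u * u) * γ 1 := by
      rw [hγu, ObservableNet.commute_of_perp hao₂.symm (star_mem hu) hEBE]
      simp only [mul_assoc]
    _ = γ 1 * B * γ 1 := by
      rw [huu, mul_one]
      have : γ 1 * γ 1 = γ 1 := map_one_mul γ 1
      simp only [mul_assoc, this]
      simp only [← mul_assoc, this]

/-- The homomorphism `δ` with `γ δ = w · w⁺`. -/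
theorem exists_lift (hi : Function.Injective γ)
    (hr : ∀ x : N.quasilocal, ∃ y, γ y = γ 1 * x * γ 1) {w : N.quasilocal} (hw : star w * w = 1)
    (hγw : γ 1 * w = w) : ∃ δ : NetEndo N, ∀ a, γ (δ a) = w * a * star w := by
  have hwγ : star w * γ 1 = star w := by
    have := congrArg star hγw
    rwa [star_mul, star_map_one] at this
  have h : ∀ a, ∃ y, γ y = w * a * star w := fun a => by
    obtain ⟨y, hy⟩ := hr (w * a * star w)
    refine ⟨y, hy.trans ?_⟩
    rw [mul_assoc, mul_assoc (w * a), hwγ, mul_assoc, ← mul_assoc, hγw, ← mul_assoc]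
  choose F hF using h
  refine ⟨{ toFun := F
            map_smul' := fun c a => hi ?_
            map_zero' := hi ?_
            map_add' := fun a b => hi ?_
            map_mul' := fun a b => hi ?_
            map_star' := fun a => hi ?_ }, hF⟩
  · simp [hF]
  · simp [hF]
  · simp [hF, mul_add, add_mul]
  · rw [map_mul, hF, hF, hF]
    calc w * (a * b) * star w = w * a * 1 * b * star w := by simp only [mul_assoc, one_mul]
      _ = _ := by rw [← hw]; simp only [mul_assoc]
  · rw [map_star, hF, hF]
    simp only [star_mul, star_star, mul_assoc]

/-- A simple, faithful and doubly faithful endomorphism has an inverse. -/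
theorem exists_inverse [TopologicalSpace.SeparableSpace H]
    (hN : ∀ a, IsProperlyInfinite (N.alg a)) (hγ : IsLT γ) (hi : Function.Injective γ)
    (hr : ∀ x : N.quasilocal, ∃ y, γ y = γ 1 * x * γ 1) (hd : IsDoublyFaithful γ) :
    ∃ (δ : NetEndo N) (w : N.quasilocal), IsLT δ ∧
      UnitaryEquiv (NonUnitalStarAlgHom.id ℂ N.quasilocal) (γ.comp δ) w := by
  -- For each `o`, transport of `γ` to `o` and an isometry `u` of the local algebra give `w = v⁺ u`
  -- and a `δ` localized in `o`. Two such `δ` are equivalent through the preimage of `w' w⁺` under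
  -- `γ`, whence transportability.
  have key : ∀ o, ∃ (δ : NetEndo N) (w : N.quasilocal), LocalizedIn δ o ∧
      star w * w = 1 ∧ γ 1 * w = w ∧ ∀ a, γ (δ a) = w * a * star w := by
    intro o
    obtain ⟨γ₁, v, hγ₁, hv⟩ := hγ.2 o
    obtain ⟨u, hu, huu, hγu⟩ := hd.exists_isometry hN hγ₁ hv
    have hw : star (star v * u) * (star v * u) = 1 := by
      rw [star_mul, star_star, mul_assoc, ← mul_assoc v, hv.mul_star_self, hγu, huu]
    have hγw : γ 1 * (star v * u) = star v * u := by
      rw [← mul_assoc, hv.toIntertwines.star.left]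
    obtain ⟨δ, hδ⟩ := exists_lift hi hr hw hγw
    refine ⟨δ, star v * u, fun c hc a ha => hi ?_, hw, hγw, hδ⟩
    have hua : u * a = a * u := ObservableNet.commute_of_perp hc.symm hu ha
    rw [map_mul, hδ, hδ, mul_one]
    calc star v * u * a * star (star v * u)
        = star v * (a * u) * star (star v * u) := by rw [mul_assoc (star v), hua]
      _ = star v * (a * γ₁ 1) * u * star (star v * u) := by
        nth_rw 1 [← hγu]; simp only [mul_assoc]
      _ = γ a * (star v * u * star (star v * u)) := by
        rw [← hγ₁.apply_eq hc ha, hv.toIntertwines.star.comm]; simp only [mul_assoc]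
  obtain ⟨δ, w, hδ, hw, hγw, hδw⟩ := key (remoteCone 0)
  have hone : ∀ {w : N.quasilocal}, star w * w = 1 → ∀ x, star w * (w * x) = x := fun hw x => by
    rw [← mul_assoc, hw, one_mul]
  refine ⟨δ, w, ⟨⟨_, hδ⟩, fun o => ?_⟩, ⟨⟨mul_one _, ?_, fun a => ?_⟩, hw, ?_⟩⟩
  · obtain ⟨δ', w', hδ', hw', hγw', hδw'⟩ := key o
    have hwγ : star w * γ 1 = star w := by
      have := congrArg star hγw
      rwa [star_mul, star_map_one] at this
    obtain ⟨t, ht⟩ := hr (w' * star w)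
    have ht' : γ t = w' * star w := by
      rw [ht, ← mul_assoc, hγw', mul_assoc, hwγ]
    refine ⟨δ', t, hδ', ⟨⟨hi ?_, hi ?_, fun a => hi ?_⟩, hi ?_, hi ?_⟩⟩
    · rw [map_mul, ht', hδw, mul_one, mul_assoc, hone hw]
    · rw [map_mul, ht', hδw', mul_one, mul_assoc, hone hw']
    · rw [map_mul, map_mul, ht', hδw, hδw']
      simp only [mul_assoc, hone hw, hone hw']
    · rw [map_mul, map_star, ht', hδw]
      simp only [star_mul, star_star, mul_assoc, hone hw', mul_one]
    · rw [map_mul, map_star, ht', hδw']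
      simp only [star_mul, star_star, mul_assoc, hone hw, mul_one]
  · change γ (δ 1) * w = w
    rw [hδw, mul_one, mul_assoc, hw, mul_one]
  · change w * a = γ (δ a) * w
    rw [hδw, mul_assoc, hw, mul_one]
  · change w * star w = γ (δ 1)
    rw [hδw, mul_one]

/-! ### Half conjugates from simple endomorphisms -/

/-- The (anti)symmetrizers of adjacent groups of factors do not annihilate each other. -/
theorem map_altProj_eq_zero (hf : IsLT f) (b : Bool) {e : ℕ}
    (h : altProj hf b (e + 1) * f (altProj hf b (e + 1)) = 0) : f (altProj hf b (e + 1)) = 0 := by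
  have h1 := sandwich_altProj hf b e
  have h2 := altProj_succ_eq hf b (e + 1)
  -- The projection on `e + 2` factors absorbs both annihilating ones. With `q = f (altProj hf b (e
  -- + 1))`, `y` the sandwich of the symmetry by `q`, and `s` the sign, `h1` and `h2` become `q + e
  -- s y = 0` and `q + (e + 1) s y = 0`, so `y` and `q` vanish.
  have h3 : altProj hf b (e + 1 + 1) = 0 := by
    rw [← altProj_mul_altProj_succ hf b (e + 1), ← map_altProj_mul_altProj_succ hf b (e + 1),
      ← mul_assoc, h, zero_mul]
  rw [mul_assoc, h, mul_zero, smul_zero] at h1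
  rw [h3, smul_zero] at h2
  generalize f (altProj hf b (e + 1)) * eps f f * f (altProj hf b (e + 1)) = y at h1 h2
  push_cast at h2
  rw [add_mul, one_mul, add_smul, ← add_assoc, ← h1, zero_add] at h2
  have h4 : y = 0 := by
    refine (smul_eq_zero.1 h2.symm).resolve_left fun h0 => ?_
    have := permSign_mul_self b
    rw [h0, zero_mul] at this
    exact zero_ne_one this
  rw [h4, smul_zero, add_zero] at h1
  exact h1.symm

/-- An irreducible endomorphism whose statistics gives a simple, faithful and doubly faithful
endomorphism has a half conjugate. -/
theorem exists_halfConj [TopologicalSpace.SeparableSpace H] [Nontrivial H]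
    (hN : ∀ a, IsProperlyInfinite (N.alg a)) (hf : IsLT f)
    (hirr : ∀ t, Intertwines f f t → ∃ c : ℂ, t = c • f 1) (hγ : IsLT γ) {c : ℂ}
    (hc : c * c = 1) (hcs : star c = c) (hs : eps γ γ = c • γ (γ 1)) (hi : Function.Injective γ)
    (hd : IsDoublyFaithful γ) {d : ℕ} (hd1 : 1 ≤ d) {b : Bool} {v : N.quasilocal}
    (hv : Intertwines γ (npow f d) v) (hvv : star v * v = γ 1) (hv' : v * star v = altProj hf b d) :
    ∃ g r r', HalfConj f g r r' := by
  have hr := exists_map_eq hN hγ hc hcs hs hi hd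
  obtain ⟨δ, w, hδ, hw⟩ := exists_inverse hN hγ hi hr hd
  obtain ⟨e, rfl⟩ : ∃ e, d = e + 1 := ⟨d - 1, by omega⟩
  have hγf := eps_intertwines hγ hf
  have hfγ := eps_intertwines hf hγ
  -- This arrow compares the two embeddings of `γ` next to a factor `f` in `f ^ (e + 2)`, on the
  -- last and on the first `e + 1` factors.
  have hX : Intertwines (f.comp γ) (γ.comp f) (star v * f v) := by
    have h1 : Intertwines (f.comp γ) ((npow f (e + 1)).comp f) (f v) := by
      have := hv.map f
      rwa [← npow_succ'] at this
    have h2 := (hv.star.mul_unit f).mul h1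
    have h3 : npow f (e + 1) (f 1) * f v = f v := by
      rw [show npow f (e + 1) (f 1) = f (npow f (e + 1) 1) from npow_succ_apply' _ _, ← map_mul,
        hv.left]
    rw [mul_assoc, h3] at h2
    exact h2
  have hX0 : star v * f v ≠ 0 := by
    intro h0
    have h1 : altProj hf b (e + 1) * f (altProj hf b (e + 1)) = 0 := by
      rw [← hv', map_mul, mul_assoc, ← mul_assoc (star v), h0, zero_mul, mul_zero]
    have h2 := map_altProj_eq_zero hf b h1
    have h3 : f (γ 1) = 0 := by
      have h4 : v = altProj hf b (e + 1) * v := by rw [← hv', mul_assoc, hvv, hv.right]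
      rw [← hvv, h4, map_mul, map_mul, h2, zero_mul, mul_zero]
    have h4 : γ (f 1) = 0 := by
      rw [← eps_mul_eps hγ hf, ← hfγ.right, NonUnitalStarAlgHom.comp_apply, h3, mul_zero, zero_mul]
    have h5 : f 1 = 0 := hi (h4.trans (map_zero γ).symm)
    have h6 : γ 1 = 0 := by
      rw [← hvv, ← hv.left, npow_succ_apply, h5, map_zero, zero_mul, mul_zero]
    have h7 : (1 : N.quasilocal) = 0 := hi (h6.trans (map_zero γ).symm)
    exact zero_ne_one (congrArg Subtype.val h7).symm
  -- Composed with the symmetry, the arrow belongs to `(γ f, γ f)`. As the image of `γ` is a full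
  -- corner, it is `γ t` with `t` in `(f, f)`, a scalar.
  obtain ⟨l, hl⟩ : ∃ l : ℂ, star v * f v = l • eps f γ := by
    have hY := hX.mul hγf
    obtain ⟨t, ht⟩ := hr (star v * f v * eps γ f)
    have h1 : γ t = star v * f v * eps γ f := by
      have e1 : γ 1 * (star v * f v * eps γ f) = star v * f v * eps γ f := by
        rw [← mul_assoc, ← mul_assoc, hv.star.left]
      have e2 : star v * f v * eps γ f * γ 1 = star v * f v * eps γ f := by
        rw [← hY.right, NonUnitalStarAlgHom.comp_apply, mul_assoc, map_mul_one]
      rw [ht, e1, e2]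
    rw [← h1] at hY
    obtain ⟨l, hl⟩ := hirr t ⟨hi (by rw [map_mul]; exact hY.right),
      hi (by rw [map_mul]; exact hY.left), fun a => hi (by rw [map_mul, map_mul]; exact hY.comm a)⟩
    refine ⟨l, ?_⟩
    have h2 : star v * f v * eps γ f * eps f γ = star v * f v := by
      rw [mul_assoc, eps_mul_eps hf hγ]
      exact hX.right
    rw [← h2, ← h1, hl, map_smul, smul_mul_assoc,
      show γ (f 1) * eps f γ = eps f γ from hfγ.left]
  have hl0 : l ≠ 0 := by
    rintro rfl
    exact hX0 (by rw [hl, zero_smul])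
  have hvw : Intertwines (NonUnitalStarAlgHom.id ℂ N.quasilocal) ((npow f (e + 1)).comp δ)
      (v * w) := by
    have h1 := (hv.mul_unit δ).mul hw.toIntertwines
    rw [mul_assoc, show γ (δ 1) * w = w from hw.left] at h1
    exact h1
  -- `v w` is an arrow from `ι` to `f ^ (e + 1) δ`, read as `f` times the conjugate. Moving the last
  -- factor `f` past `δ` gives the other arrow, and `l⁻¹` normalises the conjugate equation.
  refine ⟨(npow f e).comp δ, l⁻¹ • (npow f e (eps f δ) * (v * w)), v * w,
    (hf.npow e).comp hδ, ?_, ?_, ?_⟩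
  · exact (((eps_intertwines hf hδ).map (npow f e)).mul hvw).smul _
  · rw [npow_succ'] at hvw
    exact hvw
  · have h1 := eps_naturality hf isLT_id hf (hγ.comp hδ) (Intertwines.one f) hw.toIntertwines
    rw [eps_id_right hf, map_one_mul, eps_comp_right hf hγ hδ] at h1
    have h2 : w * f 1 * f 1 = w * f 1 := by rw [mul_assoc, map_one_mul]
    have h3 : star v * npow f (e + 1) (eps f δ) = γ (eps f δ) * star v := hv.star.comm _
    rw [map_smul, mul_smul_comm, map_mul, map_mul, star_mul, mul_assoc,
      ← mul_assoc (star v), show f (npow f e (eps f δ)) = npow f (e + 1) (eps f δ) from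
        (npow_succ_apply' _ _).symm, h3, mul_assoc, ← mul_assoc (star v), hl, smul_mul_assoc,
      mul_smul_comm, mul_smul_comm, smul_smul, inv_mul_cancel₀ hl0, one_smul,
      ← mul_assoc (γ (eps f δ)), h1]
    simp only [NonUnitalStarAlgHom.coe_id, id_eq]
    rw [h2, ← mul_assoc, hw.star_mul_self]
    simp

/-! ### Direct sums -/

section Sum

variable {k : ℕ} (F : Fin k → NetEndo N) (w : Fin k → N.quasilocal)
  (hw : ∀ i j, star (w i) * w j = if i = j then 1 else 0)

/-- The direct sum of a finite family. -/
def sumEndo : NetEndo N where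
  toFun a := ∑ i, w i * F i a * star (w i)
  map_smul' c a := by simp [Finset.smul_sum]
  map_zero' := by simp
  map_add' a b := by simp [mul_add, add_mul, Finset.sum_add_distrib]
  map_mul' a b := by
    rw [Finset.sum_mul]
    refine Finset.sum_congr rfl fun i _ => ?_
    rw [Finset.mul_sum, Finset.sum_eq_single i]
    · calc w i * F i (a * b) * star (w i) = w i * F i a * 1 * F i b * star (w i) := by
            rw [map_mul]; simp only [mul_assoc, one_mul]
        _ = _ := by rw [← (hw i i).trans (if_pos rfl)]; simp only [mul_assoc]
    · intro j _ hj
      calc w i * F i a * star (w i) * (w j * F j b * star (w j))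
          = w i * F i a * (star (w i) * w j) * (F j b * star (w j)) := by simp only [mul_assoc]
        _ = 0 := by rw [hw, if_neg hj.symm, mul_zero, zero_mul]
    · simp
  map_star' a := by simp only [star_sum, star_mul, star_star, map_star, mul_assoc]

variable {F w}

theorem sumEndo_apply (a : N.quasilocal) : sumEndo F w hw a = ∑ i, w i * F i a * star (w i) := rfl

theorem sumEndo_mul (a : N.quasilocal) (i : Fin k) : sumEndo F w hw a * w i = w i * F i a := by
  rw [sumEndo_apply, Finset.sum_mul, Finset.sum_eq_single i]
  · rw [mul_assoc, hw, if_pos rfl, mul_one]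
  · intro j _ hj
    rw [mul_assoc, hw, if_neg hj, mul_zero]
  · simp

theorem intertwines_sumEndo (i : Fin k) : Intertwines (F i) (sumEndo F w hw) (w i * F i 1) :=
  ⟨by rw [mul_assoc, map_mul_one], by rw [← mul_assoc, sumEndo_mul, mul_assoc, map_mul_one],
    fun a => by rw [← mul_assoc, sumEndo_mul, mul_assoc, mul_assoc, map_one_mul, map_mul_one]⟩

theorem localizedIn_sumEndo {o : DoubleCone} (hF : ∀ i, LocalizedIn (F i) o)
    (hwo : ∀ i, (w i : H →L[ℂ] H) ∈ N.alg o) : LocalizedIn (sumEndo F w hw) o := by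
  intro a ha x hx
  rw [sumEndo_apply, sumEndo_apply, Finset.mul_sum]
  refine Finset.sum_congr rfl fun i _ => ?_
  rw [(hF i).apply_eq ha hx, ← mul_assoc (w i), ObservableNet.commute_of_perp ha.symm (hwo i) hx]
  simp only [mul_assoc]

end Sum

theorem exists_orthonormal [TopologicalSpace.SeparableSpace H]
    (hN : ∀ a, IsProperlyInfinite (N.alg a)) (o : DoubleCone) (k : ℕ) :
    ∃ w : Fin k → N.quasilocal, (∀ i, (w i : H →L[ℂ] H) ∈ N.alg o) ∧
      ∀ i j, star (w i) * w j = if i = j then 1 else 0 := by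
  obtain ⟨t, htmem, ht⟩ := exists_orthogonal_isometries (hN o)
  refine ⟨fun k => ⟨t k, N.alg_le_quasilocal o (htmem k)⟩, fun i => htmem i, fun i j => ?_⟩
  have := ht i j
  by_cases hij : i = j
  · rw [if_pos (by rw [hij])] at this
    rw [if_pos hij]
    exact Subtype.ext this
  · rw [if_neg fun h => hij (Fin.ext h)] at this
    rw [if_neg hij]
    exact Subtype.ext this

theorem _root_.Superselection.DoubleCone.exists_superset {k : ℕ} (o : Fin k → DoubleCone) :
    ∃ c : DoubleCone, ∀ i, (o i).1 ⊆ c.1 := by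
  induction k with
  | zero => exact ⟨remoteCone 0, fun i => i.elim0⟩
  | succ k ih =>
    obtain ⟨c, hc⟩ := ih fun i => o i.succ
    obtain ⟨c', hc', h0⟩ := c.exists_union_subset (o 0)
    exact ⟨c', fun i => Fin.cases h0 (fun i => (hc i).trans hc') i⟩

/-- In the new cone the summands are recombined by isometries `w'` of the algebra there, and the
transporter is `∑ w' i * u i * star (w i)`. -/
theorem isLT_sumEndo [TopologicalSpace.SeparableSpace H]
    (hN : ∀ a, IsProperlyInfinite (N.alg a)) {k : ℕ} {F : Fin k → NetEndo N}
    (hF : ∀ i, IsLT (F i)) {w : Fin k → N.quasilocal}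
    (hw : ∀ i j, star (w i) * w j = if i = j then 1 else 0) {o : DoubleCone}
    (hFo : ∀ i, LocalizedIn (F i) o) (hwo : ∀ i, (w i : H →L[ℂ] H) ∈ N.alg o) :
    IsLT (sumEndo F w hw) := by
  refine ⟨⟨o, localizedIn_sumEndo hw hFo hwo⟩, fun o' => ?_⟩
  have h := fun i => (hF i).2 o'
  choose G u hG hu using h
  obtain ⟨w', hwo', hw'⟩ := exists_orthonormal hN o' k
  have hsum : ∀ (a b : Fin k → N.quasilocal) {w w' w'' : Fin k → N.quasilocal},
      (∀ i j, star (w' i) * w' j = if i = j then 1 else 0) →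
      (∑ i, w i * a i * star (w' i)) * ∑ i, w' i * b i * star (w'' i) =
        ∑ i, w i * (a i * b i) * star (w'' i) := by
    intro a b w w' w'' hw
    rw [Finset.sum_mul]
    refine Finset.sum_congr rfl fun i _ => ?_
    rw [Finset.mul_sum, Finset.sum_eq_single i]
    · calc _ = w i * a i * (star (w' i) * w' i) * b i * star (w'' i) := by simp only [mul_assoc]
        _ = _ := by rw [hw, if_pos rfl, mul_one]; simp only [mul_assoc]
    · intro j _ hj
      calc _ = w i * a i * (star (w' i) * w' j) * (b j * star (w'' j)) := by simp only [mul_assoc]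
        _ = 0 := by rw [hw, if_neg hj.symm, mul_zero, zero_mul]
    · simp
  have hstar : star (∑ i, w' i * u i * star (w i)) = ∑ i, w i * star (u i) * star (w' i) := by
    simp only [star_sum, star_mul, star_star, mul_assoc]
  refine ⟨sumEndo G w' hw', ∑ i, w' i * u i * star (w i), localizedIn_sumEndo hw' hG hwo',
    ⟨⟨?_, ?_, fun a => ?_⟩, ?_, ?_⟩⟩
  · rw [sumEndo_apply, hsum _ _ hw]
    simp only [(hu _).right]
  · rw [sumEndo_apply, hsum _ _ hw']
    simp only [(hu _).left]
  · rw [sumEndo_apply, sumEndo_apply, hsum _ _ hw, hsum _ _ hw']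
    simp only [(hu _).comm]
  · rw [hstar, sumEndo_apply, hsum _ _ hw']
    simp only [(hu _).star_mul_self]
  · rw [hstar, sumEndo_apply, hsum _ _ hw]
    simp only [(hu _).mul_star_self]

/-- Finite direct sums of endomorphisms with half conjugates have half conjugates. -/
theorem exists_halfConj_of_sum [TopologicalSpace.SeparableSpace H]
    (hN : ∀ a, IsProperlyInfinite (N.alg a)) {k : ℕ} {F G : Fin k → NetEndo N}
    {r r' : Fin k → N.quasilocal} (h : ∀ i, HalfConj (F i) (G i) (r i) (r' i))
    {W : Fin k → N.quasilocal} (hW : ∀ i, Intertwines (F i) f (W i))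
    (hsum : ∑ i, W i * star (W i) = f 1) : ∃ g s s', HalfConj f g s s' := by
  have ho := fun i => (h i).lt.1
  choose o ho using ho
  obtain ⟨c, hc⟩ := DoubleCone.exists_superset o
  obtain ⟨w, hwo, hw⟩ := exists_orthonormal hN c k
  have hlt := isLT_sumEndo hN (fun i => (h i).lt) hw (fun i => (ho i).mono (hc i)) hwo
  have hint := fun i => intertwines_sumEndo (F := G) hw i
  -- The arrows of the summands are added up. In the conjugate equation the cross terms vanish by
  -- orthogonality of the `w i`, and the diagonal terms are `W i * star (W i)`.
  refine ⟨sumEndo G w hw, ∑ i, w i * (G i (W i) * r i), ∑ i, W i * (F i (w i) * r' i), hlt,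
    Intertwines.sum _ fun i _ => ?_, Intertwines.sum _ fun i _ => ?_, ?_⟩
  · have h1 := ((hint i).mul_unit f).mul (((hW i).map (G i)).mul (h i).arrow)
    have h2 : w i * G i 1 * G i (f 1) * (G i (W i) * r i) = w i * (G i (W i) * r i) := by
      rw [mul_assoc, mul_assoc, ← mul_assoc (G i (f 1)), ← map_mul, (hW i).left, map_one_mul_assoc]
    rwa [h2] at h1
  · have h1 := ((hW i).mul_unit (sumEndo G w hw)).mul (((hint i).map (F i)).mul (h i).arrow')
    have h2 : W i * F i (sumEndo G w hw 1) * (F i (w i * G i 1) * r' i) =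
        W i * (F i (w i) * r' i) := by
      have h3 : F i (G i 1) * r' i = r' i := (h i).arrow'.left
      rw [mul_assoc, ← mul_assoc (F i _) (F i _), ← map_mul, (hint i).left, map_mul, mul_assoc, h3]
    rwa [h2] at h1
  · rw [star_sum, map_sum, Finset.sum_mul, ← hsum]
    refine Finset.sum_congr rfl fun i _ => ?_
    rw [Finset.mul_sum, Finset.sum_eq_single i]
    · have h1 := (hW i).star.comm (w i * (G i (W i) * r i))
      have h2 : F i (star (w i)) * F i (w i * (G i (W i) * r i)) = F i (G i (W i)) * F i (r i) := by
        rw [← map_mul, ← mul_assoc, hw, if_pos rfl, one_mul, map_mul]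
      calc _ = star (r' i) * F i (star (w i)) * (star (W i) * f (w i * (G i (W i) * r i))) := by
            simp only [star_mul, map_star, mul_assoc]
        _ = star (r' i) * (F i (star (w i)) * F i (w i * (G i (W i) * r i))) * star (W i) := by
            rw [h1]; simp only [mul_assoc]
        _ = W i * (star (r' i) * F i (r i)) * star (W i) := by
            rw [h2, ← mul_assoc, (h i).star_arrow'_comm, mul_assoc (W i)]
        _ = W i * star (W i) := by rw [(h i).zigzag, (hW i).right]
    · intro j _ hj
      have h1 := (hW i).star.comm (w j * (G j (W j) * r j))
      have h2 : F i (star (w i)) * F i (w j * (G j (W j) * r j)) = 0 := by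
        rw [← map_mul, ← mul_assoc, hw, if_neg hj.symm, zero_mul, map_zero]
      calc _ = star (r' i) * F i (star (w i)) * (star (W i) * f (w j * (G j (W j) * r j))) := by
            simp only [star_mul, map_star, mul_assoc]
        _ = star (r' i) * (F i (star (w i)) * F i (w j * (G j (W j) * r j))) * star (W i) := by
            rw [h1]; simp only [mul_assoc]
        _ = 0 := by rw [h2, mul_zero, zero_mul]
    · simp

end NetEndo
end Inverses

/-! ### Frames of bimodules -/

section Frames

variable {N : ObservableNet H}

/-- The matrix of an element with respect to two frames. -/
def frameMatrix {m n : ℕ} (W' : Fin m → N.quasilocal) (t : N.quasilocal)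
    (W : Fin n → N.quasilocal) : Matrix (Fin m) (Fin n) N.quasilocal :=
  Matrix.of fun i j => star (W' i) * t * W j

/-- The element given by a matrix and two frames. -/
def frameSum {m n : ℕ} (W' : Fin m → N.quasilocal) (T : Matrix (Fin m) (Fin n) N.quasilocal)
    (W : Fin n → N.quasilocal) : N.quasilocal :=
  ∑ i, ∑ j, W' i * T i j * star (W j)

section frameMatrix

variable {m n p : ℕ} {W : Fin n → N.quasilocal} {W' : Fin m → N.quasilocal}
  {W'' : Fin p → N.quasilocal} {s t : N.quasilocal}

theorem frameMatrix_apply (i : Fin m) (j : Fin n) :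
    frameMatrix W' t W i j = star (W' i) * t * W j := rfl

theorem frameMatrix_mul :
    frameMatrix W'' s W' * frameMatrix W' t W =
      frameMatrix W'' (s * (∑ i, W' i * star (W' i)) * t) W := by
  ext1 i j
  simp only [Matrix.mul_apply, frameMatrix_apply, Finset.mul_sum, Finset.sum_mul]
  refine Finset.sum_congr rfl fun k _ => ?_
  simp only [mul_assoc]

theorem frameMatrix_conjTranspose : (frameMatrix W' t W)ᴴ = frameMatrix W (star t) W' := by
  ext1 i j
  simp only [Matrix.conjTranspose_apply, frameMatrix_apply, star_mul, star_star, mul_assoc]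

theorem frameMatrix_smul (c : ℂ) : frameMatrix W' (c • t) W = c • frameMatrix W' t W := by
  ext1 i j
  simp only [Matrix.smul_apply, frameMatrix_apply, mul_smul_comm, smul_mul_assoc]

theorem frameMatrix_sum {ι : Type*} (F : Finset ι) (t : ι → N.quasilocal) :
    frameMatrix W' (∑ i ∈ F, t i) W = ∑ i ∈ F, frameMatrix W' (t i) W := by
  ext1 i j
  simp only [Matrix.sum_apply, frameMatrix_apply, Finset.mul_sum, Finset.sum_mul]

theorem frameSum_frameMatrix : frameSum W' (frameMatrix W' t W) W =
    (∑ i, W' i * star (W' i)) * t * ∑ j, W j * star (W j) := by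
  rw [frameSum, Finset.sum_mul, Finset.sum_mul]
  refine Finset.sum_congr rfl fun i _ => ?_
  rw [Finset.mul_sum]
  refine Finset.sum_congr rfl fun j _ => ?_
  simp only [frameMatrix_apply, mul_assoc]

theorem frameSum_mul_frameSum (h : ∀ i j, star (W' i) * W' j = if i = j then 1 else 0)
    (S : Matrix (Fin p) (Fin m) N.quasilocal) (T : Matrix (Fin m) (Fin n) N.quasilocal) :
    frameSum W'' S W' * frameSum W' T W = frameSum W'' (S * T) W := by
  have h1 : ∀ k, star (W' k) * frameSum W' T W = ∑ j, T k j * star (W j) := fun k => by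
    simp only [frameSum, Finset.mul_sum, ← mul_assoc, h]
    simp
  nth_rw 1 [frameSum]
  simp only [Finset.sum_mul, mul_assoc, h1]
  refine Finset.sum_congr rfl fun i _ => ?_
  simp only [Matrix.mul_apply, Finset.mul_sum, Finset.sum_mul]
  rw [Finset.sum_comm]
  simp only [mul_assoc]

theorem star_frameSum (T : Matrix (Fin m) (Fin n) N.quasilocal) :
    star (frameSum W' T W) = frameSum W Tᴴ W' := by
  simp only [frameSum, star_sum, star_mul, star_star, Matrix.conjTranspose_apply]
  rw [Finset.sum_comm]
  simp only [mul_assoc]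

theorem mul_frameSum_mul (a b : N.quasilocal) (T : Matrix (Fin m) (Fin n) N.quasilocal) :
    a * frameSum W' T W * b = ∑ i, ∑ j, (a * W' i) * T i j * (star (W j) * b) := by
  simp only [frameSum, Finset.mul_sum, Finset.sum_mul, mul_assoc]

end frameMatrix

/-- A realisation of the bimodule `ρ` by an endomorphism `f`. -/
structure IsFrame (ρ : Bimodule N) (f : NetEndo N) (W : Fin ρ.n → N.quasilocal) : Prop where
  hom : ∀ a, ρ.hom a = frameMatrix W (f a) W
  sum : ∑ i, W i * star (W i) = f 1
  left : ∀ i, f 1 * W i = W i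

open Bimodule NetEndo

namespace IsFrame

variable {ρ σ ρ₁ σ₁ : Bimodule N} {f g f₁ g₁ : NetEndo N} {W : Fin ρ.n → N.quasilocal}
  {V : Fin σ.n → N.quasilocal} {W₁ : Fin ρ₁.n → N.quasilocal} {V₁ : Fin σ₁.n → N.quasilocal}
  {s t : N.quasilocal}

theorem star_mul_map_one (h : IsFrame ρ f W) (i : Fin ρ.n) : star (W i) * f 1 = star (W i) := by
  have := congrArg star (h.left i)
  rwa [star_mul, star_map_one] at this

theorem unit_eq (h : IsFrame ρ f W) : ρ.unit = frameMatrix W (f 1) W := h.hom 1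

theorem hom_apply (h : IsFrame ρ f W) (a : N.quasilocal) (i j : Fin ρ.n) :
    ρ.hom a i j = star (W i) * f a * W j := by rw [h.hom]; rfl

theorem isArrow (h : IsFrame ρ f W) (h' : IsFrame σ g V) (ht : Intertwines f g t) :
    IsArrow ρ σ (frameMatrix V t W) := by
  refine ⟨?_, ?_, fun a => ?_⟩
  · rw [h.unit_eq, frameMatrix_mul, h.sum, ht.right, ht.right]
  · rw [h'.unit_eq, frameMatrix_mul, h'.sum, mul_assoc, ht.left, ht.left]
  · rw [h.hom, h'.hom, frameMatrix_mul, frameMatrix_mul, h'.sum, h.sum, ht.right, map_mul_one,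
      ht.comm]

theorem map_eq (h : IsFrame ρ f W) (a : N.quasilocal) : f a = frameSum W (ρ.hom a) W := by
  rw [h.hom, frameSum_frameMatrix, h.sum, map_one_mul, map_mul_one]

theorem star_mul_map (h : IsFrame ρ f W) (a : N.quasilocal) (i : Fin ρ.n) :
    star (W i) * f a = ∑ j, ρ.hom a i j * star (W j) := by
  rw [← map_mul_one, ← h.sum, Finset.mul_sum, Finset.mul_sum]
  refine Finset.sum_congr rfl fun j _ => ?_
  rw [h.hom_apply]
  simp only [mul_assoc]

theorem frameSum_mul_map (h : IsFrame ρ f W) {m : ℕ} (t : Fin m → N.quasilocal)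
    (T : Matrix (Fin m) (Fin ρ.n) N.quasilocal) (a : N.quasilocal) :
    frameSum t T W * f a = frameSum t (T * ρ.hom a) W := by
  rw [frameSum, frameSum, Finset.sum_mul]
  refine Finset.sum_congr rfl fun i _ => ?_
  simp only [Finset.sum_mul, mul_assoc, h.star_mul_map, Matrix.mul_apply, Finset.mul_sum]
  rw [Finset.sum_comm]

theorem frameSum_mul_frameSum (h : IsFrame ρ f W) {m p : ℕ} (t : Fin m → N.quasilocal)
    (t' : Fin p → N.quasilocal) (S : Matrix (Fin m) (Fin ρ.n) N.quasilocal)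
    (T : Matrix (Fin ρ.n) (Fin p) N.quasilocal) :
    frameSum t S W * frameSum W T t' = frameSum t (S * (ρ.unit * T)) t' := by
  have h1 : ∀ k, star (W k) * frameSum W T t' = ∑ j, (ρ.unit * T) k j * star (t' j) := fun k => by
    have h2 : ∀ l, star (W k) * W l = ρ.unit k l := fun l => by
      rw [h.unit_eq, frameMatrix_apply, h.star_mul_map_one]
    simp only [frameSum, Finset.mul_sum, ← mul_assoc, h2, Matrix.mul_apply, Finset.sum_mul]
    rw [Finset.sum_comm]
  generalize ρ.unit * T = Y at h1 ⊢
  conv_rhs => rw [frameSum]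
  rw [frameSum, Finset.sum_mul]
  refine Finset.sum_congr rfl fun i _ => ?_
  simp only [Finset.sum_mul, mul_assoc, h1]
  simp only [Matrix.mul_apply, Finset.mul_sum, Finset.sum_mul, mul_assoc]
  rw [Finset.sum_comm]

theorem frameMatrix_injective (h : IsFrame ρ f W) (h' : IsFrame σ g V) (ht : g 1 * t * f 1 = t)
    (hs : g 1 * s * f 1 = s) (he : frameMatrix V t W = frameMatrix V s W) : t = s := by
  have := congrArg (fun T => frameSum V T W) he
  simpa only [frameSum_frameMatrix, h.sum, h'.sum, ht, hs] using this

/-- `frameSum` inverts `frameMatrix`, because `T = σ(1) T ρ(1)` and the matrices `W i⁺ W j` and `V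
i⁺ V j` are the units of the two bimodules. -/
theorem exists_intertwiner (h : IsFrame ρ f W) (h' : IsFrame σ g V)
    {T : Matrix (Fin σ.n) (Fin ρ.n) N.quasilocal} (hT : IsArrow ρ σ T) :
    ∃ t, Intertwines f g t ∧ T = frameMatrix V t W := by
  have hentry : ∀ i j, ∑ k, ∑ l, star (V i) * V k * T k l * (star (W l) * W j) = T i j := by
    intro i j
    have h1 : ∀ i k, star (V i) * V k = σ.unit i k := fun i k => by
      rw [h'.unit_eq, frameMatrix_apply, h'.star_mul_map_one]
    have h2 : ∀ l j, star (W l) * W j = ρ.unit l j := fun i k => by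
      rw [h.unit_eq, frameMatrix_apply, h.star_mul_map_one]
    simp only [h1, h2]
    have h3 : T = σ.unit * T * ρ.unit := by rw [hT.2.1, hT.1]
    nth_rw 2 [h3]
    rw [Matrix.mul_apply, Finset.sum_comm]
    refine Finset.sum_congr rfl fun l _ => ?_
    rw [Matrix.mul_apply, Finset.sum_mul]
  have hmat : T = frameMatrix V (frameSum V T W) W := by
    ext1 i j
    rw [frameMatrix_apply, mul_frameSum_mul, hentry]
  refine ⟨frameSum V T W, ⟨?_, ?_, fun a => ?_⟩, hmat⟩
  · simp only [frameSum, Finset.sum_mul, mul_assoc, h.star_mul_map_one]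
  · simp only [frameSum, Finset.mul_sum, ← mul_assoc, h'.left]
  · have h1 := hT.2.2 a
    have e1 : frameSum V (T * ρ.hom a) W = frameSum V T W * f a := by
      nth_rw 1 [hmat]
      rw [h.hom, frameMatrix_mul, frameSum_frameMatrix, h.sum, h'.sum]
      have e2 : g 1 * frameSum V T W = frameSum V T W := by
        simp only [frameSum, Finset.mul_sum, ← mul_assoc, h'.left]
      rw [mul_assoc _ (f 1), map_one_mul, ← mul_assoc, e2, mul_assoc, map_mul_one]
    have e3 : frameSum V (σ.hom a * T) W = g a * frameSum V T W := by
      nth_rw 1 [hmat]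
      rw [h'.hom, frameMatrix_mul, frameSum_frameMatrix, h.sum, h'.sum]
      have e2 : frameSum V T W * f 1 = frameSum V T W := by
        simp only [frameSum, Finset.sum_mul, mul_assoc, h.star_mul_map_one]
      rw [map_mul_one, ← mul_assoc, map_one_mul, mul_assoc, e2]
    rw [← e1, h1, e3]

theorem isIsometry (h : IsFrame ρ f W) (h' : IsFrame σ g V) (ht : Intertwines f g t)
    (ht' : star t * t = f 1) : IsIsometry ρ σ (frameMatrix V t W) := by
  refine ⟨h.isArrow h' ht, ?_⟩
  rw [frameMatrix_conjTranspose, frameMatrix_mul, h'.sum, mul_assoc, ht.left, ht', h.unit_eq]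

theorem isUnitary (h : IsFrame ρ f W) (h' : IsFrame σ g V) (ht : UnitaryEquiv f g t) :
    IsUnitary ρ σ (frameMatrix V t W) := by
  refine ⟨h.isIsometry h' ht.toIntertwines ht.star_mul_self, ?_⟩
  rw [frameMatrix_conjTranspose, frameMatrix_mul, h.sum, ht.right, ht.mul_star_self, h'.unit_eq]

theorem exists_isometry (h : IsFrame ρ f W) (h' : IsFrame σ g V)
    {T : Matrix (Fin σ.n) (Fin ρ.n) N.quasilocal} (hT : IsIsometry ρ σ T) :
    ∃ t, Intertwines f g t ∧ star t * t = f 1 ∧ T = frameMatrix V t W := by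
  obtain ⟨t, ht, rfl⟩ := h.exists_intertwiner h' hT.1
  refine ⟨t, ht, ?_, rfl⟩
  have h1 := hT.2
  rw [frameMatrix_conjTranspose, frameMatrix_mul, h'.sum, mul_assoc, ht.left, h.unit_eq] at h1
  refine h.frameMatrix_injective h ?_ ?_ h1
  · rw [mul_assoc, mul_assoc, ht.right, ← mul_assoc, ht.star.left]
  · rw [map_mul_one, map_mul_one]

theorem exists_unitary (h : IsFrame ρ f W) (h' : IsFrame σ g V)
    {T : Matrix (Fin σ.n) (Fin ρ.n) N.quasilocal} (hT : IsUnitary ρ σ T) :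
    ∃ t, UnitaryEquiv f g t ∧ T = frameMatrix V t W := by
  obtain ⟨t, ht, ht', rfl⟩ := h.exists_isometry h' hT.1
  refine ⟨t, ⟨ht, ht', ?_⟩, rfl⟩
  have h1 := hT.2
  rw [frameMatrix_conjTranspose, frameMatrix_mul, h.sum, ht.right, h'.unit_eq] at h1
  refine h'.frameMatrix_injective h' ?_ ?_ h1
  · rw [← mul_assoc, ht.left, mul_assoc, ht.star.right]
  · rw [map_mul_one, map_mul_one]

end IsFrame

/-! ### Frames of tensor products -/

/-- The frame of a tensor product. -/
def tensorFrame {m n : ℕ} (f : NetEndo N) (W : Fin n → N.quasilocal) (V : Fin m → N.quasilocal) :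
    Fin (m * n) → N.quasilocal :=
  fun i => f (V (finProdFinEquiv.symm i).1) * W (finProdFinEquiv.symm i).2

theorem tensorFrame_apply {m n : ℕ} (f : NetEndo N) (W : Fin n → N.quasilocal)
    (V : Fin m → N.quasilocal) (i : Fin m) (j : Fin n) :
    tensorFrame f W V (finProdFinEquiv (i, j)) = f (V i) * W j := by
  simp [tensorFrame]

theorem finProdFinEquiv_assoc {m n p : ℕ} (i : Fin m) (j : Fin n) (k : Fin p) :
    Fin.cast (Nat.mul_assoc m n p).symm (finProdFinEquiv (i, finProdFinEquiv (j, k))) =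
      finProdFinEquiv (finProdFinEquiv (i, j), k) := by
  ext
  simp only [Fin.val_cast, finProdFinEquiv_apply_val]
  ring

theorem tensorFrame_assoc {m n p : ℕ} (f g : NetEndo N) (W : Fin p → N.quasilocal)
    (V : Fin n → N.quasilocal) (U : Fin m → N.quasilocal) (i : Fin (m * (n * p))) :
    tensorFrame f W (tensorFrame g V U) (Fin.cast (Nat.mul_assoc m n p).symm i) =
      tensorFrame (f.comp g) (tensorFrame f W V) U i := by
  obtain ⟨⟨i, j⟩, rfl⟩ := finProdFinEquiv.surjective i
  obtain ⟨⟨j, k⟩, rfl⟩ := finProdFinEquiv.surjective j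
  rw [finProdFinEquiv_assoc, tensorFrame_apply, tensorFrame_apply, tensorFrame_apply,
    tensorFrame_apply, map_mul, mul_assoc]
  rfl

theorem recast_frameMatrix {m m' n n' : ℕ} (hm : m = m') (hn : n = n')
    (W' : Fin m → N.quasilocal) (t : N.quasilocal) (W : Fin n → N.quasilocal) :
    recast hm hn (frameMatrix W' t W) =
      frameMatrix (fun i => W' (Fin.cast hm.symm i)) t fun j => W (Fin.cast hn.symm j) := rfl

theorem isFrame_iota : IsFrame (iota N) (NonUnitalStarAlgHom.id ℂ N.quasilocal) fun _ => 1 := by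
  refine ⟨fun a => ?_, by simp, by simp⟩
  ext1 i j
  simp [frameMatrix_apply]

namespace IsFrame

variable {ρ σ ρ₁ σ₁ : Bimodule N} {f g f₁ g₁ : NetEndo N} {W : Fin ρ.n → N.quasilocal}
  {V : Fin σ.n → N.quasilocal} {W₁ : Fin ρ₁.n → N.quasilocal} {V₁ : Fin σ₁.n → N.quasilocal}
  {s t : N.quasilocal}

theorem tensor (h : IsFrame ρ f W) (h' : IsFrame σ g V) :
    IsFrame (tensor ρ σ) (f.comp g) (tensorFrame f W V) := by
  refine ⟨fun a => ?_, ?_, fun i => ?_⟩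
  · ext1 i j
    rw [tensorHom_apply, h.hom_apply, h'.hom_apply, frameMatrix_apply]
    simp only [tensorFrame, map_mul, map_star, star_mul, mul_assoc, NonUnitalStarAlgHom.comp_apply]
  · rw [← finProdFinEquiv.sum_comp, Fintype.sum_prod_type]
    simp only [tensorFrame_apply, star_mul]
    have : ∀ i, ∑ j, f (V i) * W j * (star (W j) * star (f (V i))) = f (V i * star (V i)) :=
      fun i => by
        rw [map_mul, ← map_one_mul f (star (V i)), ← h.sum, Finset.sum_mul, Finset.mul_sum,
          map_star]
        simp only [mul_assoc]
    simp only [this]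
    rw [← map_sum, h'.sum]
    rfl
  · rw [NonUnitalStarAlgHom.comp_apply, tensorFrame, ← mul_assoc, ← map_mul, h'.left]

theorem times (h : IsFrame ρ f W) {m : ℕ} {W₁ : Fin m → N.quasilocal} (ht : Intertwines f f₁ t)
    {p q : ℕ} (V' : Fin p → N.quasilocal) (V : Fin q → N.quasilocal) :
    times ρ (frameMatrix W₁ t W) (frameMatrix V' s V) =
      frameMatrix (tensorFrame f₁ W₁ V') (t * f s) (tensorFrame f W V) := by
  ext1 i j
  simp only [Bimodule.times, Matrix.of_apply, frameMatrix_apply, h.hom_apply, tensorFrame]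
  generalize (finProdFinEquiv.symm i).1 = i₂
  generalize (finProdFinEquiv.symm i).2 = i₁
  generalize (finProdFinEquiv.symm j).1 = j₂
  generalize (finProdFinEquiv.symm j).2 = j₁
  calc _ = star (W₁ i₁) * t * (∑ k, W k * star (W k)) * f (star (V' i₂) * s * V j₂) * W j₁ := by
        simp only [Finset.mul_sum, Finset.sum_mul, mul_assoc]
    _ = star (W₁ i₁) * (t * f (star (V' i₂))) * f s * f (V j₂) * W j₁ := by
        rw [h.sum, mul_assoc _ t, ht.right, map_mul, map_mul]; simp only [mul_assoc]
    _ = _ := by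
        rw [ht.comm, star_mul, map_star]; simp only [mul_assoc]

end IsFrame

/-! ### Existence of frames -/

/-- The homomorphism `a ↦ u f(a) u⁺`. -/
def conjEndo (f : NetEndo N) (u : N.quasilocal) (hu : star u * u = f 1) : NetEndo N where
  toFun a := u * f a * star u
  map_smul' c a := by simp
  map_zero' := by simp
  map_add' a b := by simp [mul_add, add_mul]
  map_mul' a b := by
    calc u * f (a * b) * star u = u * (f a * f 1) * f b * star u := by
          rw [map_mul_one, map_mul]; simp only [mul_assoc]
      _ = _ := by rw [← hu]; simp only [mul_assoc]
  map_star' a := by simp only [star_mul, star_star, map_star, mul_assoc]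

theorem unitaryEquiv_conjEndo {f : NetEndo N} {u : N.quasilocal} (hu : star u * u = f 1)
    (hu1 : u * f 1 = u) : UnitaryEquiv f (conjEndo f u hu) u := by
  have h1 : conjEndo f u hu 1 = u * star u := by change u * f 1 * star u = _; rw [hu1]
  refine ⟨⟨hu1, by rw [h1, mul_assoc, hu, hu1], fun a => ?_⟩, hu, h1.symm⟩
  change u * f a = u * f a * star u * u
  rw [mul_assoc (u * f a), hu, mul_assoc, map_mul_one]

/-- The endomorphism given by a bimodule and orthonormal isometries. -/
def frameEndo (ρ : Bimodule N) (t : Fin ρ.n → N.quasilocal)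
    (ht : ∀ i j, star (t i) * t j = if i = j then 1 else 0) : NetEndo N where
  toFun a := frameSum t (ρ.hom a) t
  map_smul' c a := by simp [frameSum, Finset.smul_sum]
  map_zero' := by simp [frameSum]
  map_add' a b := by simp [frameSum, mul_add, add_mul, Finset.sum_add_distrib]
  map_mul' a b := by
    rw [map_mul, frameSum_mul_frameSum ht]
  map_star' a := by
    simp only [frameSum, star_sum, star_mul, star_star, map_star, Matrix.star_apply]
    rw [Finset.sum_comm]
    simp only [mul_assoc]

theorem frameEndo_apply {ρ : Bimodule N} {t : Fin ρ.n → N.quasilocal}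
    (ht : ∀ i j, star (t i) * t j = if i = j then 1 else 0) (a : N.quasilocal) :
    frameEndo ρ t ht a = frameSum t (ρ.hom a) t := rfl

theorem isIntertwiner_unit (ρ : Morphism N) : Morphism.IsIntertwiner ρ ρ (ρ.hom 1) :=
  ⟨by rw [← map_mul, one_mul], by rw [← map_mul, one_mul],
    fun A => by rw [← map_mul, ← map_mul, one_mul, mul_one]⟩

/-- The frame given by a bimodule and orthonormal isometries. -/
def frameVec (ρ : Bimodule N) (t : Fin ρ.n → N.quasilocal) (i : Fin ρ.n) : N.quasilocal :=
  ∑ k, t k * ρ.hom 1 k i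

theorem isFrame_frameEndo {ρ : Bimodule N} {t : Fin ρ.n → N.quasilocal}
    (ht : ∀ i j, star (t i) * t j = if i = j then 1 else 0) :
    IsFrame ρ (frameEndo ρ t ht) (frameVec ρ t) := by
  have hstar : ∀ i j, star (ρ.hom 1 i j) = ρ.hom 1 j i := fun i j => by
    have h1 : ρ.hom 1 = star (ρ.hom 1) := by rw [← map_star, star_one]
    nth_rw 2 [h1]
    rfl
  obtain ⟨W, hWdef⟩ : ∃ W, W = frameVec ρ t := ⟨_, rfl⟩
  have hWd : ∀ i, W i = ∑ k, t k * ρ.hom 1 k i := fun i => by rw [hWdef]; rfl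
  rw [← hWdef]
  clear hWdef
  have hW : ∀ i, star (W i) = ∑ k, ρ.hom 1 i k * star (t k) := fun i => by
    simp only [hWd, star_sum, star_mul, hstar]
  have h1 : ∀ k (T : Matrix (Fin ρ.n) (Fin ρ.n) N.quasilocal),
      star (t k) * frameSum t T t = ∑ j, T k j * star (t j) := fun k T => by
    simp only [frameSum, Finset.mul_sum, ← mul_assoc, ht]
    simp
  have h2 : ∀ i (T : Matrix (Fin ρ.n) (Fin ρ.n) N.quasilocal),
      star (W i) * frameSum t T t = ∑ j, (ρ.hom 1 * T) i j * star (t j) := fun i T => by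
    rw [hW]
    simp only [Finset.sum_mul, mul_assoc, h1, Matrix.mul_apply]
    simp only [Finset.mul_sum]
    rw [Finset.sum_comm]
  have h3 : ∀ (T : Matrix (Fin ρ.n) (Fin ρ.n) N.quasilocal) i j,
      (∑ k, T i k * star (t k)) * W j = (T * ρ.hom 1) i j := fun T i j => by
    simp only [hWd, Finset.mul_sum, Finset.sum_mul]
    rw [Finset.sum_comm, Matrix.mul_apply]
    refine Finset.sum_congr rfl fun k _ => ?_
    rw [Finset.sum_eq_single k]
    · rw [mul_assoc, ← mul_assoc (star (t k)), ht, if_pos rfl, one_mul]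
    · intro l _ hl
      rw [mul_assoc, ← mul_assoc (star (t k)), ht, if_neg hl.symm, zero_mul, mul_zero]
    · simp
  have hidem : ρ.hom 1 * ρ.hom 1 = ρ.hom 1 := by rw [← map_mul, one_mul]
  -- The frame consists of the orthonormal isometries cut down by the unit of the endomorphism.
  have hWt : ∀ i, W i = frameSum t (ρ.hom 1) t * t i := fun i => by
    rw [hWd, frameSum, Finset.sum_mul]
    refine Finset.sum_congr rfl fun k _ => ?_
    rw [Finset.sum_mul, Finset.sum_eq_single i]
    · rw [mul_assoc, ht, if_pos rfl, mul_one]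
    · intro l _ hl
      rw [mul_assoc, ht, if_neg hl, mul_zero]
    · simp
  refine ⟨fun a => ?_, ?_, fun i => ?_⟩
  · ext1 i j
    rw [frameMatrix_apply, frameEndo_apply, h2, h3, ← map_mul, ← map_mul, one_mul, mul_one]
  · rw [frameEndo_apply]
    have h4 : ∀ i, W i * star (W i) =
        ∑ k, ∑ l, t k * (ρ.hom 1 k i * ρ.hom 1 i l) * star (t l) := fun i => by
      rw [hW, hWd]
      simp only [Finset.sum_mul, Finset.mul_sum, mul_assoc]
      rw [Finset.sum_comm]
    simp only [h4]
    rw [frameSum, Finset.sum_comm]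
    refine Finset.sum_congr rfl fun k _ => ?_
    rw [Finset.sum_comm]
    refine Finset.sum_congr rfl fun l _ => ?_
    nth_rw 3 [← hidem]
    rw [Matrix.mul_apply, Finset.mul_sum, Finset.sum_mul]
  · rw [hWt, frameEndo_apply, ← mul_assoc, frameSum_mul_frameSum ht, hidem]

/-- Localized bimodules have local frames. -/
theorem exists_localFrame [TopologicalSpace.SeparableSpace H]
    (hN : ∀ a, IsProperlyInfinite (N.alg a)) {ρ : Bimodule N} {o : DoubleCone}
    (hρ : ρ.toMorphism.LocalizedIn o) : ∃ (f : NetEndo N) (W : Fin ρ.n → N.quasilocal),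
      IsFrame ρ f W ∧ LocalizedIn f o ∧ ∀ i, (W i : H →L[ℂ] H) ∈ N.alg o := by
  obtain ⟨t, hto, ht⟩ := exists_orthonormal hN o ρ.n
  have hunit : ∀ i j, (ρ.hom 1 i j : H →L[ℂ] H) ∈ N.alg o := fun i j =>
    (isIntertwiner_unit ρ.toMorphism).entry_mem hρ hρ i j
  refine ⟨frameEndo ρ t ht, _, isFrame_frameEndo ht, fun c hc x hx => ?_, fun i => ?_⟩
  · have h5 : ∀ i j, ρ.hom x i j = x * ρ.hom 1 i j := fun i j => by
      have := congrFun (congrFun (hρ c hc x hx) i) j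
      rw [Morphism.amp_mul_apply] at this
      exact Subtype.ext this
    rw [frameEndo_apply, frameEndo_apply, frameSum, frameSum, Finset.mul_sum]
    refine Finset.sum_congr rfl fun i _ => ?_
    rw [Finset.mul_sum]
    refine Finset.sum_congr rfl fun j _ => ?_
    rw [h5, ← mul_assoc (t i), ObservableNet.commute_of_perp hc.symm (hto i) hx]
    simp only [mul_assoc]
  · rw [frameVec, AddSubmonoidClass.coe_finsetSum]
    exact sum_mem fun k _ => mul_mem (hto k) (hunit k i)

theorem map_val_mul {m n p : ℕ} (M : Matrix (Fin m) (Fin n) N.quasilocal)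
    (M' : Matrix (Fin n) (Fin p) N.quasilocal) :
    (M * M').map Subtype.val = M.map Subtype.val * M'.map Subtype.val := by
  ext1 i j
  simp [Matrix.mul_apply]

/-- Bimodules in the category have frames with localized transportable endomorphisms. -/
theorem exists_frame [TopologicalSpace.SeparableSpace H]
    (hN : ∀ a, IsProperlyInfinite (N.alg a)) (ρ : LTBimodule N) :
    ∃ (f : NetEndo N) (W : Fin ρ.n → N.quasilocal), IsFrame ρ.toBimodule f W ∧ IsLT f := by
  obtain ⟨⟨o, ho⟩, htr⟩ := ρ.mem
  obtain ⟨f, W, hW, hf, hWo⟩ := exists_localFrame hN ho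
  refine ⟨f, W, hW, ⟨o, hf⟩, fun o' => ?_⟩
  obtain ⟨τ, hτ, U, hU⟩ := htr o'
  -- The larger cone `c` shows that the entries of `U` belong to the quasilocal algebra. The
  -- localization in `o'` comes from `τ` and from the choice of the isometries `t` in the algebra of
  -- `o'`.
  obtain ⟨c, hoc, hoc'⟩ := o.exists_union_subset o'
  have hmono : ∀ {τ : Morphism N} {o : DoubleCone}, τ.LocalizedIn o → o.1 ⊆ c.1 →
      τ.LocalizedIn c := fun h hoc a ha A hA => h a (ha.mono subset_rfl hoc) A hA
  have hUmem : ∀ i j, U i j ∈ N.alg c := fun i j =>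
    hU.1.entry_mem (hmono hτ hoc') (hmono ho hoc) i j
  let T : Matrix (Fin τ.n) (Fin ρ.n) N.quasilocal :=
    Matrix.of fun i j => ⟨U i j, N.alg_le_quasilocal c (hUmem i j)⟩
  obtain ⟨t, hto, ht⟩ := exists_orthonormal hN o' τ.n
  have hTT : Tᴴ * T = ρ.hom 1 := by
    ext1 i j
    apply Subtype.ext
    have := congrFun (congrFun hU.2.1 i) j
    rw [Matrix.mul_apply] at this ⊢
    rw [AddSubmonoidClass.coe_finsetSum]
    exact this
  have hT1 : T * ρ.hom 1 = T := by
    ext1 i j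
    apply Subtype.ext
    have := congrFun (congrFun hU.1.1 i) j
    rw [Matrix.mul_apply] at this ⊢
    rw [AddSubmonoidClass.coe_finsetSum]
    exact this
  have hsu : star (frameSum t T W) * frameSum t T W = f 1 := by
    have h1 := frameSum_mul_frameSum (W := W) (W'' := W) ht Tᴴ T
    rw [star_frameSum, h1, hTT, hW.map_eq]
  have hu1 : frameSum t T W * f 1 = frameSum t T W := by
    simp only [frameSum, Finset.sum_mul, mul_assoc, hW.star_mul_map_one]
  refine ⟨conjEndo f _ hsu, frameSum t T W, fun a ha x hx => ?_, unitaryEquiv_conjEndo hsu hu1⟩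
  have h1 : ∀ x, conjEndo f _ hsu x = frameSum t (T * ρ.hom x * Tᴴ) t := by
    intro x
    change frameSum t T W * f x * star (frameSum t T W) = _
    rw [hW.frameSum_mul_map, star_frameSum, hW.frameSum_mul_frameSum, ← Matrix.mul_assoc,
      Matrix.mul_assoc T (ρ.hom x), Bimodule.unit, ← map_mul, mul_one]
  have hval : ∀ x, (T * ρ.hom x * Tᴴ).map Subtype.val = τ.hom x := by
    intro x
    have e2 : (Tᴴ).map Subtype.val = Uᴴ := rfl
    rw [map_val_mul, map_val_mul, e2]
    change U * operatorHom ρ.toBimodule x * Uᴴ = _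
    rw [hU.1.2.2, Matrix.mul_assoc, hU.2.2, ← map_mul, mul_one]
  have h5 : ∀ i j, (T * ρ.hom x * Tᴴ) i j = x * (T * ρ.hom 1 * Tᴴ) i j := fun i j => by
    apply Subtype.ext
    have e1 := congrFun (congrFun (hτ a ha x hx) i) j
    rw [Morphism.amp_mul_apply] at e1
    have e2 := congrFun (congrFun (hval x) i) j
    have e3 := congrFun (congrFun (hval 1) i) j
    rw [Matrix.map_apply] at e2 e3
    rw [MulMemClass.coe_mul, e2, e3]
    exact e1
  rw [h1, h1, frameSum, frameSum, Finset.mul_sum]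
  refine Finset.sum_congr rfl fun i _ => ?_
  rw [Finset.mul_sum]
  refine Finset.sum_congr rfl fun j _ => ?_
  rw [h5, ← mul_assoc (t i), ObservableNet.commute_of_perp ha.symm (hto i) hx]
  simp only [mul_assoc]

end Frames

section Dictionary

variable {N : ObservableNet H}

open Bimodule NetEndo

/-! ### Bimodules of multiplicity one -/

/-- The bimodule of multiplicity one given by an endomorphism. -/
def endoBimodule (f : NetEndo N) : Bimodule N := ⟨1, (iotaHom N).comp f⟩

theorem isFrame_endoBimodule (f : NetEndo N) : IsFrame (endoBimodule f) f fun _ => f 1 := by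
  refine ⟨fun a => ?_, ?_, fun _ => map_one_mul f 1⟩
  · ext1 i j
    rw [frameMatrix_apply, star_map_one, map_one_mul, map_mul_one]
    rfl
  · change ∑ i : Fin 1, _ = _
    rw [Fin.sum_univ_one, star_map_one, map_one_mul]

theorem localizedIn_endoBimodule {f : NetEndo N} {o : DoubleCone} (hf : LocalizedIn f o) :
    (endoBimodule f).toMorphism.LocalizedIn o := by
  intro a ha A hA
  ext1 i j
  rw [Morphism.amp_mul_apply]
  exact congrArg Subtype.val (hf a ha ⟨A, N.alg_le_quasilocal a hA⟩ hA)

theorem isUnitaryIntertwiner_of_isUnitary {ρ σ : Bimodule N}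
    {T : Matrix (Fin σ.n) (Fin ρ.n) N.quasilocal} (hT : IsUnitary ρ σ T) :
    Morphism.IsUnitaryIntertwiner ρ.toMorphism σ.toMorphism (T.map Subtype.val) := by
  have hstar : (T.map Subtype.val)ᴴ = Tᴴ.map Subtype.val := rfl
  refine ⟨⟨?_, ?_, fun A => ?_⟩, ?_, ?_⟩
  · exact (map_val_mul T ρ.unit).symm.trans (congrArg (fun M => M.map Subtype.val) hT.1.1.1)
  · exact (map_val_mul σ.unit T).symm.trans (congrArg (fun M => M.map Subtype.val) hT.1.1.2.1)
  · exact (map_val_mul T (ρ.hom A)).symm.trans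
      ((congrArg (fun M => M.map Subtype.val) (hT.1.1.2.2 A)).trans (map_val_mul _ _))
  · rw [hstar]
    exact (map_val_mul Tᴴ T).symm.trans (congrArg (fun M => M.map Subtype.val) hT.1.2)
  · rw [hstar]
    exact (map_val_mul T Tᴴ).symm.trans (congrArg (fun M => M.map Subtype.val) hT.2)

/-- The object of multiplicity one given by a localized transportable endomorphism. -/
def endoObject (f : NetEndo N) (hf : IsLT f) : LTBimodule N where
  toBimodule := endoBimodule f
  mem := by
    refine ⟨hf.1.imp fun o ho => localizedIn_endoBimodule ho, fun o => ?_⟩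
    obtain ⟨g, u, hg, hu⟩ := hf.2 o
    exact ⟨_, localizedIn_endoBimodule hg, _, isUnitaryIntertwiner_of_isUnitary
      ((isFrame_endoBimodule f).isUnitary (isFrame_endoBimodule g) hu)⟩

/-! ### The symmetry in terms of frames -/

section Frames

variable {ρ σ : Bimodule N} {f g : NetEndo N} {W : Fin ρ.n → N.quasilocal}
  {V : Fin σ.n → N.quasilocal}

theorem frameMatrix_mul_theta {p m n : ℕ} (X : Fin p → N.quasilocal) (s : N.quasilocal)
    (Y : Fin (n * m) → N.quasilocal) :
    frameMatrix X s Y * theta N n m =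
      frameMatrix X s fun j => Y (finProdFinEquiv (finProdFinEquiv.symm j).swap) := by
  ext1 i j
  rw [Matrix.mul_apply, Finset.sum_eq_single (finProdFinEquiv (finProdFinEquiv.symm j).swap)]
  · rw [theta, Matrix.of_apply, Equiv.symm_apply_apply, if_pos rfl, mul_one]
    rfl
  · intro k _ hk
    have : finProdFinEquiv.symm k ≠ (finProdFinEquiv.symm j).swap := fun h =>
      hk (by rw [← h, Equiv.apply_symm_apply])
    rw [theta, Matrix.of_apply, if_neg this, mul_zero]
  · simp

theorem IsFrame.isExchange_eq [TopologicalSpace.SeparableSpace H]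
    (hN : ∀ a, IsProperlyInfinite (N.alg a)) (hW : IsFrame ρ f W) (hV : IsFrame σ g V)
    (hf : IsLT f) (hg : IsLT g)
    {E : Matrix (Fin (Bimodule.tensor σ ρ).n) (Fin (Bimodule.tensor ρ σ).n) N.quasilocal}
    (hE : IsExchange ρ σ E) :
    E = frameMatrix (tensorFrame g V W) (eps f g) (tensorFrame f W V) := by
  obtain ⟨o₁, o₂, ρ₁, σ₁, U, T, ho, hρ₁, hσ₁, hU, hT, rfl⟩ := hE
  obtain ⟨f₁, W₁, hW₁, hf₁, hWo⟩ := exists_localFrame hN hρ₁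
  obtain ⟨g₁, V₁, hV₁, hg₁, hVo⟩ := exists_localFrame hN hσ₁
  obtain ⟨u, hu, rfl⟩ := hW.exists_unitary hW₁ hU
  obtain ⟨v, hv, rfl⟩ := hV.exists_unitary hV₁ hT
  rw [frameMatrix_conjTranspose, frameMatrix_conjTranspose,
    hV₁.times hv.toIntertwines.star, hW.times hu.toIntertwines, frameMatrix_mul_theta]
  -- The transported frames lie in spacelike cones, so each endomorphism acts on the frame of the
  -- other through its unit only, and the frames commute. The flipped product frame is the product
  -- frame in the other order, and `θ` disappears.
  have h1 : (fun j => tensorFrame g₁ V₁ W₁ (finProdFinEquiv (finProdFinEquiv.symm j).swap)) =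
      tensorFrame f₁ W₁ V₁ := by
    funext j
    obtain ⟨⟨i, j⟩, rfl⟩ := finProdFinEquiv.surjective j
    rw [Equiv.symm_apply_apply, Prod.swap_prod_mk, tensorFrame_apply, tensorFrame_apply,
      hg₁.apply_eq ho (hWo j), hf₁.apply_eq ho.symm (hVo i), mul_assoc, mul_assoc, hV₁.left,
      hW₁.left, ObservableNet.commute_of_perp ho (hWo j) (hVo i)]
  rw [h1, frameMatrix_mul, (hW₁.tensor hV₁).sum, eps_eq_exchange hf hg ho hf₁ hg₁ hu hv, exchange]
  congr 1
  have h2 : (NonUnitalStarAlgHom.comp f₁ g₁) 1 * (u * f v) = u * f v :=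
    (hu.toIntertwines.times hv.toIntertwines).left
  rw [mul_assoc, h2]
  simp only [mul_assoc]

theorem IsFrame.exists_isExchange (hW : IsFrame ρ f W) (hV : IsFrame σ g V)
    (hf : IsLT f) (hg : IsLT g) : ∃ E, IsExchange ρ σ E := by
  have ho : Perp (remoteCone 0) (remoteCone 1) := perp_remoteCone zero_ne_one
  obtain ⟨f₁, u, hf₁, hu⟩ := hf.2 (remoteCone 0)
  obtain ⟨g₁, v, hg₁, hv⟩ := hg.2 (remoteCone 1)
  exact ⟨_, _, _, _, _, _, _, ho, localizedIn_endoBimodule hf₁, localizedIn_endoBimodule hg₁,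
    hW.isUnitary (isFrame_endoBimodule f₁) hu, hV.isUnitary (isFrame_endoBimodule g₁) hv, rfl⟩

theorem IsFrame.symmetry_eq [TopologicalSpace.SeparableSpace H]
    (hN : ∀ a, IsProperlyInfinite (N.alg a)) (hW : IsFrame ρ f W) (hV : IsFrame σ g V)
    (hf : IsLT f) (hg : IsLT g) :
    symmetry ρ σ = frameMatrix (tensorFrame g V W) (eps f g) (tensorFrame f W V) := by
  have h := hW.exists_isExchange hV hf hg
  rw [symmetry, dif_pos h]
  exact hW.isExchange_eq hN hV hf hg h.choose_spec

/-! ### The properties of objects in terms of frames -/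

theorem IsFrame.isIrreducible_iff (hW : IsFrame ρ f W) :
    IsIrreducible ρ ↔ ∀ t, Intertwines f f t → ∃ c : ℂ, t = c • f 1 := by
  refine ⟨fun h t ht => ?_, fun h T hT => ?_⟩
  · obtain ⟨c, hc⟩ := h _ (hW.isArrow hW ht)
    refine ⟨c, hW.frameMatrix_injective hW ?_ ?_ (hc.trans ?_)⟩
    · rw [ht.left, ht.right]
    · rw [mul_smul_comm, smul_mul_assoc, map_mul_one, map_mul_one]
    · rw [frameMatrix_smul, hW.unit_eq]
  · obtain ⟨t, ht, rfl⟩ := hW.exists_intertwiner hW hT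
    obtain ⟨c, rfl⟩ := h t ht
    exact ⟨c, by rw [frameMatrix_smul, hW.unit_eq]⟩

theorem IsFrame.isSimple_iff [TopologicalSpace.SeparableSpace H]
    (hN : ∀ a, IsProperlyInfinite (N.alg a)) (hW : IsFrame ρ f W) (hf : IsLT f) :
    IsSimple ρ ↔ ∃ c : ℂ, (c = 1 ∨ c = -1) ∧ eps f f = c • f (f 1) := by
  have hT := hW.tensor hW
  refine exists_congr fun c => and_congr_right fun _ => ?_
  rw [hW.symmetry_eq hN hW hf hf, hT.unit_eq, ← frameMatrix_smul]
  refine ⟨fun h => hT.frameMatrix_injective hT ?_ ?_ h, fun h => by rw [h]; rfl⟩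
  · have h1 : Intertwines (f.comp f) (f.comp f) (eps f f) := eps_intertwines hf hf
    rw [h1.left, h1.right]
  · change f.comp f 1 * (c • f.comp f 1) * f.comp f 1 = c • f.comp f 1
    rw [mul_smul_comm, smul_mul_assoc, map_mul_one, map_mul_one]

theorem IsFrame.isFaithful_iff (hW : IsFrame ρ f W) : IsFaithful ρ ↔ Function.Injective f := by
  refine ⟨fun h a b hab => h ?_, fun h a b hab => h ?_⟩
  · rw [hW.hom, hW.hom, hab]
  · rw [hW.map_eq, hW.map_eq, hab]

theorem IsFrame.isDoublyFaithful_iff {ρ : LTBimodule N} {W : Fin ρ.n → N.quasilocal}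
    (hW : IsFrame ρ.toBimodule f W) (hf : IsLT f) :
    ρ.IsDoublyFaithful ↔ IsDoublyFaithful f := by
  -- The extension has entries `(u W i)⁺ x (u W j)`, and the `u W i` form a frame for `f₁ 1`. So it
  -- kills `x` exactly if `f₁ 1 * x * f₁ 1 = 0`, that is, if `x * f₁ 1 = 0`, since `x` commutes with
  -- `f₁ 1`.
  have key : ∀ {o : DoubleCone} {f₁ : NetEndo N} {u : N.quasilocal}, LocalizedIn f₁ o →
      UnitaryEquiv f f₁ u → ∀ x ∈ (N.alg o).commutant, ∀ i j,
        ρ.toMorphism.presheafExt ρ.mem.2 o x i j =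
          star ((u * W i : N.quasilocal) : H →L[ℂ] H) * x *
            ((u * W j : N.quasilocal) : H →L[ℂ] H) := by
    intro o f₁ u hf₁ hu x hx i j
    have hU := isUnitaryIntertwiner_of_isUnitary (hW.isUnitary (isFrame_endoBimodule f₁) hu)
    have e : ∀ i, ((frameMatrix (fun _ => f₁ 1) u W (0 : Fin 1) i : N.quasilocal) : H →L[ℂ] H) =
        ((u * W i : N.quasilocal) : H →L[ℂ] H) := fun i => by
      rw [frameMatrix_apply, star_map_one, hu.left]
    rw [Morphism.presheafExt_eq _ ρ.mem.2 o hx (localizedIn_endoBimodule hf₁) hU, Matrix.mul_assoc,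
      Matrix.mul_apply]
    refine (Fin.sum_univ_one _).trans ?_
    rw [mul_assoc, ← e i, ← e j]
    exact congrArg _ (Morphism.amp_mul_apply _ _ _ _ _)
  constructor
  · intro h o f₁ u hf₁ hu x hx h0
    refine h o hx (zero_mem _) ?_
    ext1 i j
    rw [key hf₁ hu x hx, key hf₁ hu 0 (zero_mem _)]
    have e : x * ((u * W j : N.quasilocal) : H →L[ℂ] H) = 0 := by
      rw [← hu.left, mul_assoc, MulMemClass.coe_mul, ← mul_assoc, h0, zero_mul]
    rw [mul_assoc, e, mul_zero]
    exact (zero_mul _).symm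
  · intro h o x hx y hy hxy
    obtain ⟨f₁, u, hf₁, hu⟩ := hf.2 o
    rw [← sub_eq_zero]
    refine h o f₁ u hf₁ hu _ (sub_mem hx hy) ?_
    have e1 : ∀ i j, star ((u * W i : N.quasilocal) : H →L[ℂ] H) * (x - y) *
        ((u * W j : N.quasilocal) : H →L[ℂ] H) = 0 := fun i j => by
      rw [mul_sub, sub_mul, ← key hf₁ hu x hx, ← key hf₁ hu y hy, hxy, sub_self]
    have e2 : ∑ i, (u * W i) * star (u * W i) = f₁ 1 := by
      simp only [star_mul]
      calc _ = u * (∑ i, W i * star (W i)) * star u := by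
            simp only [Finset.mul_sum, Finset.sum_mul, mul_assoc]
        _ = f₁ 1 := by rw [hW.sum, hu.right, hu.mul_star_self]
    have e3 : ((f₁ 1 : N.quasilocal) : H →L[ℂ] H) =
        ∑ i, ((u * W i : N.quasilocal) : H →L[ℂ] H) *
          star ((u * W i : N.quasilocal) : H →L[ℂ] H) := by
      rw [← e2, AddSubmonoidClass.coe_finsetSum]
      rfl
    have e4 : ((f₁ 1 : N.quasilocal) : H →L[ℂ] H) * (x - y) *
        ((f₁ 1 : N.quasilocal) : H →L[ℂ] H) = 0 := by
      rw [e3, Finset.sum_mul, Finset.sum_mul]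
      refine Finset.sum_eq_zero fun i _ => ?_
      rw [Finset.mul_sum]
      refine Finset.sum_eq_zero fun j _ => ?_
      rw [← mul_assoc, mul_assoc (((u * W i : N.quasilocal) : H →L[ℂ] H)),
        mul_assoc (((u * W i : N.quasilocal) : H →L[ℂ] H)), e1, mul_zero, zero_mul]
    have e5 := VonNeumannAlgebra.mem_commutant_iff.1 (sub_mem hx hy) _ hf₁.one_mem
    have e6 : ((f₁ 1 : N.quasilocal) : H →L[ℂ] H) * ((f₁ 1 : N.quasilocal) : H →L[ℂ] H) =
        ((f₁ 1 : N.quasilocal) : H →L[ℂ] H) := congrArg Subtype.val (map_one_mul f₁ 1)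
    rwa [e5, mul_assoc, e6] at e4

/-! ### The representation of the permutation group in terms of frames -/

/-- The frames of the tensor powers. -/
def powerFrame (ρ : Bimodule N) (f : NetEndo N) (W : Fin ρ.n → N.quasilocal) :
    (d : ℕ) → Fin (Bimodule.power ρ d).n → N.quasilocal
  | 0 => fun _ => 1
  | d + 1 => tensorFrame (npow f d) (powerFrame ρ f W d) W

theorem IsFrame.isFrame_powerFrame (hW : IsFrame ρ f W) :
    ∀ d, IsFrame (Bimodule.power ρ d) (npow f d) (powerFrame ρ f W d)
  | 0 => isFrame_iota
  | d + 1 => (isFrame_powerFrame hW d).tensor hW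

theorem IsFrame.exchangeAt_eq [TopologicalSpace.SeparableSpace H]
    (hN : ∀ a, IsProperlyInfinite (N.alg a)) (hW : IsFrame ρ f W) (hf : IsLT f) {d i : ℕ}
    (h : i + 1 < d) : Bimodule.exchangeAt ρ d i = frameMatrix (powerFrame ρ f W d)
      (NetEndo.exchangeAt f d i) (powerFrame ρ f W d) := by
  induction d with
  | zero => omega
  | succ d ih =>
    obtain ⟨d, rfl⟩ : ∃ d', d = d' + 1 := ⟨d - 1, by omega⟩
    have hP := hW.isFrame_powerFrame d
    have hP' := hW.isFrame_powerFrame (d + 1)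
    by_cases hi : i = d
    · subst hi
      refine (if_pos rfl).trans ?_
      rw [hW.symmetry_eq hN hW hf hf, hP.unit_eq, hP.times (Intertwines.one _)]
      refine (recast_frameMatrix _ _ _ _ _).trans ?_
      have e1 : npow f i 1 * npow f i (eps f f) = NetEndo.exchangeAt f (i + 2) i := by
        rw [map_one_mul, NetEndo.exchangeAt, npow_succ_apply, npow_succ_apply, ← map_mul]
        congr 1
        exact ((eps_intertwines hf hf).right).symm
      rw [e1]
      -- The two ways of associating `f ^ i`, `f` and `f` give the same frame index by index, which
      -- is why `recast` does no harm.
      congr 1 <;> funext j <;> exact tensorFrame_assoc _ _ _ _ _ _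
    · refine (if_neg hi).trans ?_
      rw [ih (by omega), hW.unit_eq,
        hP'.times (exchangeAt_intertwines (d := d + 1) (i := i) hf (by omega))]
      congr 1
      rw [NetEndo.exchangeAt, NetEndo.exchangeAt, mul_assoc]
      congr 1
      exact npow_mul_unit (f := f) (m := d + 1) (d := d + 2) (by omega)

theorem IsFrame.permutationRep_eq [TopologicalSpace.SeparableSpace H]
    (hN : ∀ a, IsProperlyInfinite (N.alg a)) (hW : IsFrame ρ f W) (hf : IsLT f) {d : ℕ}
    {π : Equiv.Perm (Fin d) →
      Matrix (Fin (Bimodule.power ρ d).n) (Fin (Bimodule.power ρ d).n) N.quasilocal}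
    (hπ : IsPermutationRep ρ d π) (w : Equiv.Perm (Fin d)) :
    π w = frameMatrix (powerFrame ρ f W d) (permRep hf d w)
      (powerFrame ρ f W d) := by
  have hP := hW.isFrame_powerFrame d
  induction w using perm_induction with
  | one => rw [hπ.1, permRep_one, hP.unit_eq]
  | mul_swap w i h ih =>
    rw [hπ.2.1, ih, hπ.2.2 i h, hW.exchangeAt_eq hN hf h, permRep_mul, permRep_swap hf h,
      frameMatrix_mul, hP.sum, permRep_mul_unit]

theorem IsFrame.isPermutationRep [TopologicalSpace.SeparableSpace H]
    (hN : ∀ a, IsProperlyInfinite (N.alg a)) (hW : IsFrame ρ f W) (hf : IsLT f) (d : ℕ) :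
    IsPermutationRep ρ d fun w => frameMatrix (powerFrame ρ f W d)
      (permRep hf d w) (powerFrame ρ f W d) := by
  have hP := hW.isFrame_powerFrame d
  refine ⟨?_, fun p q => ?_, fun i h => ?_⟩ <;> beta_reduce
  · rw [permRep_one, hP.unit_eq]
  · rw [frameMatrix_mul, hP.sum, permRep_mul_unit, permRep_mul]
  · rw [permRep_swap hf h, hW.exchangeAt_eq hN hf h]

theorem antisymmetrizer_frameMatrix (hf : IsLT f) {d m : ℕ} (P : Fin m → N.quasilocal) :
    antisymmetrizer (fun w => frameMatrix P (permRep hf d w) P) =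
      frameMatrix P (altProj hf true d) P := by
  rw [antisymmetrizer, altProj, frameMatrix_smul, frameMatrix_sum]
  congr 1
  exact Finset.sum_congr rfl fun w _ => by rw [frameMatrix_smul]; rfl

theorem symmetrizer_frameMatrix (hf : IsLT f) {d m : ℕ} (P : Fin m → N.quasilocal) :
    symmetrizer (fun w => frameMatrix P (permRep hf d w) P) =
      frameMatrix P (altProj hf false d) P := by
  rw [symmetrizer, altProj, frameMatrix_smul, frameMatrix_sum]
  congr 1
  exact Finset.sum_congr rfl fun w _ => by rw [frameMatrix_smul]; exact (one_smul ℂ _).symm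

/-! ### The conjugate equations in terms of frames -/

/-- The index identifications respect the frames: reassociation by `tensorFrame_assoc`, and the
factors of multiplicity one because the frame of `ι` is `1`. The rest is that a frame matrix
determines its element. -/
theorem IsFrame.conjugateEquation_iff (hW : IsFrame ρ f W) (hV : IsFrame σ g V)
    {r r' : N.quasilocal} (hr : Intertwines (NonUnitalStarAlgHom.id ℂ N.quasilocal) (g.comp f) r)
    (hr' : Intertwines (NonUnitalStarAlgHom.id ℂ N.quasilocal) (f.comp g) r') :
    recast (Nat.mul_one ρ.n) (Nat.one_mul ρ.n)
      (Bimodule.times (Bimodule.tensor ρ σ)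
          (frameMatrix (tensorFrame f W V) r' fun _ : Fin 1 => 1)ᴴ ρ.unit *
        recast (m' := ρ.n * (Bimodule.tensor ρ σ).n) (Nat.mul_assoc ρ.n σ.n ρ.n) rfl
          (Bimodule.times ρ ρ.unit
            (frameMatrix (tensorFrame g V W) r fun _ : Fin 1 => 1))) = ρ.unit ↔
      star r' * f r = f 1 := by
  have hT := hW.tensor hV
  have e1 : star r' * f.comp g (f 1) * (f (g (f 1))) * (f 1 * f r) = star r' * f r := by
    rw [map_one_mul, NonUnitalStarAlgHom.comp_apply, mul_assoc (star r'), ← map_mul, ← map_mul,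
      ← map_mul, one_mul, mul_assoc, ← map_mul, show g (f 1) * r = r from hr.left]
  rw [frameMatrix_conjTranspose, hW.unit_eq, hT.times hr'.star, hW.times (Intertwines.one f),
    recast_frameMatrix]
  have e2 : (fun i : Fin (ρ.n * (Bimodule.tensor ρ σ).n) => tensorFrame f W (tensorFrame g V W)
      (Fin.cast (Nat.mul_assoc ρ.n σ.n ρ.n).symm i)) =
        tensorFrame (f.comp g) (tensorFrame f W V) W := by
    funext i
    exact tensorFrame_assoc _ _ _ _ _ _
  rw [e2, frameMatrix_mul, (hT.tensor hW).sum, recast_frameMatrix]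
  have e3 : (fun i => tensorFrame (NonUnitalStarAlgHom.id ℂ N.quasilocal) (fun _ : Fin 1 => 1) W
      (Fin.cast (Nat.mul_one ρ.n).symm i)) = W := by
    funext i
    have hi : Fin.cast (Nat.mul_one ρ.n).symm i = finProdFinEquiv (i, (0 : Fin 1)) :=
      Fin.ext (by simp [finProdFinEquiv])
    rw [hi, tensorFrame_apply]
    exact mul_one _
  have e4 : (fun i => tensorFrame f W (fun _ : Fin 1 => (1 : N.quasilocal))
      (Fin.cast (Nat.one_mul ρ.n).symm i)) = W := by
    funext i
    have hi : Fin.cast (Nat.one_mul ρ.n).symm i = finProdFinEquiv ((0 : Fin 1), i) :=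
      Fin.ext (by simp [finProdFinEquiv])
    rw [hi, tensorFrame_apply, hW.left]
  refine Iff.trans (Eq.congr ((congr (congrArg₂ frameMatrix e3 e1) e4)) rfl) ?_
  refine ⟨fun h => hW.frameMatrix_injective hW ?_ ?_ h, fun h => by rw [h]⟩
  · have e5 : f 1 * star r' = star r' * f (g (f 1)) := by
      have := congrArg star (hr'.comm (f 1))
      rw [star_mul, star_mul] at this
      change star (f 1) * star r' = star r' * star (f (g (f 1))) at this
      rwa [star_map_one, ← map_star, ← map_star, star_map_one] at this
    rw [← mul_assoc (f 1), e5, mul_assoc (star r'), ← map_mul, show g (f 1) * r = r from hr.left,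
      mul_assoc, map_mul_one]
  · rw [map_one_mul, map_one_mul]

end Frames
end Dictionary

section Conjugation

variable {N : ObservableNet H}

open Bimodule NetEndo LTBimodule

/-! ### Finite direct sums of objects with finite statistics have conjugates -/

theorem hasConjugates_of_halfConj {α : LTBimodule N} {f g : NetEndo N}
    {r r' : N.quasilocal} {W : Fin α.n → N.quasilocal} (hW : IsFrame α.toBimodule f W)
    (h : HalfConj f g r r') : hasConjugates N α := by
  obtain ⟨g, r, r', h, h'⟩ := h.exists_conjugate
  have hV := isFrame_endoBimodule g
  exact ⟨endoObject g h.lt, _, _, isFrame_iota.isArrow (hV.tensor hW) h.arrow,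
    isFrame_iota.isArrow (hW.tensor hV) h.arrow',
    (hW.conjugateEquation_iff hV h.arrow h.arrow').2 h.zigzag,
    (hV.conjugateEquation_iff hW h.arrow' h.arrow).2 h'⟩

variable [TopologicalSpace.SeparableSpace H]

theorem exists_halfConj_of_isStatisticsTriple [Nontrivial H]
    (hN : ∀ a, IsProperlyInfinite (N.alg a)) {ρ γ : LTBimodule N} {f : NetEndo N}
    {W : Fin ρ.n → N.quasilocal} (hW : IsFrame ρ.toBimodule f W) (hf : IsLT f)
    (hirr : IsIrreducible ρ.toBimodule) {d : ℕ}
    {V : Matrix (Fin (power ρ.toBimodule d).n) (Fin γ.n) N.quasilocal}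
    (h : IsStatisticsTriple ρ d γ V) (hγ : γ.IsDoublyFaithful) : ∃ g r r', HalfConj f g r r' := by
  obtain ⟨hd, hs, hi, hV, π, hπ, hVV⟩ := h
  obtain ⟨φ, X, hX, hφ⟩ := exists_frame hN γ
  have hP := hW.isFrame_powerFrame d
  obtain ⟨c, hc, hs⟩ := (hX.isSimple_iff hN hφ).1 hs
  obtain ⟨v, hv, hvv, rfl⟩ := hX.exists_isometry hP hV
  obtain rfl : π = fun w => frameMatrix (powerFrame ρ.toBimodule f W d) (permRep hf d w)
      (powerFrame ρ.toBimodule f W d) := funext fun w => hW.permutationRep_eq hN hf hπ w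
  rw [antisymmetrizer_frameMatrix, symmetrizer_frameMatrix, frameMatrix_conjTranspose,
    frameMatrix_mul, hX.sum, hv.right] at hVV
  have key : ∀ b, frameMatrix (powerFrame ρ.toBimodule f W d) (v * star v)
      (powerFrame ρ.toBimodule f W d) = frameMatrix (powerFrame ρ.toBimodule f W d)
      (altProj hf b d) (powerFrame ρ.toBimodule f W d) → v * star v = altProj hf b d := by
    intro b hb
    refine hP.frameMatrix_injective hP ?_ ?_ hb
    · have h1 := hv.mul hv.star
      rw [h1.left, h1.right]
    · have h1 := altProj_intertwines hf b d
      rw [h1.left, h1.right]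
  have hc' : c * c = 1 ∧ star c = c := by
    rcases hc with rfl | rfl <;> simp
  have hirr' := hW.isIrreducible_iff.1 hirr
  have hi' := hX.isFaithful_iff.1 hi
  have hγ' := (hX.isDoublyFaithful_iff hφ).1 hγ
  rcases hVV with hVV | hVV
  · exact exists_halfConj hN hf hirr' hφ hc'.1 hc'.2 hs hi' hγ' hd hv hvv (key true hVV)
  · exact exists_halfConj hN hf hirr' hφ hc'.1 hc'.2 hs hi' hγ' hd hv hvv (key false hVV)

/-- Half conjugates of the irreducible summands are added up first; a genuine conjugate is extracted
only at the end, for the whole sum. -/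
theorem hasConjugates_of_finiteHomogeneous [Nontrivial H]
    (hN : ∀ a, IsProperlyInfinite (N.alg a)) {α : LTBimodule N} (h : finiteHomogeneous N α) :
    hasConjugates N α := by
  obtain ⟨k, ρ, ⟨W, hW, hsum⟩, hρ⟩ := h
  obtain ⟨f, X, hX, -⟩ := exists_frame hN α
  choose F Y hY hF using fun i => exists_frame hN (ρ i)
  have hG : ∀ i, ∃ g r r', HalfConj (F i) g r r' := fun i => by
    obtain ⟨hirr, d, γ, V, hV, hγ⟩ := hρ i
    exact exists_halfConj_of_isStatisticsTriple hN (hY i) (hF i) hirr hV hγ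
  choose G r r' hG using hG
  choose w hw hww hWw using fun i => (hY i).exists_isometry hX (hW i)
  have hsum' : ∑ i, w i * star (w i) = f 1 := by
    refine hX.frameMatrix_injective hX ?_ ?_ ?_
    · have h1 : Intertwines f f (∑ i, w i * star (w i)) :=
        Intertwines.sum _ fun i _ => (hw i).mul (hw i).star
      rw [h1.left, h1.right]
    · rw [map_one_mul, map_one_mul]
    · rw [← hX.unit_eq, ← hsum, frameMatrix_sum]
      refine Finset.sum_congr rfl fun i _ => ?_
      rw [hWw, frameMatrix_conjTranspose, frameMatrix_mul, (hY i).sum, (hw i).right]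
  obtain ⟨g, s, s', h⟩ := exists_halfConj_of_sum hN hG hw hsum'
  exact hasConjugates_of_halfConj hX h

/-! ### Objects with conjugates are finite direct sums of objects with finite statistics -/

theorem exists_isStatisticsTriple [Nontrivial H] (hN : ∀ a, IsProperlyInfinite (N.alg a))
    {f g : NetEndo N} {r r' : N.quasilocal} (hf : IsLT f) (h : HalfConj f g r r')
    (hirr : ∀ t, Intertwines f f t → ∃ c : ℂ, t = c • f 1) (h1 : f 1 ≠ 0) :
    ∃ d γ V, IsStatisticsTriple (endoObject f hf) d γ V ∧ γ.IsDoublyFaithful := by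
  obtain ⟨b, d, hd, γ, hγ, ⟨c, hc, hs⟩, hi, hdf⟩ := h.exists_simple hf hirr h1
  have hγlt : IsLT γ := hγ ▸ (hf.npow d).sub
  have hγ1 : γ 1 = altProj hf b d := by rw [hγ, subEndo_one]
  have hv : Intertwines γ (npow f d) (altProj hf b d) := hγ ▸ intertwines_subEndo
  have hW := isFrame_endoBimodule f
  have hX := isFrame_endoBimodule γ
  have hP := hW.isFrame_powerFrame d
  refine ⟨d, endoObject γ hγlt, _, ⟨hd, (hX.isSimple_iff hN hγlt).2 ⟨c, hc, hs⟩,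
    hX.isFaithful_iff.2 hi, hX.isIsometry hP hv ?_, _, hW.isPermutationRep hN hf d, ?_⟩,
    (hX.isDoublyFaithful_iff (ρ := endoObject γ hγlt) hγlt).2 hdf⟩
  · rw [star_altProj, altProj_mul_self, hγ1]
  · have key : ∀ {m : ℕ} (P : Fin m → N.quasilocal),
        frameMatrix P (altProj hf b d) (fun _ : Fin (endoBimodule γ).n => γ 1) *
          (frameMatrix P (altProj hf b d) fun _ : Fin (endoBimodule γ).n => γ 1)ᴴ =
        frameMatrix P (altProj hf b d) P := fun P => by
      rw [frameMatrix_conjTranspose, frameMatrix_mul, hX.sum, hv.right, star_altProj,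
        altProj_mul_self]
    cases b
    · exact Or.inr ((key _).trans (symmetrizer_frameMatrix hf _).symm)
    · exact Or.inl ((key _).trans (antisymmetrizer_frameMatrix hf _).symm)

/-- One conjugate equation suffices: it bounds the orthogonal families of intertwiners, and it
passes to the irreducible subobjects cut out by the minimal projections (`HalfConj.sub`). -/
theorem finiteHomogeneous_of_hasConjugates [Nontrivial H]
    (hN : ∀ a, IsProperlyInfinite (N.alg a)) {α : LTBimodule N} (h : hasConjugates N α) :
    finiteHomogeneous N α := by
  obtain ⟨σ, R, R', hR, hR', hRR, -⟩ := h
  obtain ⟨f, W, hW, hf⟩ := exists_frame hN α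
  obtain ⟨g, V, hV, hg⟩ := exists_frame hN σ
  obtain ⟨r, hr, rfl⟩ := isFrame_iota.exists_intertwiner (hV.tensor hW) hR
  obtain ⟨r', hr', rfl⟩ := isFrame_iota.exists_intertwiner (hW.tensor hV) hR'
  have hfg : HalfConj f g r r' :=
    ⟨hg, hr, hr', (hW.conjugateEquation_iff hV hr hr').1 hRR⟩
  obtain ⟨k, e, he, hs, hi, h0, hsum, hirr⟩ := hfg.exists_decomposition
  have hlt : ∀ i, IsLT (subEndo f (e i) (he i) (hs i) (hi i)) := fun i => hf.sub
  have hirr' := fun i t ht => subEndo_irreducible (t := t) (he i) (hs i) (hi i) (hirr i) ht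
  refine ⟨k, fun i => endoObject _ (hlt i), ⟨fun i => frameMatrix W (e i) fun _ =>
    subEndo f (e i) (he i) (hs i) (hi i) 1, fun i => ?_, ?_⟩, fun i => ⟨?_, ?_⟩⟩
  · exact (isFrame_endoBimodule _).isIsometry hW intertwines_subEndo
      (by rw [hs, hi, subEndo_one])
  · rw [hW.unit_eq, ← hsum, frameMatrix_sum]
    refine Finset.sum_congr rfl fun i _ => ?_
    rw [frameMatrix_conjTranspose]
    refine frameMatrix_mul.trans ?_
    congr 1
    refine (congrArg (fun x => e i * x * star (e i))
      (isFrame_endoBimodule (subEndo f (e i) (he i) (hs i) (hi i))).sum).trans ?_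
    rw [subEndo_one, hs, hi, hi]
  · exact (isFrame_endoBimodule _).isIrreducible_iff.2 (hirr' i)
  · refine exists_isStatisticsTriple hN (hlt i) (hfg.sub (he i) (hs i) (hi i)) (hirr' i) ?_
    rw [subEndo_one]
    exact h0 i

end Conjugation

end Superselection

end

/-! ### Equality of the two full subcategories. -/

theorem theorem4p4 {H : Type*} [NormedAddCommGroup H] [InnerProductSpace ℂ H] [CompleteSpace H]
    [TopologicalSpace.SeparableSpace H] (hdim : ¬ FiniteDimensional ℂ H)
    (N : Superselection.ObservableNet H)
    (hN : ∀ a : Superselection.DoubleCone, Superselection.IsProperlyInfinite (N.alg a)) :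
    Superselection.LTBimodule.finiteHomogeneous N = Superselection.LTBimodule.hasConjugates N := by
  -- A nonzero space is what lets scalars be read off from multiples of `1`.
  have : Nontrivial H := not_subsingleton_iff_nontrivial.1 fun _ => hdim inferInstance
  funext α
  exact propext ⟨Superselection.hasConjugates_of_finiteHomogeneous hN,
    Superselection.finiteHomogeneous_of_hasConjugates hN⟩
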